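/- Conventions. A list $V=(v_1,\dots,v_n)$ of vectors in $\mathbb R^d$ may contain repetitions; $\dim$ of a list is the dimension of its linear span; a sublist (subset) of $V$ is obtained by keeping the entries at a subset of the indices, and its size is counted with multiplicity. A $3$-matching in $[n]$ is a set of pairwise disjoint $3$-element subsets of $[n]$. The list $V$ is a $(3,\delta)$-LCC, with decoding matchings $M_1,\dots,M_n$, if every $M_i$ is a $3$-matching in $[n]$ with $|M_i|\ge\delta n$ such that $v_i\in\mathrm{span}\{v_{j_1},v_{j_2},v_{j_3}\}$ for every $\{j_1,j_2,j_3\}\in M_i$. A triple $\tau\subset[n]$ is clustered by $S_1,\dots,S_m\subset[n]$ if $|\tau\cap S_k|\ge 2$ for some $k$. Lemma (Final clustering). There are absolute constants $A,a,B>0$ such that for every $\beta>0$ there is a constant $C=C(\beta)>0$ with the following property. Let $\delta>0$ and $n>(1/\delta)^{C}$, and let $V=(v_1,\dots,v_n)\in(\mathbb R^d)^n$ be a list spanning $\mathbb R^d$ that is a $(3,\delta)$-LCC, such that every sublist $U\subset V$ of size $|U|\ge(\delta^2/288)\,n$ satisfies $$\dim(U)\ \ge\ \max\{8\delta^6 d,\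 n^{1/2-\beta/4}\}.$$ Then there are a real number $\hat\delta\ge\delta^2/4$, a sublist $\hat V=(\hat v_1,\dots,\hat v_{\hat n})$ of $V$ of size $\hat n\ge(\delta/10)\,n$ and dimension $\hat d\le d$ that is a $(3,\hat\delta)$-LCC (in its span) with decoding matchings $\hat M_1,\dots,\hat M_{\hat n}$, a number $m$ and sets $S_1,\dots,S_m\subset[\hat n]$ such that 1. $|S_k|\le A\,\hat n/(\hat\delta^6\hat d)$ for all $k\in[m]$; 2. $a\,\hat\delta^{19}\hat d^3/\hat n^{1+2\beta}\ \le\ m\ \le\ B\,\hat n^{1+2\beta}/(\hat\delta^{10}\hat d)$; 3. every triple in each $\hat M_i$, $i\in[\hat n]$, is clustered by $S_1,\dots,S_m$. -/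

import Mathlib

/-- A `q`-matching in `ι`: a set of pairwise disjoint subsets of `ι`, each of size `q`. -/
def IsQMatching {ι : Type*} (q : ℕ) (M : Finset (Finset ι)) : Prop :=
  (∀ τ ∈ M, τ.card = q) ∧ (M : Set (Finset ι)).PairwiseDisjoint id

/-- The dimension of the span of the sublist of `v` indexed by `U`. -/
noncomputable def subDim {ι E : Type*} [AddCommGroup E] [Module ℝ E]
    (v : ι → E) (U : Finset ι) : ℕ :=
  Module.finrank ℝ (Submodule.span ℝ (v '' (U : Set ι)))

/-- The dimension of the span of the list `v`. -/
noncomputable def listDim {ι E : Type*} [AddCommGroup E] [Module ℝ E] (v : ι → E) : ℕ :=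
  Module.finrank ℝ (Submodule.span ℝ (Set.range v))

/-- `M i`, for `i : ι`, are decoding matchings which make the list `v` a linear `(q, δ)`-LCC
in geometric form: each `M i` is a `q`-matching in the index set, of size at least `δ n`, where
`n` is the length of the list, and every tuple in `M i` spans `v i`. There is one matching for
each index, so repeated vectors of the list may have different matchings. The list is
regarded as lying in its own span, a space of dimension `listDim v`. -/
structure IsDecoding {ι E : Type*} [Fintype ι] [AddCommGroup E] [Module ℝ E]
    (q : ℕ) (δ : ℝ) (v : ι → E) (M : ι → Finset (Finset ι)) : Prop where
  isQMatching : ∀ i, IsQMatching q (M i)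
  le_card : ∀ i, δ * (Fintype.card ι : ℝ) ≤ ((M i).card : ℝ)
  mem_span : ∀ i, ∀ τ ∈ M i, v i ∈ Submodule.span ℝ (v '' (τ : Set ι))

/-- The list `v` is a linear `(q, δ)`-LCC in geometric form (in the span of `v`). -/
def IsLCC {ι E : Type*} [Fintype ι] [AddCommGroup E] [Module ℝ E]
    (q : ℕ) (δ : ℝ) (v : ι → E) : Prop :=
  ∃ M : ι → Finset (Finset ι), IsDecoding q δ v M

/-- The tuple `τ` is clustered by `S 1, …, S m`: it meets some `S k` in at least two elements. -/
def IsClustered {ι : Type*} [DecidableEq ι] {m : ℕ} (S : Fin m → Finset ι)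
    (τ : Finset ι) : Prop :=
  ∃ k, 2 ≤ (τ ∩ S k).card

/-! Write `w = 8δ⁶d` and `s = 2n/w`. Robust dimension makes it possible to cover all but a few
indices by at most `n/w` bases of the ambient space. Almost minimizing a log-determinant potential
attached to these bases gives a linear change of coordinates after which the normalized vectors `u
a` satisfy `∑ ⟨u a, x⟩² ≤ s ‖x‖²` (`exists_isotropic_position`). Linear maps preserve decoding, so
nothing is lost.

In this position each vector has correlation at least 1/4 with at most `16 s` others. A unit vector
in the span of three weakly correlated unit vectors is correlated with one of the three, so all but
`16 s` triples of a decoding matching contain a correlated pair. Keeping only those triples leaves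
matchings of size at least `δn'/2`, and a graph `H` of correlated pairs with at most `16 s n'`
ordered edges (`exists_correlated_restriction`). It remains to cover `H` by few sets of size `O(s)`
and to compare their number with the required bounds.

The sparsity of `H` bounds `d`. Contracting an edge of `H` chosen by averaging merges a fixed
proportion of the classes of vectors, so about `(n log n)/(δ⁷d)` contractions leave almost nothing
(`ThinDecoding.finrank_span_le`). Together with `dim ≥ 8δ⁶d` this gives `d² ≤ n^(1+β/2)`.

For the cover, a symmetric part `F` of `H` has a nearly biregular piece, by dyadic pigeonholing of
degrees. On it the two-step random walk, signed by the correlations, has a large quadratic form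
against the Gram matrix. Cauchy–Schwarz transfers this to powers `2^l`, and near-isotropy then
forces the rows of the unsigned walk to have squared norm about `1/s`, up to small losses. Hence
over `2^l` steps the norm cannot always decay quickly. At a step of slow decay some row has large
energy, and a level set of that row, cut to size about `s`, spans many edges
(`NearlyBiregular.exists_dense`). Thus `F` always has a set `X` with `|X| = O(s)` and at least
`n^(-β)|X||F|/n` edges inside. Greedy removal of such sets has harmonic total cost, and merging
small sets yields at most `1 + n^β n'/s` sets (`exists_cover_of_correlated`).

The lower bound on the number of sets holds because `m` sets of size `8 s` can meet only `8 s m`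
disjoint triples. For `β ≥ 1` the permitted number of sets is so large that all pairs of indices
suffice (`exists_clustering_of_one_le`). -/

open Matrix Finset

/-! ### Approximate radial isotropic position -/

/-- The matrix determinant lemma for a multiple of `x xᵀ`. -/
theorem det_add_smul_vecMulVec_self {m : Type*} [Fintype m] [DecidableEq m] {A : Matrix m m ℝ}
    (hA : IsUnit A.det) (c : ℝ) (x : m → ℝ) :
    (A + c • vecMulVec x x).det = A.det * (1 + c * (x ⬝ᵥ A⁻¹ *ᵥ x)) := by
  have h : c • vecMulVec x x = vecMulVec (c • x) x := by
    ext i j; simp [vecMulVec_apply, mul_assoc]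
  have h2 : (replicateRow Unit x * A⁻¹ * replicateCol Unit (c • x)) default default =
      (x ᵥ* A⁻¹) ⬝ᵥ (c • x) := rfl
  rw [h, vecMulVec_eq Unit, det_add_replicateCol_mul_replicateRow hA]
  congr 1
  rw [det_unique, Matrix.add_apply, h2, dotProduct_smul, ← dotProduct_mulVec, smul_eq_mul,
    Matrix.one_apply_eq]

theorem posSemidef_vecMulVec_self {m : Type*} [Fintype m] (x : m → ℝ) :
    (vecMulVec x x).PosSemidef := by
  simpa using posSemidef_vecMulVec_self_star x

/-- By the determinant lemma each rank-one term multiplies the determinant by `1 + c (x ⬝ᵥ A⁻¹ *ᵥ x)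
≥ 1`. This compares the full moment matrix with that of a single basis. -/
theorem Matrix.PosDef.add_sum_vecMulVec {m ι : Type*} [Fintype m] [DecidableEq m]
    {A : Matrix m m ℝ} (hA : A.PosDef) (v : ι → m → ℝ) (c : ι → ℝ) (hc : ∀ i, 0 ≤ c i)
    (s : Finset ι) :
    (A + ∑ i ∈ s, c i • vecMulVec (v i) (v i)).PosDef ∧
      A.det ≤ (A + ∑ i ∈ s, c i • vecMulVec (v i) (v i)).det := by
  classical
  induction s using Finset.induction_on with
  | empty => simpa using hA
  | insert i s hi ih =>
    obtain ⟨h1, h2⟩ := ih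
    have e : A + ∑ j ∈ insert i s, c j • vecMulVec (v j) (v j) =
        (A + ∑ j ∈ s, c j • vecMulVec (v j) (v j)) + c i • vecMulVec (v i) (v i) := by
      rw [Finset.sum_insert hi]; abel
    rw [e]
    refine ⟨h1.add_posSemidef ((posSemidef_vecMulVec_self (v i)).smul (hc i)), ?_⟩
    rw [det_add_smul_vecMulVec_self h1.det_pos.ne'.isUnit]
    have h3 : 0 ≤ v i ⬝ᵥ (A + ∑ j ∈ s, c j • vecMulVec (v j) (v j))⁻¹ *ᵥ v i := by
      simpa using h1.inv.posSemidef.dotProduct_mulVec_nonneg (v i)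
    have h4 := mul_nonneg (hc i) h3
    nlinarith [h1.det_pos]

theorem sum_smul_vecMulVec_eq {m ι : Type*} [Fintype m] [DecidableEq m] [Fintype ι]
    [DecidableEq ι] (v : ι → m → ℝ) (c : ι → ℝ) :
    ∑ i, c i • vecMulVec (v i) (v i) = (of v)ᵀ * diagonal c * of v := by
  ext a b
  rw [Matrix.mul_apply]
  simp only [Matrix.sum_apply, Matrix.smul_apply, vecMulVec_apply, smul_eq_mul,
    mul_diagonal, transpose_apply, of_apply]
  exact Finset.sum_congr rfl fun i _ => by ring

/-- A basis of `ℝ^d` among the vectors bounds the determinant of a moment matrix from below. -/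
theorem posDef_moment_and_le_det {ι : Type*} [Fintype ι] [DecidableEq ι] {d : ℕ}
    (v : ι → Fin d → ℝ) {B : Finset ι} (hcard : B.card = d) (hB : LinearIndepOn ℝ v (B : Set ι)) :
    ∃ c : ℝ, 0 < c ∧ ∀ t : ι → ℝ,
      (∑ i, Real.exp (t i) • vecMulVec (v i) (v i)).PosDef ∧
      c * Real.exp (∑ i ∈ B, t i) ≤ (∑ i, Real.exp (t i) • vecMulVec (v i) (v i)).det := by
  let f : Fin d ≃ B := (Fintype.equivFinOfCardEq (by simpa using hcard)).symm
  let M : Matrix (Fin d) (Fin d) ℝ := of fun j => v (f j)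
  have hM : IsUnit M := by
    rw [← linearIndependent_rows_iff_isUnit]
    exact LinearIndependent.comp hB f f.injective
  have hdet : M.det ≠ 0 := ((Matrix.isUnit_iff_isUnit_det _).1 hM).ne_zero
  refine ⟨M.det ^ 2, by positivity, fun t => ?_⟩
  have hsum : ∑ i ∈ B, Real.exp (t i) • vecMulVec (v i) (v i) =
      Mᵀ * diagonal (fun j => Real.exp (t (f j))) * M := by
    rw [← sum_smul_vecMulVec_eq (fun j => v (f j)) (fun j => Real.exp (t (f j))),
      Fintype.sum_equiv f (g := fun b : B => Real.exp (t b) • vecMulVec (v b) (v b)) _ (fun _ => rfl),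
      Finset.sum_coe_sort B (fun b => Real.exp (t b) • vecMulVec (v b) (v b))]
  have hpd : (∑ i ∈ B, Real.exp (t i) • vecMulVec (v i) (v i)).PosDef := by
    rw [hsum]
    exact (PosDef.diagonal fun j => Real.exp_pos _).conjTranspose_mul_mul_same
      (Matrix.mulVec_injective_iff_isUnit.2 hM)
  have key := hpd.add_sum_vecMulVec v (fun i => Real.exp (t i)) (fun i => (Real.exp_pos _).le) Bᶜ
  rw [Finset.sum_add_sum_compl] at key
  refine ⟨key.1, le_trans (le_of_eq ?_) key.2⟩
  rw [hsum, det_mul, det_mul, det_transpose, det_diagonal, ← Real.exp_sum,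
    Fintype.sum_equiv f (g := fun b : B => t b) _ (fun _ => rfl), Finset.sum_coe_sort B t]
  ring

/-- An approximate form of Barthe's theorem on radial isotropic position. -/
theorem exists_isotropic_transform {ι : Type*} [Fintype ι] [DecidableEq ι] {d : ℕ}
    (v : ι → Fin d → ℝ) (Bs : Finset (Finset ι)) (hne : Bs.Nonempty)
    (hB : ∀ B ∈ Bs, B.card = d ∧ LinearIndepOn ℝ v (B : Set ι)) :
    ∃ T : Matrix (Fin d) (Fin d) ℝ, IsUnit T ∧
      ∀ G : Finset ι, (∀ i ∈ G, ∃ B ∈ Bs, i ∈ B) → ∀ w : Fin d → ℝ,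
        ∑ i ∈ G, (T *ᵥ v i ⬝ᵥ w) ^ 2 / (T *ᵥ v i ⬝ᵥ T *ᵥ v i) ≤ 2 * Bs.card * (w ⬝ᵥ w) := by
  classical
  set A : (ι → ℝ) → Matrix (Fin d) (Fin d) ℝ :=
    fun t => ∑ i, Real.exp (t i) • vecMulVec (v i) (v i) with hA
  have hpd : ∀ t, (A t).PosDef := by
    obtain ⟨B, hBs⟩ := hne
    obtain ⟨c, -, h⟩ := posDef_moment_and_le_det v (hB B hBs).1 (hB B hBs).2
    exact fun t => (h t).1
  have hlow : ∀ B ∈ Bs, ∃ c : ℝ, ∀ t, c ≤ Real.log (A t).det - ∑ i ∈ B, t i := by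
    intro B hBs
    obtain ⟨c, hc, h⟩ := posDef_moment_and_le_det v (hB B hBs).1 (hB B hBs).2
    refine ⟨Real.log c, fun t => ?_⟩
    have := Real.log_le_log (by positivity) (h t).2
    rw [Real.log_mul hc.ne' (Real.exp_pos _).ne', Real.log_exp] at this
    linarith
  choose! c hc using hlow
  let f : (ι → ℝ) → ℝ := fun t => ∑ B ∈ Bs, (Real.log (A t).det - ∑ i ∈ B, t i)
  have hbdd : BddBelow (Set.range f) :=
    ⟨∑ B ∈ Bs, c B, by rintro _ ⟨t, rfl⟩; exact Finset.sum_le_sum fun B hBs => hc B hBs t⟩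
  -- The infimum need not be attained, so a point within 1/10 of it replaces the minimizer in
  -- Barthe's argument.
  obtain ⟨_, ⟨t, rfl⟩, ht⟩ := Real.lt_sInf_add_pos (Set.range_nonempty f) (show (0 : ℝ) < 1 / 10 by norm_num)
  have hmin : ∀ t', f t - 1 / 10 ≤ f t' := fun t' => by
    have := csInf_le hbdd ⟨t', rfl⟩
    linarith
  have hN : (0 : ℝ) < Bs.card := by exact_mod_cast hne.card_pos
  -- The quantity on the right is the leverage score of `v i`. Raising `t i` by 1 lowers the
  -- potential by at least 1 through the bases containing `i`, so near-minimality forces the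
  -- log-determinants to grow.
  have hp : ∀ i, (∃ B ∈ Bs, i ∈ B) →
      1 / (2 * Bs.card) ≤ Real.exp (t i) * (v i ⬝ᵥ (A t)⁻¹ *ᵥ v i) := by
    rintro i ⟨B₀, hB₀, hi⟩
    set p := Real.exp (t i) * (v i ⬝ᵥ (A t)⁻¹ *ᵥ v i) with hpdef
    have hp0 : 0 ≤ p := mul_nonneg (Real.exp_pos _).le
      (by simpa using (hpd t).inv.posSemidef.dotProduct_mulVec_nonneg (v i))
    have hA' : A (Function.update t i (t i + 1)) =
        A t + ((Real.exp 1 - 1) * Real.exp (t i)) • vecMulVec (v i) (v i) := by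
      simp only [hA]
      rw [← Finset.add_sum_erase _ _ (Finset.mem_univ i),
        ← Finset.add_sum_erase _ (fun i => Real.exp (t i) • vecMulVec (v i) (v i)) (Finset.mem_univ i),
        Finset.sum_congr rfl (g := fun i => Real.exp (t i) • vecMulVec (v i) (v i))]
      · rw [Function.update_self, Real.exp_add, add_right_comm, ← add_smul]
        congr 2; ring
      · intro j hj
        rw [Function.update_of_ne (Finset.ne_of_mem_erase hj)]
    have hdet : (A (Function.update t i (t i + 1))).det =
        (A t).det * (1 + (Real.exp 1 - 1) * p) := by
      rw [hA', det_add_smul_vecMulVec_self (hpd t).det_pos.ne'.isUnit, hpdef, mul_assoc]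
    have he : Real.exp 1 - 1 < 1.72 := by linarith [Real.exp_one_lt_d9]
    have he0 : 0 < Real.exp 1 - 1 := by linarith [Real.add_one_le_exp (1 : ℝ)]
    have hlog : Real.log (A (Function.update t i (t i + 1))).det ≤
        Real.log (A t).det + 1.72 * p := by
      rw [hdet, Real.log_mul (hpd t).det_pos.ne' (by positivity)]
      have := Real.log_le_sub_one_of_pos (show 0 < 1 + (Real.exp 1 - 1) * p by positivity)
      nlinarith
    have hf : f (Function.update t i (t i + 1)) ≤ f t + (Bs.card * (1.72 * p) - 1) := by
      have hterm : ∀ B ∈ Bs, Real.log (A (Function.update t i (t i + 1))).det -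
          ∑ j ∈ B, Function.update t i (t i + 1) j ≤
          (Real.log (A t).det - ∑ j ∈ B, t j) + (1.72 * p - if B = B₀ then 1 else 0) := by
        intro B _
        have hs : ∑ j ∈ B, t j + (if i ∈ B then 1 else 0) =
            ∑ j ∈ B, Function.update t i (t i + 1) j := by
          rw [← Finset.sum_ite_eq B i (fun _ => (1 : ℝ)), ← Finset.sum_add_distrib]
          refine Finset.sum_congr rfl fun j _ => ?_
          by_cases h : i = j
          · subst h; simp
          · rw [Function.update_of_ne (Ne.symm h)]; simp [h]
        have : (if B = B₀ then (1 : ℝ) else 0) ≤ if i ∈ B then 1 else 0 := by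
          by_cases h : B = B₀
          · subst h; simp [hi]
          · rw [if_neg h]; positivity
        linarith
      calc f (Function.update t i (t i + 1)) ≤ _ := Finset.sum_le_sum hterm
        _ = f t + (Bs.card * (1.72 * p) - 1) := by
          rw [Finset.sum_add_distrib, Finset.sum_sub_distrib (fun _ => 1.72 * p)]
          simp only [f, Finset.sum_const, nsmul_eq_mul, Finset.sum_ite_eq', hB₀, if_true]
    -- Near-minimality gives `1.72 p N ≥ 9/10`, where `N` is the number of bases; since `0.9 / 1.72
    -- > 1/2`, this yields `p ≥ 1 / (2N)`.
    have := hmin (Function.update t i (t i + 1))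
    rw [div_le_iff₀ (by positivity)]
    nlinarith
  obtain ⟨T, hT⟩ : ∃ T : Matrix (Fin d) (Fin d) ℝ, (A t)⁻¹ = Tᵀ * T := by
    have h := (hpd t).inv.posSemidef
    open scoped MatrixOrder in
    obtain ⟨T, hT⟩ := CStarAlgebra.nonneg_iff_eq_star_mul_self.mp h.nonneg
    exact ⟨T, by rw [hT]; rfl⟩
  have hunit : IsUnit T := by
    have h1 : IsUnit (Tᵀ * T) := hT ▸ (hpd t).inv.isUnit
    rw [Matrix.isUnit_iff_isUnit_det, det_mul, IsUnit.mul_iff] at h1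
    exact (Matrix.isUnit_iff_isUnit_det _).2 h1.2
  have hquad : ∀ x, x ⬝ᵥ (A t)⁻¹ *ᵥ x = T *ᵥ x ⬝ᵥ T *ᵥ x := fun x => by
    rw [hT, ← mulVec_mulVec, dotProduct_mulVec, vecMul_transpose]
  have hTAT : T * A t * Tᵀ = 1 := by
    have h1 : IsUnit T.det := (Matrix.isUnit_iff_isUnit_det _).1 hunit
    have h2 : A t = T⁻¹ * Tᵀ⁻¹ := by
      rw [← Matrix.mul_inv_rev, ← hT, Matrix.nonsing_inv_nonsing_inv _ (hpd t).det_pos.ne'.isUnit]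
    rw [h2, ← Matrix.mul_assoc, Matrix.mul_nonsing_inv _ h1, Matrix.one_mul,
      Matrix.nonsing_inv_mul _ (by rwa [det_transpose])]
  -- The vectors `T *ᵥ v i` with weights `exp (t i)` are exactly isotropic; the lower bound on
  -- leverage scores lets these weights be replaced by the inverse squared norms.
  have hsum : ∀ w : Fin d → ℝ, ∑ i, Real.exp (t i) * (T *ᵥ v i ⬝ᵥ w) ^ 2 = w ⬝ᵥ w := by
    intro w
    have h1 : w ⬝ᵥ (T * A t * Tᵀ) *ᵥ w = w ⬝ᵥ w := by rw [hTAT, one_mulVec]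
    rw [← h1, ← mulVec_mulVec, ← mulVec_mulVec, dotProduct_mulVec, ← mulVec_transpose]
    simp only [hA, Matrix.sum_mulVec, dotProduct_sum, smul_mulVec, dotProduct_smul, smul_eq_mul]
    refine Finset.sum_congr rfl fun i _ => ?_
    have h2 : T *ᵥ v i ⬝ᵥ w = v i ⬝ᵥ Tᵀ *ᵥ w := by
      rw [dotProduct_mulVec, vecMul_transpose]
    rw [h2, vecMulVec_mulVec, dotProduct_comm (Tᵀ *ᵥ w)]
    simp [dotProduct_comm, sq]
  refine ⟨T, hunit, fun G hG w => ?_⟩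
  calc ∑ i ∈ G, (T *ᵥ v i ⬝ᵥ w) ^ 2 / (T *ᵥ v i ⬝ᵥ T *ᵥ v i)
      ≤ ∑ i ∈ G, 2 * Bs.card * (Real.exp (t i) * (T *ᵥ v i ⬝ᵥ w) ^ 2) := by
        refine Finset.sum_le_sum fun i hi => ?_
        have h1 := hp i (hG i hi)
        rw [hquad] at h1
        have h2 : 0 < T *ᵥ v i ⬝ᵥ T *ᵥ v i := by
          have h3 : 0 < 1 / (2 * (Bs.card : ℝ)) := by positivity
          exact pos_of_mul_pos_right (h3.trans_le h1) (Real.exp_pos _).le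
        rw [div_le_iff₀ h2]
        rw [div_le_iff₀ (by positivity)] at h1
        nlinarith [sq_nonneg (T *ᵥ v i ⬝ᵥ w)]
    _ ≤ ∑ i, 2 * Bs.card * (Real.exp (t i) * (T *ᵥ v i ⬝ᵥ w) ^ 2) :=
        Finset.sum_le_sum_of_subset_of_nonneg (Finset.subset_univ _) fun i _ _ => by positivity
    _ = 2 * Bs.card * (w ⬝ᵥ w) := by rw [← Finset.mul_sum, hsum]

/-- If every large sublist of a spanning list has dimension at least `w`, then few bases suffice
to cover most of the list. -/
theorem exists_bases_cover {ι E : Type*} [Fintype ι] [DecidableEq ι] [AddCommGroup E] [Module ℝ E]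
    [FiniteDimensional ℝ E] (v : ι → E) (hspan : Submodule.span ℝ (Set.range v) = ⊤) {w α : ℝ}
    (hw : 0 < w) (hdim : ∀ U : Finset ι, α ≤ (U.card : ℝ) → w ≤ (subDim v U : ℝ)) :
    ∃ Bs : Finset (Finset ι),
      (∀ B ∈ Bs, B.card = Module.finrank ℝ E ∧ LinearIndepOn ℝ v (B : Set ι)) ∧
      Bs.card * w ≤ ((Bs.biUnion id).card : ℝ) ∧ (((Bs.biUnion id)ᶜ).card : ℝ) < α := by
  classical
  let P : Finset (Finset ι) → Prop := fun Bs =>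
    (∀ B ∈ Bs, B.card = Module.finrank ℝ E ∧ LinearIndepOn ℝ v (B : Set ι)) ∧
      Bs.card * w ≤ ((Bs.biUnion id).card : ℝ)
  -- Take a largest admissible family. If the uncovered part had size at least `α`, a maximal
  -- independent subset of it would have at least `w` elements, and its extension to a basis could
  -- be added.
  obtain ⟨Bs, hBs, hmax⟩ := Finset.exists_max_image (Finset.univ.filter P) Finset.card
    ⟨∅, by simp [P]⟩
  simp only [Finset.mem_filter, Finset.mem_univ, true_and] at hBs hmax
  refine ⟨Bs, hBs.1, hBs.2, ?_⟩
  by_contra hcon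
  set R := (Bs.biUnion id)ᶜ with hR
  have hdimR := hdim R (not_lt.1 hcon)
  obtain ⟨I, hIR, -, hIspan, hI⟩ := exists_linearIndepOn_extension
    (K := ℝ) (v := v) (s := ∅) (t := (R : Set ι)) (linearIndepOn_empty ℝ v) (Set.empty_subset _)
  obtain ⟨B, -, hIB, hBspan, hB⟩ := exists_linearIndepOn_extension
    (K := ℝ) (v := v) (s := I) (t := Set.univ) hI (Set.subset_univ _)
  have hIcard : I.toFinset.card = subDim v R := by
    have h1 : Submodule.span ℝ (v '' (R : Set ι)) = Submodule.span ℝ (v '' I) :=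
      le_antisymm (Submodule.span_le.2 hIspan) (Submodule.span_mono (Set.image_mono hIR))
    rw [subDim, h1, Set.image_eq_range, finrank_span_eq_card hI, Set.toFinset_card]
  have hBcard : B.toFinset.card = Module.finrank ℝ E := by
    have h1 : Submodule.span ℝ (v '' B) = ⊤ := by
      rw [eq_top_iff, ← hspan, Submodule.span_le, ← Set.image_univ]
      exact hBspan
    rw [← finrank_top ℝ E, ← h1, Set.image_eq_range, finrank_span_eq_card hB, Set.toFinset_card]
  have hIpos : I.toFinset.Nonempty := by
    rw [← Finset.card_pos, hIcard]
    exact_mod_cast hw.trans_le hdimR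
  have hdisj : Disjoint (Bs.biUnion id) I.toFinset := by
    rw [Finset.disjoint_right]
    intro i hi
    have : i ∈ R := by exact_mod_cast hIR (Set.mem_toFinset.1 hi)
    exact Finset.mem_compl.1 (hR ▸ this)
  have hnot : B.toFinset ∉ Bs := by
    intro h
    obtain ⟨i, hi⟩ := hIpos
    refine Finset.disjoint_right.1 hdisj hi (Finset.mem_biUnion.2 ⟨_, h, ?_⟩)
    exact Set.mem_toFinset.2 (hIB (Set.mem_toFinset.1 hi))
  have hnew := hmax (insert B.toFinset Bs) ⟨?_, ?_⟩
  · rw [Finset.card_insert_of_notMem hnot] at hnew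
    omega
  · intro B' hB'
    rcases Finset.mem_insert.1 hB' with rfl | h
    · exact ⟨hBcard, by simpa using hB⟩
    · exact hBs.1 B' h
  · rw [Finset.card_insert_of_notMem hnot]
    have hsub : Bs.biUnion id ∪ I.toFinset ⊆ (insert B.toFinset Bs).biUnion id := by
      rw [Finset.biUnion_insert, Finset.union_comm]
      exact Finset.union_subset_union (Set.toFinset_mono hIB) subset_rfl
    have h2 := Finset.card_le_card hsub
    rw [Finset.card_union_of_disjoint hdisj, hIcard] at h2
    have h3 : ((Bs.biUnion id).card : ℝ) + subDim v R ≤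
        (((insert B.toFinset Bs).biUnion id).card : ℝ) := by exact_mod_cast h2
    push_cast
    linarith [hBs.2]

/-- A robustly high-dimensional list can be put in nearly isotropic position, up to a few vectors. -/
theorem exists_isotropic_position {ι : Type*} [Fintype ι] [DecidableEq ι] {d : ℕ}
    (v : ι → EuclideanSpace ℝ (Fin d)) (hspan : Submodule.span ℝ (Set.range v) = ⊤) {w α : ℝ}
    (hw : 0 < w) (hα : α ≤ Fintype.card ι)
    (hdim : ∀ U : Finset ι, α ≤ (U.card : ℝ) → w ≤ (subDim v U : ℝ)) :
    ∃ (T : EuclideanSpace ℝ (Fin d) →ₗ[ℝ] EuclideanSpace ℝ (Fin d)) (G : Finset ι),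
      Function.Injective T ∧ (Gᶜ.card : ℝ) < α ∧ (∀ i ∈ G, v i ≠ 0) ∧
      ∀ x, ∑ i ∈ G, inner ℝ (T (v i)) x ^ 2 / ‖T (v i)‖ ^ 2 ≤
        2 * Fintype.card ι / w * ‖x‖ ^ 2 := by
  obtain ⟨Bs, hB, hcard, hcompl⟩ := exists_bases_cover v hspan hw hdim
  have hne : Bs.Nonempty := by
    rw [Finset.nonempty_iff_ne_empty]
    rintro rfl
    rw [Finset.biUnion_empty, Finset.compl_empty, Finset.card_univ] at hcompl
    linarith
  obtain ⟨T, hT, hsum⟩ := exists_isotropic_transform (fun i => (v i).ofLp) Bs hne fun B hBs => by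
    refine ⟨by simpa using (hB B hBs).1, ?_⟩
    have := (hB B hBs).2.map_injOn (WithLp.linearEquiv 2 ℝ (Fin d → ℝ)).toLinearMap
      (WithLp.linearEquiv 2 ℝ (Fin d → ℝ)).injective.injOn
    exact this
  have hin : ∀ x y : EuclideanSpace ℝ (Fin d), inner ℝ x y = x.ofLp ⬝ᵥ y.ofLp := fun x y => by
    rw [EuclideanSpace.inner_eq_star_dotProduct, dotProduct_comm]; simp
  refine ⟨toEuclideanLin T, Bs.biUnion id, ?_, hcompl, ?_, fun x => ?_⟩
  · intro x y hxy
    have h1 : T *ᵥ x.ofLp = T *ᵥ y.ofLp := congrArg WithLp.ofLp hxy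
    exact WithLp.ofLp_injective 2 (Matrix.mulVec_injective_iff_isUnit.2 hT h1)
  · intro i hi
    obtain ⟨B, hBs, hiB⟩ := Finset.mem_biUnion.1 hi
    exact (hB B hBs).2.ne_zero hiB
  · have h1 := hsum (Bs.biUnion id) (fun i hi => by simpa using hi) x.ofLp
    have h2 : ∀ i, inner ℝ (toEuclideanLin T (v i)) x ^ 2 / ‖toEuclideanLin T (v i)‖ ^ 2 =
        (T *ᵥ (v i).ofLp ⬝ᵥ x.ofLp) ^ 2 / (T *ᵥ (v i).ofLp ⬝ᵥ T *ᵥ (v i).ofLp) := by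
      intro i
      rw [← real_inner_self_eq_norm_sq, hin, hin]; rfl
    rw [← real_inner_self_eq_norm_sq, hin x x, Finset.sum_congr rfl fun i _ => h2 i]
    refine h1.trans ?_
    have h3 : 0 ≤ x.ofLp ⬝ᵥ x.ofLp := by
      rw [← hin, real_inner_self_eq_norm_sq]; positivity
    refine mul_le_mul_of_nonneg_right ?_ h3
    rw [le_div_iff₀ hw, mul_assoc]
    have h4 : ((Bs.biUnion id).card : ℝ) ≤ Fintype.card ι := by
      exact_mod_cast Finset.card_le_univ _
    linarith

/-! ### Vectors in the span of weakly correlated triples -/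

/-- A nonzero combination of three nearly orthogonal unit vectors is correlated with one of them. -/
theorem eq_zero_of_weakly_correlated {E : Type*} [NormedAddCommGroup E] [InnerProductSpace ℝ E]
    {x y z p : E} (hx : ‖x‖ = 1) (hy : ‖y‖ = 1) (hz : ‖z‖ = 1)
    (hxy : |inner ℝ x y| < 1 / 4) (hxz : |inner ℝ x z| < 1 / 4) (hyz : |inner ℝ y z| < 1 / 4)
    (hpx : |inner ℝ p x| ≤ 1 / 4 * ‖p‖) (hpy : |inner ℝ p y| ≤ 1 / 4 * ‖p‖)
    (hpz : |inner ℝ p z| ≤ 1 / 4 * ‖p‖) (hp : p ∈ Submodule.span ℝ {x, y, z}) : p = 0 := by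
  obtain ⟨a, b, c, rfl⟩ := Submodule.mem_span_triple.1 hp
  set p := a • x + b • y + c • z with hpdef
  have e1 : ‖p‖ ^ 2 = a * inner ℝ p x + b * inner ℝ p y + c * inner ℝ p z := by
    rw [← real_inner_self_eq_norm_sq]
    conv_lhs => rw [hpdef, inner_add_left, inner_add_left, inner_smul_left, inner_smul_left,
      inner_smul_left, ← hpdef, real_inner_comm p x, real_inner_comm p y, real_inner_comm p z]
    simp
  have e2 : ‖p‖ ^ 2 = a ^ 2 + b ^ 2 + c ^ 2 + 2 * (a * b * inner ℝ x y) + 2 * (a * c * inner ℝ x z)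
      + 2 * (b * c * inner ℝ y z) := by
    rw [← real_inner_self_eq_norm_sq, hpdef]
    simp only [inner_add_left, inner_add_right, inner_smul_left, inner_smul_right,
      real_inner_self_eq_norm_sq, hx, hy, hz, real_inner_comm y x, real_inner_comm z x,
      real_inner_comm z y]
    simp
    ring
  have hb : ∀ s t r : ℝ, |r| < 1 / 4 → -(1 / 4 * (s ^ 2 + t ^ 2)) ≤ 2 * (s * t * r) := by
    intro s t r hr
    have h1 := abs_lt.1 hr
    nlinarith [sq_nonneg (s - t), sq_nonneg (s + t), mul_nonneg (sq_nonneg (s + t)) (by linarith : 0 ≤ 1/4 + r),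
      mul_nonneg (sq_nonneg (s - t)) (by linarith : 0 ≤ 1/4 - r)]
  -- Each square occurs in two cross terms, which cost at most `1/4` of it each.
  have h1 : a ^ 2 + b ^ 2 + c ^ 2 ≤ 2 * ‖p‖ ^ 2 := by
    linarith [hb a b _ hxy, hb a c _ hxz, hb b c _ hyz]
  have hl : ∀ s r : ℝ, |r| ≤ 1 / 4 * ‖p‖ → s * r ≤ s ^ 2 / 8 + ‖p‖ ^ 2 / 8 := by
    intro s r hr
    have h2 : r ^ 2 ≤ (1 / 4 * ‖p‖) ^ 2 := by
      rw [← sq_abs r]; exact pow_le_pow_left₀ (abs_nonneg _) hr 2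
    nlinarith [sq_nonneg (s - 4 * r)]
  have h2 := hl a _ hpx
  have h3 := hl b _ hpy
  have h4 := hl c _ hpz
  -- The bounds sum to `‖p‖² ≤ (a² + b² + c²)/8 + 3‖p‖²/8 ≤ (5/8)‖p‖²`.
  have h5 : ‖p‖ ^ 2 ≤ 0 := by nlinarith
  exact norm_eq_zero.1 (pow_eq_zero_iff two_ne_zero |>.1 (le_antisymm h5 (sq_nonneg _)))

/-! ### Dimension bound by contracting pairs -/

/-- Elements of `C` whose value under `φ` is `z`, or is attained twice, are counted half by
`φ(C) \ {z}`. -/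
theorem two_mul_card_image_erase_add_card_le {α γ : Type*} [DecidableEq α] [DecidableEq γ]
    (C : Finset α) (φ : α → γ) (z : γ) :
    2 * ((C.image φ).erase z).card +
      (C.filter fun X => φ X = z ∨ ∃ Y ∈ C, Y ≠ X ∧ φ Y = φ X).card ≤ 2 * C.card := by
  set H := C.filter fun X => φ X = z ∨ ∃ Y ∈ C, Y ≠ X ∧ φ Y = φ X with hH
  -- Argue fibre by fibre. A singleton fibre over `y ≠ z` has no element in `H`, and a fibre with `c
  -- ≥ 2` elements satisfies `2 + c ≤ 2c`.
  have key : ∀ y ∈ C.image φ, (if y = z then 0 else 2) + (H.filter fun X => φ X = y).card ≤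
      2 * (C.filter fun X => φ X = y).card := by
    intro y hy
    have hsub : H.filter (fun X => φ X = y) ⊆ C.filter fun X => φ X = y :=
      Finset.filter_subset_filter _ (Finset.filter_subset _ _)
    have hle := Finset.card_le_card hsub
    by_cases hyz : y = z
    · rw [if_pos hyz]; omega
    rw [if_neg hyz]
    obtain ⟨X, hX, hXy⟩ := Finset.mem_image.1 hy
    have hpos : 0 < (C.filter fun X => φ X = y).card :=
      Finset.card_pos.2 ⟨X, Finset.mem_filter.2 ⟨hX, hXy⟩⟩
    by_cases h1 : (C.filter fun X => φ X = y).card = 1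
    · obtain ⟨X₀, hX₀⟩ := Finset.card_eq_one.1 h1
      have : H.filter (fun X => φ X = y) = ∅ := by
        rw [Finset.eq_empty_iff_forall_notMem]
        intro X' hX'
        obtain ⟨hX'H, hX'y⟩ := Finset.mem_filter.1 hX'
        obtain ⟨hX'C, h | ⟨Y, hY, hne, hYX⟩⟩ := Finset.mem_filter.1 hX'H
        · exact hyz (hX'y ▸ h)
        · have a1 : X' ∈ C.filter fun X => φ X = y := Finset.mem_filter.2 ⟨hX'C, hX'y⟩
          have a2 : Y ∈ C.filter fun X => φ X = y := Finset.mem_filter.2 ⟨hY, hYX.trans hX'y⟩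
          rw [hX₀, Finset.mem_singleton] at a1 a2
          exact hne (a2.trans a1.symm)
      rw [this, h1]; simp
    · omega
  have hsum := Finset.sum_le_sum key
  rw [Finset.sum_add_distrib, ← Finset.mul_sum,
    ← Finset.card_eq_sum_card_fiberwise (fun X hX => Finset.mem_image_of_mem φ hX),
    ← Finset.card_eq_sum_card_fiberwise (s := H)
      (fun X hX => Finset.mem_image_of_mem φ (Finset.filter_subset _ _ hX))] at hsum
  have h2 : ∑ y ∈ C.image φ, (if y = z then 0 else 2) = 2 * ((C.image φ).erase z).card := by
    rw [← Finset.filter_ne', Finset.card_filter, Finset.mul_sum]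
    refine Finset.sum_congr rfl fun y _ => ?_
    by_cases h : y = z <;> simp [h]
  omega

section Restriction

variable {ι E : Type*} [Fintype ι] [AddCommGroup E] [Module ℝ E]

open Classical in
/-- The distinct lines spanned by the vectors of a list modulo the subspace `W`. -/
noncomputable def classesMod (v : ι → E) (W : Submodule ℝ E) : Finset (Submodule ℝ E) :=
  (univ.image fun i => W ⊔ Submodule.span ℝ {v i}).erase W

theorem mem_classesMod {v : ι → E} {W X : Submodule ℝ E} :
    X ∈ classesMod v W ↔ X ≠ W ∧ ∃ i, W ⊔ Submodule.span ℝ {v i} = X := by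
  simp [classesMod]

/-- One representative per class, together with `W`, spans the whole list. -/
theorem finrank_span_le_add_card_classesMod [FiniteDimensional ℝ E] (v : ι → E)
    (W : Submodule ℝ E) :
    Module.finrank ℝ (Submodule.span ℝ (Set.range v)) ≤
      Module.finrank ℝ W + (classesMod v W).card := by
  classical
  have hrep : ∀ X ∈ classesMod v W, ∃ x : E, W ⊔ Submodule.span ℝ {x} = X := fun X hX => by
    obtain ⟨-, i, hi⟩ := mem_classesMod.1 hX
    exact ⟨v i, hi⟩
  choose! r hr using hrep
  have hle : Submodule.span ℝ (Set.range v) ≤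
      W ⊔ Submodule.span ℝ (((classesMod v W).image r : Finset E) : Set E) := by
    rw [Submodule.span_le]
    rintro _ ⟨i, rfl⟩
    have hi : v i ∈ W ⊔ Submodule.span ℝ {v i} :=
      Submodule.mem_sup_right (Submodule.mem_span_singleton_self _)
    by_cases h : W ⊔ Submodule.span ℝ {v i} = W
    · rw [h] at hi; exact Submodule.mem_sup_left hi
    · have hm : W ⊔ Submodule.span ℝ {v i} ∈ classesMod v W := mem_classesMod.2 ⟨h, i, rfl⟩
      rw [← hr _ hm] at hi
      refine sup_le_sup_left (Submodule.span_mono ?_) W hi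
      rw [Set.singleton_subset_iff]
      exact_mod_cast Finset.mem_image_of_mem r hm
  refine (Submodule.finrank_mono hle).trans ((Submodule.finrank_add_le_finrank_add_finrank _ _).trans ?_)
  exact Nat.add_le_add_left ((finrank_span_finset_le_card _).trans Finset.card_image_le) _

/-- The pair `e` collapses the class `X` modulo `W`, or merges it with another class. -/
def Merges (v : ι → E) (W : Submodule ℝ E) (e : Finset ι) (X : Submodule ℝ E) : Prop :=
  X ⊔ (W ⊔ Submodule.span ℝ (v '' e)) = W ⊔ Submodule.span ℝ (v '' e) ∨
    ∃ Y ∈ classesMod v W, Y ≠ X ∧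
      Y ⊔ (W ⊔ Submodule.span ℝ (v '' e)) = X ⊔ (W ⊔ Submodule.span ℝ (v '' e))

-- The classes modulo the larger subspace are nontrivial images of the old classes. A merged class
-- dies or shares its image with another, so each such class saves at least one half.
open Classical in
theorem two_mul_card_classesMod_sup_add_le (v : ι → E) (W : Submodule ℝ E) (e : Finset ι) :
    2 * (classesMod v (W ⊔ Submodule.span ℝ (v '' e))).card +
      ((classesMod v W).filter (Merges v W e)).card ≤ 2 * (classesMod v W).card := by
  set W' := W ⊔ Submodule.span ℝ (v '' e) with hW'
  refine le_trans ?_ (two_mul_card_image_erase_add_card_le (classesMod v W) (· ⊔ W') W')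
  refine Nat.add_le_add (Nat.mul_le_mul_left _ (Finset.card_le_card ?_)) (le_of_eq ?_)
  · intro X hX
    obtain ⟨hne, i, rfl⟩ := mem_classesMod.1 hX
    have h1 : (W ⊔ Submodule.span ℝ {v i}) ⊔ W' = W' ⊔ Submodule.span ℝ {v i} := by
      rw [sup_right_comm, sup_eq_right.2 (le_sup_left : W ≤ W')]
    refine Finset.mem_erase.2 ⟨hne, Finset.mem_image.2 ⟨_, mem_classesMod.2 ⟨?_, i, rfl⟩, h1⟩⟩
    intro h
    rw [h, sup_eq_right.2 (le_sup_left : W ≤ W')] at h1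
    exact hne h1.symm
  · unfold Merges; congr!

/-- A decoding tuple made of a pair `e` and a third element outside the class of `v i` shows that
`e` merges the class of `v i`. -/
theorem merges_of_mem_span {v : ι → E} {W : Submodule ℝ E} {e : Finset ι} {i j : ι}
    (h : v i ∈ Submodule.span ℝ (v '' e) ⊔ Submodule.span ℝ {v j})
    (hj : W ⊔ Submodule.span ℝ {v j} ≠ W ⊔ Submodule.span ℝ {v i}) :
    Merges v W e (W ⊔ Submodule.span ℝ {v i}) := by
  unfold Merges
  set W' := W ⊔ Submodule.span ℝ (v '' e) with hW'
  have e1 : ∀ x : E, (W ⊔ Submodule.span ℝ {x}) ⊔ W' = W' ⊔ Submodule.span ℝ {x} := fun x => by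
    rw [sup_right_comm, sup_eq_right.2 (le_sup_left : W ≤ W')]
  have h' : v i ∈ W' ⊔ Submodule.span ℝ {v j} :=
    sup_le_sup_right (le_sup_right : Submodule.span ℝ (v '' e) ≤ W') _ h
  rw [e1]
  by_cases hi : v i ∈ W'
  · left
    exact sup_eq_left.2 ((Submodule.span_singleton_le_iff_mem _ _).2 hi)
  right
  refine ⟨W ⊔ Submodule.span ℝ {v j}, mem_classesMod.2 ⟨?_, j, rfl⟩, hj, ?_⟩
  · intro hW
    have : v j ∈ W := by
      rw [← hW]; exact Submodule.mem_sup_right (Submodule.mem_span_singleton_self _)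
    have h2 : Submodule.span ℝ {v j} ≤ W' :=
      (Submodule.span_singleton_le_iff_mem _ _).2 ((le_sup_left : W ≤ W') this)
    rw [sup_eq_left.2 h2] at h'
    exact hi h'
  · rw [e1]
    obtain ⟨a, ha, b, hb, hab⟩ := Submodule.mem_sup.1 h'
    obtain ⟨c, rfl⟩ := Submodule.mem_span_singleton.1 hb
    have hc : c ≠ 0 := by
      rintro rfl
      rw [zero_smul, add_zero] at hab
      exact hi (hab ▸ ha)
    refine le_antisymm (sup_le le_sup_left ?_) (sup_le le_sup_left ?_)
    · rw [Submodule.span_singleton_le_iff_mem]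
      have : v j = c⁻¹ • (-a) + c⁻¹ • v i := by
        rw [← hab, smul_add, smul_smul, inv_mul_cancel₀ hc, one_smul]; simp
      rw [this]
      exact Submodule.add_mem_sup (Submodule.smul_mem _ _ (Submodule.neg_mem _ ha))
        (Submodule.smul_mem _ _ (Submodule.mem_span_singleton_self _))
    · rwa [Submodule.span_singleton_le_iff_mem]

/-- The matchings `T i` decode `v` by triples containing a pair of `F`. -/
structure ThinDecoding (v : ι → E) (F : Finset (Finset ι)) (T : ι → Finset (Finset ι)) : Prop where
  card_pair : ∀ e ∈ F, e.card = 2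
  isQMatching : ∀ i, IsQMatching 3 (T i)
  mem_span : ∀ i, ∀ τ ∈ T i, v i ∈ Submodule.span ℝ (v '' (τ : Set ι))
  exists_pair : ∀ i, ∀ τ ∈ T i, ∃ e ∈ F, e ⊆ τ

-- Split each triple of `T i` as a pair of `F` and a third index `j`. If `j` is outside the class of
-- `v i`, the pair merges that class. Disjointness of the triples makes both the pairs and the third
-- indices distinct.
open Classical in
theorem ThinDecoding.card_le_card_merges_add [DecidableEq ι] {v : ι → E} {F : Finset (Finset ι)}
    {T : ι → Finset (Finset ι)} (h : ThinDecoding v F T) (W : Submodule ℝ E) (i : ι) :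
    (T i).card ≤ (F.filter fun e => Merges v W e (W ⊔ Submodule.span ℝ {v i})).card +
      (univ.filter fun j => W ⊔ Submodule.span ℝ {v j} = W ⊔ Submodule.span ℝ {v i}).card := by
  have hex : ∀ τ ∈ T i, ∃ e j, e ∈ F ∧ e ⊆ τ ∧ j ∈ τ ∧ τ = insert j e := by
    intro τ hτ
    obtain ⟨e, he, heτ⟩ := h.exists_pair i τ hτ
    have h1 : (τ \ e).card = 1 := by
      rw [Finset.card_sdiff_of_subset heτ, (h.isQMatching i).1 τ hτ, h.card_pair e he]
    obtain ⟨j, hj⟩ := Finset.card_eq_one.1 h1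
    refine ⟨e, j, he, heτ, ?_, ?_⟩
    · exact (Finset.mem_sdiff.1 (hj ▸ Finset.mem_singleton_self j)).1
    · rw [← Finset.sdiff_union_of_subset heτ, hj, Finset.insert_eq]
  have : Nonempty ι := ⟨i⟩
  choose! p j hpF hpτ hjτ hτeq using hex
  have hdisj : ∀ τ₁ ∈ T i, ∀ τ₂ ∈ T i, ∀ x, x ∈ τ₁ → x ∈ τ₂ → τ₁ = τ₂ := by
    intro τ₁ h₁ τ₂ h₂ x hx₁ hx₂
    by_contra hne
    exact Finset.disjoint_left.1 ((h.isQMatching i).2 h₁ h₂ hne) hx₁ hx₂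
  rw [← Finset.card_filter_add_card_filter_not (s := T i)
    (fun τ => W ⊔ Submodule.span ℝ {v (j τ)} = W ⊔ Submodule.span ℝ {v i}), add_comm]
  refine Nat.add_le_add (Finset.card_le_card_of_injOn p ?_ ?_) (Finset.card_le_card_of_injOn j ?_ ?_)
  · intro τ hτ
    obtain ⟨hτ, hne⟩ := Finset.mem_filter.1 hτ
    refine Finset.mem_coe.2 (Finset.mem_filter.2 ⟨hpF τ hτ, merges_of_mem_span ?_ hne⟩)
    have h1 := h.mem_span i τ hτ
    rw [hτeq τ hτ, Finset.coe_insert, Set.image_insert_eq, Submodule.span_insert, sup_comm] at h1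
    exact h1
  · intro τ₁ h₁ τ₂ h₂ h12
    have h₁ := (Finset.mem_filter.1 h₁).1
    have h₂ := (Finset.mem_filter.1 h₂).1
    have hne : (p τ₁).Nonempty := by
      rw [← Finset.card_pos, h.card_pair _ (hpF _ h₁)]; norm_num
    obtain ⟨x, hx⟩ := hne
    exact hdisj _ h₁ _ h₂ x (hpτ _ h₁ hx) (hpτ _ h₂ (h12 ▸ hx))
  · intro τ hτ
    exact Finset.mem_coe.2 (Finset.mem_filter.2 ⟨mem_univ _, (Finset.mem_filter.1 hτ).2⟩)
  · intro τ₁ h₁ τ₂ h₂ h12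
    have h₁ := (Finset.mem_filter.1 h₁).1
    have h₂ := (Finset.mem_filter.1 h₂).1
    exact hdisj _ h₁ _ h₂ _ (hjτ _ h₁) (h12 ▸ hjτ _ h₂)

/-- One step of the restriction: killing a suitable pair shrinks the number of classes. -/
theorem ThinDecoding.exists_pair_card_classesMod_le {v : ι → E} {F : Finset (Finset ι)}
    {T : ι → Finset (Finset ι)} (h : ThinDecoding v F T) {κ t : ℝ} (hκ : 0 < κ) (ht : 0 < t)
    (hT : ∀ i, κ * Fintype.card ι ≤ (T i).card) (hF : (F.card : ℝ) ≤ Fintype.card ι * t)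
    (W : Submodule ℝ E) (hW : 2 / κ < (classesMod v W).card) :
    ∃ e ∈ F, ((classesMod v (W ⊔ Submodule.span ℝ (v '' e))).card : ℝ) - 2 / κ ≤
      ((classesMod v W).card - 2 / κ) * (1 - κ / (4 * t)) := by
  classical
  set C := classesMod v W with hC
  set n : ℝ := (Fintype.card ι : ℝ) with hn
  have hCpos : 0 < C.card := by
    have : (0 : ℝ) < C.card := lt_trans (by positivity) hW
    exact_mod_cast this
  obtain ⟨X₀, hX₀⟩ := Finset.card_pos.1 hCpos
  obtain ⟨-, i₀, -⟩ := mem_classesMod.1 hX₀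
  have hn0 : 0 < n := by
    have : Nonempty ι := ⟨i₀⟩
    rw [hn]; exact_mod_cast Fintype.card_pos
  let cls : Submodule ℝ E → Finset ι := fun X => univ.filter fun j => W ⊔ Submodule.span ℝ {v j} = X
  have hclsum : ∑ X ∈ C, ((cls X).card : ℝ) ≤ n := by
    have h1 : (C.biUnion cls).card = ∑ X ∈ C, (cls X).card := by
      refine Finset.card_biUnion fun X _ Y _ hXY => ?_
      rw [Function.onFun, Finset.disjoint_left]
      intro j hj hj'
      exact hXY ((Finset.mem_filter.1 hj).2.symm.trans (Finset.mem_filter.1 hj').2)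
    rw [hn, ← Nat.cast_sum, ← h1]
    exact_mod_cast Finset.card_le_univ _
  have hlocal : ∀ X ∈ C, κ * n ≤ ((F.filter fun e => Merges v W e X).card : ℝ) + (cls X).card := by
    intro X hX
    obtain ⟨-, i, rfl⟩ := mem_classesMod.1 hX
    refine (hT i).trans ?_
    exact_mod_cast h.card_le_card_merges_add W i
  have hdouble : ∑ e ∈ F, ((C.filter (Merges v W e)).card : ℝ) =
      ∑ X ∈ C, ((F.filter fun e => Merges v W e X).card : ℝ) := by
    simp only [Finset.card_filter, Nat.cast_sum]
    exact Finset.sum_comm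
  -- Count pairs (edge, merged class) twice. The exceptional triples cost only `n` in total because
  -- the classes occupy disjoint sets of indices.
  have htot : C.card * (κ * n) - n ≤ ∑ e ∈ F, ((C.filter (Merges v W e)).card : ℝ) := by
    have := Finset.sum_le_sum hlocal
    rw [Finset.sum_add_distrib, Finset.sum_const, nsmul_eq_mul] at this
    linarith
  have hCk : 2 < C.card * κ := by rwa [div_lt_iff₀ hκ] at hW
  have hFne : F.Nonempty := by
    rw [Finset.nonempty_iff_ne_empty]
    rintro rfl
    rw [Finset.sum_empty] at htot
    nlinarith
  -- The threshold `2/κ` absorbs the loss of `n`: `|C|κ - 1 ≥ (|C|κ - 2)/2`. The shifted count `|C|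
  -- - 2/κ` then contracts geometrically.
  obtain ⟨e, heF, he⟩ : ∃ e ∈ F, (C.card - 2 / κ) * (κ / (2 * t)) ≤
      ((C.filter (Merges v W e)).card : ℝ) := by
    refine Finset.exists_le_of_sum_le hFne ?_
    rw [Finset.sum_const, nsmul_eq_mul]
    refine le_trans ?_ htot
    have h0 : 0 ≤ (C.card - 2 / κ) * (κ / (2 * t)) :=
      mul_nonneg (by linarith) (by positivity)
    calc F.card * ((C.card - 2 / κ) * (κ / (2 * t)))
        ≤ (n * t) * ((C.card - 2 / κ) * (κ / (2 * t))) := mul_le_mul_of_nonneg_right hF h0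
      _ = n * (C.card * κ - 2) / 2 := by field_simp
      _ ≤ C.card * (κ * n) - n := by nlinarith
  refine ⟨e, heF, ?_⟩
  have h2 := two_mul_card_classesMod_sup_add_le v W e
  have h3 : 2 * ((classesMod v (W ⊔ Submodule.span ℝ (v '' e))).card : ℝ) +
      ((C.filter (Merges v W e)).card : ℝ) ≤ 2 * C.card := by exact_mod_cast h2
  have h4 : (C.card - 2 / κ) * (κ / (4 * t)) = (C.card - 2 / κ) * (κ / (2 * t)) / 2 := by
    field_simp; ring
  rw [mul_sub, mul_one, h4]
  linarith

/-- A list decoded by few pairs has small dimension. -/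
theorem ThinDecoding.finrank_span_le [FiniteDimensional ℝ E] {v : ι → E} {F : Finset (Finset ι)}
    {T : ι → Finset (Finset ι)} (h : ThinDecoding v F T) {κ t : ℝ} (hκ : 0 < κ) (ht : 0 < t)
    (hκt : κ ≤ 4 * t) (hT : ∀ i, κ * Fintype.card ι ≤ (T i).card)
    (hF : (F.card : ℝ) ≤ Fintype.card ι * t) (q : ℕ)
    (hq : Fintype.card ι * (1 - κ / (4 * t)) ^ q ≤ 1) :
    (Module.finrank ℝ (Submodule.span ℝ (Set.range v)) : ℝ) ≤ 2 * q + 2 / κ + 1 := by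
  classical
  have hr : 0 ≤ 1 - κ / (4 * t) := by
    rw [sub_nonneg, div_le_one (by positivity)]; exact hκt
  have key : ∀ p : ℕ, ∃ W : Submodule ℝ E, Module.finrank ℝ W ≤ 2 * p ∧
      ((classesMod v W).card : ℝ) - 2 / κ ≤ Fintype.card ι * (1 - κ / (4 * t)) ^ p := by
    intro p
    induction p with
    | zero =>
      refine ⟨⊥, by simp, ?_⟩
      have h1 : (classesMod v (⊥ : Submodule ℝ E)).card ≤ Fintype.card ι :=
        ((Finset.card_le_card (Finset.erase_subset _ _)).trans Finset.card_image_le).trans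
          (by simp)
      have h2 : ((classesMod v (⊥ : Submodule ℝ E)).card : ℝ) ≤ Fintype.card ι := by
        exact_mod_cast h1
      have : 0 < 2 / κ := by positivity
      rw [pow_zero, mul_one]; linarith
    | succ p ih =>
      obtain ⟨W, hW1, hW2⟩ := ih
      by_cases hW : 2 / κ < (classesMod v W).card
      · obtain ⟨e, he, hle⟩ := h.exists_pair_card_classesMod_le hκ ht hT hF W hW
        refine ⟨W ⊔ Submodule.span ℝ (v '' e), ?_, hle.trans ?_⟩
        · refine (Submodule.finrank_add_le_finrank_add_finrank _ _).trans ?_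
          have h1 : Module.finrank ℝ (Submodule.span ℝ (v '' (e : Set ι))) ≤ 2 := by
            rw [← Finset.coe_image]
            refine (finrank_span_finset_le_card _).trans ?_
            exact Finset.card_image_le.trans (h.card_pair e he).le
          omega
        · rw [pow_succ, ← mul_assoc]
          exact mul_le_mul_of_nonneg_right hW2 hr
      -- At or below the threshold the left side is nonpositive, so no contraction is needed.
      · refine ⟨W, by omega, ?_⟩
        have : 0 ≤ Fintype.card ι * (1 - κ / (4 * t)) ^ (p + 1) := by positivity
        linarith
  obtain ⟨W, hW1, hW2⟩ := key q
  have h1 : (Module.finrank ℝ (Submodule.span ℝ (Set.range v)) : ℝ) ≤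
      Module.finrank ℝ W + (classesMod v W).card := by
    exact_mod_cast finrank_span_le_add_card_classesMod v W
  have h2 : (Module.finrank ℝ W : ℝ) ≤ 2 * q := by exact_mod_cast hW1
  linarith

end Restriction

/-! ### Powers of a signed matrix against the Gram matrix -/

section GramPowers

variable {ι E : Type*} [Fintype ι] [NormedAddCommGroup E] [InnerProductSpace ℝ E]

/-- The dual form of a Bessel-type inequality. -/
theorem norm_sq_sum_smul_le {u : ι → E} {s : ℝ} (hs0 : 0 ≤ s)
    (hs : ∀ w, ∑ a, inner ℝ (u a) w ^ 2 ≤ s * ‖w‖ ^ 2) (x : ι → ℝ) :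
    ‖∑ a, x a • u a‖ ^ 2 ≤ s * ∑ a, x a ^ 2 := by
  set w := ∑ a, x a • u a with hw
  have h1 : ‖w‖ ^ 2 = ∑ a, x a * inner ℝ (u a) w := by
    rw [← real_inner_self_eq_norm_sq]
    conv_lhs => rw [hw, sum_inner, ← hw]
    simp [inner_smul_left]
  have h2 : (‖w‖ ^ 2) ^ 2 ≤ (∑ a, x a ^ 2) * (s * ‖w‖ ^ 2) := by
    calc (‖w‖ ^ 2) ^ 2 ≤ (∑ a, x a ^ 2) * ∑ a, inner ℝ (u a) w ^ 2 := by
          rw [h1]; exact Finset.sum_mul_sq_le_sq_mul_sq _ _ _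
      _ ≤ _ := mul_le_mul_of_nonneg_left (hs w) (Finset.sum_nonneg fun _ _ => sq_nonneg _)
  rcases (sq_nonneg ‖w‖).eq_or_lt with h | h
  · rw [← h]
    exact mul_nonneg hs0 (Finset.sum_nonneg fun _ _ => sq_nonneg _)
  · nlinarith

/-- The quadratic form of the Gram matrix against the matrix `C`. -/
noncomputable def gramForm (u : ι → E) (C : Matrix ι ι ℝ) : ℝ :=
  ∑ a, inner ℝ (u a) (∑ b, C a b • u b)

variable [DecidableEq ι]

theorem gramForm_pow_two_mul (u : ι → E) {C : Matrix ι ι ℝ} (hC : C.IsSymm) (j : ℕ) :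
    gramForm u (C ^ (2 * j)) = ∑ a, ‖∑ b, (C ^ j) a b • u b‖ ^ 2 := by
  have hsymm : ∀ a b, (C ^ j) a b = (C ^ j) b a := fun a b => (hC.pow j).apply b a
  have e : ∀ a, ∑ b, (C ^ (2 * j)) a b • u b = ∑ c, (C ^ j) a c • ∑ b, (C ^ j) c b • u b := by
    intro a
    simp only [two_mul, pow_add, Matrix.mul_apply, Finset.sum_smul, Finset.smul_sum, smul_smul]
    exact Finset.sum_comm
  simp only [gramForm, e, inner_sum, inner_smul_right]
  rw [Finset.sum_comm]
  refine Finset.sum_congr rfl fun c _ => ?_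
  rw [← real_inner_self_eq_norm_sq, sum_inner]
  refine Finset.sum_congr rfl fun a _ => ?_
  rw [hsymm a c, inner_smul_left, inner_sum]
  simp [inner_smul_right]

/-- Induction by doubling the exponent. Cauchy–Schwarz over `A`, outside which the rows vanish,
bounds the square of the form at `j` by `A.card` times the form at `2 * j`. -/
theorem gramForm_pow_two_pow_ge {u : ι → E} (hu : ∀ a, ‖u a‖ = 1) {C : Matrix ι ι ℝ}
    (hC : C.IsSymm) {A : Finset ι} (hA : ∀ a ∉ A, ∀ b, C a b = 0) {κ : ℝ} (hκ : 0 ≤ κ)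
    (h1 : κ * A.card ≤ gramForm u C) (l : ℕ) :
    κ ^ 2 ^ l * A.card ≤ gramForm u (C ^ 2 ^ l) := by
  induction l with
  | zero => simpa using h1
  | succ l ih =>
    have hpow : ∀ a ∉ A, ∀ b, (C ^ 2 ^ l) a b = 0 := by
      intro a ha b
      obtain ⟨k, hk⟩ : ∃ k, 2 ^ l = k + 1 := ⟨2 ^ l - 1, by have := Nat.one_le_two_pow (n := l); omega⟩
      rw [hk, pow_succ', Matrix.mul_apply]
      exact Finset.sum_eq_zero fun c _ => by rw [hA a ha, zero_mul]
    set j := 2 ^ l with hj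
    have h2 : gramForm u (C ^ j) ^ 2 ≤ A.card * gramForm u (C ^ (2 * j)) := by
      rw [gramForm_pow_two_mul u hC]
      have e1 : gramForm u (C ^ j) = ∑ a ∈ A, inner ℝ (u a) (∑ b, (C ^ j) a b • u b) := by
        refine (Finset.sum_subset (Finset.subset_univ A) fun a _ ha => ?_).symm
        simp [hpow a ha]
      rw [e1]
      calc (∑ a ∈ A, inner ℝ (u a) (∑ b, (C ^ j) a b • u b)) ^ 2
          ≤ A.card * ∑ a ∈ A, inner ℝ (u a) (∑ b, (C ^ j) a b • u b) ^ 2 := sq_sum_le_card_mul_sum_sq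
        _ ≤ A.card * ∑ a ∈ A, ‖∑ b, (C ^ j) a b • u b‖ ^ 2 := by
          refine mul_le_mul_of_nonneg_left (Finset.sum_le_sum fun a _ => ?_) (Nat.cast_nonneg _)
          rw [← sq_abs]
          refine pow_le_pow_left₀ (abs_nonneg _) ?_ 2
          simpa [hu a] using abs_real_inner_le_norm (u a) (∑ b, (C ^ j) a b • u b)
        _ ≤ _ := by
          refine mul_le_mul_of_nonneg_left ?_ (Nat.cast_nonneg _)
          exact Finset.sum_le_sum_of_subset_of_nonneg (Finset.subset_univ _)
            fun _ _ _ => sq_nonneg _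
    rw [pow_succ, ← hj, mul_comm j 2]
    rcases (Nat.cast_nonneg (α := ℝ) A.card).eq_or_lt with h0 | h0
    · rw [← h0, mul_zero, gramForm_pow_two_mul u hC]
      exact Finset.sum_nonneg fun _ _ => sq_nonneg _
    · have h3 : (κ ^ j * A.card) ^ 2 ≤ gramForm u (C ^ j) ^ 2 :=
        pow_le_pow_left₀ (by positivity) ih 2
      have h4 : (A.card : ℝ) * (κ ^ (2 * j) * A.card) ≤ A.card * gramForm u (C ^ (2 * j)) := by
        refine le_trans (le_of_eq ?_) (h3.trans h2)
        rw [mul_comm 2 j, pow_mul]; ring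
      exact le_of_mul_le_mul_left h4 h0

theorem abs_pow_apply_le {C Q : Matrix ι ι ℝ} (h : ∀ a b, |C a b| ≤ Q a b) (j : ℕ) (a b : ι) :
    |(C ^ j) a b| ≤ (Q ^ j) a b := by
  induction j generalizing b with
  | zero =>
    rw [pow_zero, pow_zero, Matrix.one_apply]
    split_ifs <;> simp
  | succ j ih =>
    rw [pow_succ, pow_succ, Matrix.mul_apply, Matrix.mul_apply]
    refine (Finset.abs_sum_le_sum_abs _ _).trans (Finset.sum_le_sum fun c _ => ?_)
    rw [abs_mul]
    exact mul_le_mul (ih c) (h c b) (abs_nonneg _) ((abs_nonneg _).trans (ih c))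

/-- Correlation along the signed walk forces the unsigned walk to be concentrated. -/
theorem sum_sq_pow_ge {u : ι → E} (hu : ∀ a, ‖u a‖ = 1) {s : ℝ} (hs0 : 0 < s)
    (hs : ∀ w, ∑ a, inner ℝ (u a) w ^ 2 ≤ s * ‖w‖ ^ 2) {C Q : Matrix ι ι ℝ}
    (hC : C.IsSymm) {A : Finset ι} (hA : ∀ a ∉ A, ∀ b, C a b = 0)
    (hCQ : ∀ a b, |C a b| ≤ Q a b) {κ : ℝ} (hκ : 0 ≤ κ) (h1 : κ * A.card ≤ gramForm u C) (l : ℕ) :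
    κ ^ (2 * 2 ^ l) / s * A.card ≤ ∑ a ∈ A, ∑ b, (Q ^ 2 ^ l) a b ^ 2 := by
  have h2 := gramForm_pow_two_pow_ge hu hC hA hκ h1 (l + 1)
  -- The form at exponent `2^(l+1)` is a sum of squared norms at exponent `2^l`; the dual Bessel
  -- inequality bounds each by `s` times the squared row norm.
  rw [pow_succ 2 l, mul_comm (2 ^ l) 2, gramForm_pow_two_mul u hC] at h2
  rw [div_mul_eq_mul_div, div_le_iff₀ hs0]
  refine h2.trans ?_
  rw [Finset.sum_mul]
  have h3 : ∑ a ∈ A, ‖∑ b, (C ^ 2 ^ l) a b • u b‖ ^ 2 = ∑ a, ‖∑ b, (C ^ 2 ^ l) a b • u b‖ ^ 2 := by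
    refine Finset.sum_subset (Finset.subset_univ A) fun a _ ha => ?_
    obtain ⟨k, hk⟩ : ∃ k, 2 ^ l = k + 1 := ⟨2 ^ l - 1, by have := Nat.one_le_two_pow (n := l); omega⟩
    have : ∀ b, (C ^ 2 ^ l) a b = 0 := fun b => by
      rw [hk, pow_succ', Matrix.mul_apply]
      exact Finset.sum_eq_zero fun c _ => by rw [hA a ha, zero_mul]
    simp [this]
  rw [← h3]
  refine Finset.sum_le_sum fun a _ => (norm_sq_sum_smul_le hs0.le hs _).trans ?_
  rw [mul_comm]
  refine mul_le_mul_of_nonneg_right (Finset.sum_le_sum fun b _ => ?_) hs0.le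
  rw [← sq_abs]
  exact pow_le_pow_left₀ (abs_nonneg _) (abs_pow_apply_le hCQ _ a b) 2

end GramPowers

/-! ### Energy and the two-step walk -/

section Energy

variable {ι : Type*} [Fintype ι]

/-- The squared norm of `Rᵀ f`. -/
noncomputable def energy (R : Matrix ι ι ℝ) (f : ι → ℝ) : ℝ := ∑ b, (∑ a, R a b * f a) ^ 2

theorem energy_nonneg (R : Matrix ι ι ℝ) (f : ι → ℝ) : 0 ≤ energy R f :=
  Finset.sum_nonneg fun _ _ => sq_nonneg _

theorem energy_sum_le {γ : Type*} (R : Matrix ι ι ℝ) (s : Finset γ) (f : γ → ι → ℝ) :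
    energy R (∑ p ∈ s, f p) ≤ s.card * ∑ p ∈ s, energy R (f p) := by
  unfold energy
  rw [Finset.sum_comm, Finset.mul_sum]
  refine Finset.sum_le_sum fun b _ => ?_
  have : ∑ a, R a b * (∑ p ∈ s, f p) a = ∑ p ∈ s, ∑ a, R a b * f p a := by
    rw [Finset.sum_comm]
    exact Finset.sum_congr rfl fun a _ => by rw [Finset.sum_apply, Finset.mul_sum]
  rw [this]
  exact sq_sum_le_card_mul_sum_sq

theorem energy_add_le (R : Matrix ι ι ℝ) (f g : ι → ℝ) :
    energy R (f + g) ≤ 2 * energy R f + 2 * energy R g := by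
  unfold energy
  rw [Finset.mul_sum, Finset.mul_sum, ← Finset.sum_add_distrib]
  refine Finset.sum_le_sum fun b _ => ?_
  have : ∑ a, R a b * (f + g) a = ∑ a, R a b * f a + ∑ a, R a b * g a := by
    rw [← Finset.sum_add_distrib]
    exact Finset.sum_congr rfl fun a _ => by rw [Pi.add_apply]; ring
  rw [this]
  nlinarith [sq_nonneg (∑ a, R a b * f a - ∑ a, R a b * g a)]

theorem energy_mono {R : Matrix ι ι ℝ} (hR : ∀ a b, 0 ≤ R a b) {f g : ι → ℝ} (hf : ∀ a, 0 ≤ f a)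
    (hfg : ∀ a, f a ≤ g a) : energy R f ≤ energy R g := by
  refine Finset.sum_le_sum fun b _ => pow_le_pow_left₀ ?_ ?_ 2
  · exact Finset.sum_nonneg fun a _ => mul_nonneg (hR a b) (hf a)
  · exact Finset.sum_le_sum fun a _ => mul_le_mul_of_nonneg_left (hfg a) (hR a b)

theorem energy_smul (R : Matrix ι ι ℝ) (c : ℝ) (f : ι → ℝ) :
    energy R (fun a => c * f a) = c ^ 2 * energy R f := by
  unfold energy
  rw [Finset.mul_sum]
  refine Finset.sum_congr rfl fun b _ => ?_
  rw [← mul_pow, Finset.mul_sum]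
  exact congrArg (· ^ 2) (Finset.sum_congr rfl fun a _ => by ring)

/-- A nonnegative matrix with bounded row and column sums. -/
structure SumsBounded (R : Matrix ι ι ℝ) (T₁ T₂ : ℝ) : Prop where
  nonneg : ∀ a b, 0 ≤ R a b
  row : ∀ a, ∑ b, R a b ≤ T₁
  col : ∀ b, ∑ a, R a b ≤ T₂
  pos_left : 0 < T₁
  pos_right : 0 < T₂

variable {R : Matrix ι ι ℝ} {T₁ T₂ : ℝ}

theorem SumsBounded.transpose (h : SumsBounded R T₁ T₂) : SumsBounded Rᵀ T₂ T₁ :=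
  ⟨fun a b => h.nonneg b a, h.col, h.row, h.pos_right, h.pos_left⟩

/-- The Schur test. -/
theorem SumsBounded.energy_le (h : SumsBounded R T₁ T₂) (f : ι → ℝ) :
    energy R f ≤ T₁ * T₂ * ∑ a, f a ^ 2 := by
  calc energy R f ≤ ∑ b, T₂ * ∑ a, R a b * f a ^ 2 := by
        refine Finset.sum_le_sum fun b _ => ?_
        have h1 : (∑ a, R a b * f a) ^ 2 ≤ (∑ a, R a b) * ∑ a, R a b * f a ^ 2 := by
          refine Finset.sum_sq_le_sum_mul_sum_of_sq_le_mul _ (fun a _ => h.nonneg a b)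
            (fun a _ => mul_nonneg (h.nonneg a b) (sq_nonneg _)) fun a _ => le_of_eq (by ring)
        refine h1.trans (mul_le_mul_of_nonneg_right (h.col b) ?_)
        exact Finset.sum_nonneg fun a _ => mul_nonneg (h.nonneg a b) (sq_nonneg _)
    _ = T₂ * ∑ a, (∑ b, R a b) * f a ^ 2 := by
        rw [← Finset.mul_sum, Finset.sum_comm]
        simp only [Finset.sum_mul]
    _ ≤ T₂ * ∑ a, T₁ * f a ^ 2 := by
        refine mul_le_mul_of_nonneg_left (Finset.sum_le_sum fun a _ => ?_) h.pos_right.le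
        exact mul_le_mul_of_nonneg_right (h.row a) (sq_nonneg _)
    _ = T₁ * T₂ * ∑ a, f a ^ 2 := by rw [← Finset.mul_sum]; ring

/-- Functions with small values and bounded mass have small energy. -/
theorem SumsBounded.energy_le_of_le (h : SumsBounded R T₁ T₂) {f : ι → ℝ} {τ : ℝ} (hτ : 0 ≤ τ)
    (hf : ∀ a, 0 ≤ f a) (hfτ : ∀ a, f a ≤ τ) : energy R f ≤ T₁ * T₂ * τ * ∑ a, f a := by
  calc energy R f ≤ ∑ b, (T₂ * τ) * ∑ a, R a b * f a := by
        refine Finset.sum_le_sum fun b _ => ?_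
        have h0 : 0 ≤ ∑ a, R a b * f a :=
          Finset.sum_nonneg fun a _ => mul_nonneg (h.nonneg a b) (hf a)
        rw [sq]
        refine mul_le_mul_of_nonneg_right ?_ h0
        calc ∑ a, R a b * f a ≤ ∑ a, R a b * τ :=
              Finset.sum_le_sum fun a _ => mul_le_mul_of_nonneg_left (hfτ a) (h.nonneg a b)
          _ ≤ T₂ * τ := by
              rw [← Finset.sum_mul]; exact mul_le_mul_of_nonneg_right (h.col b) hτ
    _ = (T₂ * τ) * ∑ a, (∑ b, R a b) * f a := by
        rw [← Finset.mul_sum, Finset.sum_comm]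
        simp only [Finset.sum_mul]
    _ ≤ (T₂ * τ) * ∑ a, T₁ * f a := by
        refine mul_le_mul_of_nonneg_left (Finset.sum_le_sum fun a _ => ?_)
          (mul_nonneg h.pos_right.le hτ)
        exact mul_le_mul_of_nonneg_right (h.row a) (hf a)
    _ = T₁ * T₂ * τ * ∑ a, f a := by rw [← Finset.mul_sum]; ring

/-- The normalized two-step walk. -/
noncomputable def twoStep (R : Matrix ι ι ℝ) (T₁ T₂ : ℝ) : Matrix ι ι ℝ :=
  (T₁ * T₂)⁻¹ • (R * Rᵀ)

theorem twoStep_apply (a b : ι) :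
    twoStep R T₁ T₂ a b = (T₁ * T₂)⁻¹ * ∑ c, R a c * R b c := by
  simp [twoStep, Matrix.mul_apply]

theorem twoStep_isSymm : (twoStep R T₁ T₂).IsSymm := by
  rw [Matrix.IsSymm, twoStep, Matrix.transpose_smul, Matrix.transpose_mul, transpose_transpose]

theorem SumsBounded.twoStep_nonneg (h : SumsBounded R T₁ T₂) (a b : ι) :
    0 ≤ twoStep R T₁ T₂ a b := by
  rw [twoStep_apply]
  exact mul_nonneg (inv_nonneg.2 (mul_nonneg h.pos_left.le h.pos_right.le))
    (Finset.sum_nonneg fun c _ => mul_nonneg (h.nonneg a c) (h.nonneg b c))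

theorem SumsBounded.sum_twoStep_le (h : SumsBounded R T₁ T₂) (a : ι) :
    ∑ b, twoStep R T₁ T₂ a b ≤ 1 := by
  have hD : 0 < T₁ * T₂ := mul_pos h.pos_left h.pos_right
  simp only [twoStep_apply]
  rw [← Finset.mul_sum, inv_mul_le_iff₀ hD, mul_one, Finset.sum_comm]
  calc ∑ c, ∑ b, R a c * R b c = ∑ c, R a c * ∑ b, R b c := by simp only [Finset.mul_sum]
    _ ≤ ∑ c, R a c * T₂ :=
        Finset.sum_le_sum fun c _ => mul_le_mul_of_nonneg_left (h.col c) (h.nonneg a c)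
    _ ≤ T₁ * T₂ := by
        rw [← Finset.sum_mul]; exact mul_le_mul_of_nonneg_right (h.row a) h.pos_right.le

/-- One half of the two-step walk is the energy; the Schur test for the transpose controls the other
half. Energy thus bounds the norm remaining after one more step. -/
theorem SumsBounded.sum_sq_twoStep_mulVec_le (h : SumsBounded R T₁ T₂) (f : ι → ℝ) :
    ∑ a, (twoStep R T₁ T₂ *ᵥ f) a ^ 2 ≤ (T₁ * T₂)⁻¹ * energy R f := by
  have hD : 0 < T₁ * T₂ := mul_pos h.pos_left h.pos_right
  have e1 : ∑ a, (twoStep R T₁ T₂ *ᵥ f) a ^ 2 = ((T₁ * T₂)⁻¹) ^ 2 * energy Rᵀ (Rᵀ *ᵥ f) := by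
    unfold energy
    rw [Finset.mul_sum]
    refine Finset.sum_congr rfl fun a _ => ?_
    rw [← mul_pow, twoStep, smul_mulVec, ← mulVec_mulVec]
    rfl
  have e2 : ∑ b, (Rᵀ *ᵥ f) b ^ 2 = energy R f := rfl
  have h1 := h.transpose.energy_le (Rᵀ *ᵥ f)
  rw [e2, mul_comm T₂] at h1
  rw [e1, sq, mul_assoc]
  refine mul_le_mul_of_nonneg_left ?_ (inv_nonneg.2 hD.le)
  rwa [inv_mul_le_iff₀ hD]

theorem gramForm_twoStep {E : Type*} [NormedAddCommGroup E] [InnerProductSpace ℝ E] (u : ι → E) (R : Matrix ι ι ℝ) (T₁ T₂ : ℝ) :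
    gramForm u (twoStep R T₁ T₂) = (T₁ * T₂)⁻¹ * ∑ c, ‖∑ a, R a c • u a‖ ^ 2 := by
  have h : ∀ c, ‖∑ a, R a c • u a‖ ^ 2 = ∑ a, ∑ b, R a c * R b c * inner ℝ (u a) (u b) := by
    intro c
    rw [← real_inner_self_eq_norm_sq, sum_inner]
    refine Finset.sum_congr rfl fun a _ => ?_
    rw [inner_sum]
    refine Finset.sum_congr rfl fun b _ => ?_
    rw [inner_smul_left, inner_smul_right]
    simp [mul_assoc]
  simp only [h, gramForm, inner_sum, inner_smul_right, twoStep_apply]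
  rw [Finset.sum_comm (s := univ (α := ι)) (f := fun c a => ∑ b, R a c * R b c * inner ℝ (u a) (u b)),
    Finset.mul_sum]
  refine Finset.sum_congr rfl fun a _ => ?_
  rw [Finset.sum_comm, Finset.mul_sum]
  refine Finset.sum_congr rfl fun b _ => ?_
  rw [mul_assoc, Finset.sum_mul]

variable [DecidableEq ι]

theorem SumsBounded.twoStep_pow_nonneg (h : SumsBounded R T₁ T₂) (i : ℕ) (a b : ι) :
    0 ≤ (twoStep R T₁ T₂ ^ i) a b :=
  (abs_nonneg _).trans
    (abs_pow_apply_le (fun a b => (abs_of_nonneg (h.twoStep_nonneg a b)).le) i a b)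

theorem SumsBounded.sum_twoStep_pow_le (h : SumsBounded R T₁ T₂) (i : ℕ) (a : ι) :
    ∑ b, (twoStep R T₁ T₂ ^ i) a b ≤ 1 := by
  induction i with
  | zero => simp [Matrix.one_apply]
  | succ i ih =>
    simp only [pow_succ, Matrix.mul_apply]
    rw [Finset.sum_comm]
    calc ∑ c, ∑ b, (twoStep R T₁ T₂ ^ i) a c * twoStep R T₁ T₂ c b
        ≤ ∑ c, (twoStep R T₁ T₂ ^ i) a c := by
          refine Finset.sum_le_sum fun c _ => ?_
          rw [← Finset.mul_sum]
          exact mul_le_of_le_one_right (h.twoStep_pow_nonneg i a c) (h.sum_twoStep_le c)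
      _ ≤ 1 := ih

/-- The total squared norm `N i` of the rows indexed by `A` starts at `A.card` and is at least `μ *
A.card` after `k` steps. Since `θ ^ k ≤ μ`, it cannot shrink by a factor below `θ` at every step,
and a row at a good step serves as `f`. -/
theorem SumsBounded.exists_concentrated (h : SumsBounded R T₁ T₂) {A : Finset ι} (hA : A.Nonempty)
    {k : ℕ} {θ μ : ℝ} (hθ : 0 < θ) (hθμ : θ ^ k ≤ μ)
    (hμ : μ * A.card ≤ ∑ a ∈ A, ∑ b, (twoStep R T₁ T₂ ^ k) a b ^ 2) (hk : k ≠ 0) :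
    ∃ f : ι → ℝ, (∀ a, 0 ≤ f a) ∧ ∑ a, f a ≤ 1 ∧
      θ / 2 * (∑ a, f a ^ 2 + μ) ≤ (T₁ * T₂)⁻¹ * energy R f := by
  have hD : 0 < T₁ * T₂ := mul_pos h.pos_left h.pos_right
  set Q := twoStep R T₁ T₂ with hQ
  let N : ℕ → ℝ := fun i => ∑ a ∈ A, ∑ b, (Q ^ i) a b ^ 2
  have hN0 : N 0 = A.card := by
    simp [N, Matrix.one_apply]
  have hrow : ∀ i a, (fun b => (Q ^ (i + 1)) a b) = Q *ᵥ fun b => (Q ^ i) a b := by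
    intro i a
    ext b
    rw [pow_succ, Matrix.mul_apply, mulVec, dotProduct]
    refine Finset.sum_congr rfl fun c _ => ?_
    rw [mul_comm, hQ, (twoStep_isSymm (R := R) (T₁ := T₁) (T₂ := T₂)).apply b c]
  have hstep : ∀ i a, ∑ b, (Q ^ (i + 1)) a b ^ 2 ≤
      (T₁ * T₂)⁻¹ * energy R (fun b => (Q ^ i) a b) := by
    intro i a
    have := h.sum_sq_twoStep_mulVec_le (fun b => (Q ^ i) a b)
    rw [← hQ, ← hrow] at this
    exact this
  have hanti : Antitone N := by
    refine antitone_nat_of_succ_le fun i => Finset.sum_le_sum fun a _ => (hstep i a).trans ?_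
    rw [inv_mul_le_iff₀ hD]
    exact h.energy_le _
  have hex : ∃ i < k, θ * N i ≤ N (i + 1) := by
    by_contra hcon
    push Not at hcon
    have h1 : ∀ i ≤ k, i ≠ 0 → N i < θ ^ i * A.card := by
      intro i hi hi0
      induction i with
      | zero => exact absurd rfl hi0
      | succ i ih =>
        refine (hcon i (by omega)).trans_le ?_
        rw [pow_succ', mul_assoc]
        refine mul_le_mul_of_nonneg_left ?_ hθ.le
        rcases eq_or_ne i 0 with rfl | h0
        · rw [hN0]; simp
        · exact (ih (by omega) h0).le
    have h2 := h1 k le_rfl hk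
    have h3 : θ ^ k * (A.card : ℝ) ≤ μ * A.card := mul_le_mul_of_nonneg_right hθμ (Nat.cast_nonneg _)
    exact absurd hμ (not_le.2 (h2.trans_le h3))
  obtain ⟨i, hik, hi⟩ := hex
  -- Half of `N i` is traded for `μ * A.card`, using monotonicity of `N`; the additive `μ` later
  -- pays for discarding small values of `f`.
  have hsum : ∑ a ∈ A, θ / 2 * (∑ b, (Q ^ i) a b ^ 2 + μ) ≤
      ∑ a ∈ A, (T₁ * T₂)⁻¹ * energy R (fun b => (Q ^ i) a b) := by
    calc ∑ a ∈ A, θ / 2 * (∑ b, (Q ^ i) a b ^ 2 + μ) = θ / 2 * (N i + μ * A.card) := by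
          rw [← Finset.mul_sum, Finset.sum_add_distrib, Finset.sum_const, nsmul_eq_mul, mul_comm μ]
      _ ≤ θ / 2 * (N i + N i) :=
          mul_le_mul_of_nonneg_left (add_le_add le_rfl (hμ.trans (hanti hik.le))) (by positivity)
      _ ≤ N (i + 1) := by linarith
      _ ≤ _ := Finset.sum_le_sum fun a _ => hstep i a
  obtain ⟨a, -, ha⟩ := Finset.exists_le_of_sum_le hA hsum
  exact ⟨_, h.twoStep_pow_nonneg i a, h.sum_twoStep_pow_le i a, ha⟩

/-- A function of large energy yields a small set whose indicator has large energy. -/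
theorem SumsBounded.exists_set (h : SumsBounded R T₁ T₂) {f : ι → ℝ} (hf : ∀ a, 0 ≤ f a)
    (hf1 : ∑ a, f a ≤ 1) {θ μ : ℝ} (hθ : 0 < θ) (hμ : 0 < μ)
    (hE : θ / 2 * (∑ a, f a ^ 2 + μ) ≤ (T₁ * T₂)⁻¹ * energy R f) {g : ℕ} (hg : 0 < g) {P : ℝ}
    (hP : ((Nat.log 2 ⌊4 / (θ * μ)⌋₊ + 1 : ℕ) : ℝ) * ((⌊4 / (θ * μ)⌋₊ / g + 1 : ℕ) : ℝ) ≤ P) :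
    ∃ S : Finset ι, S.Nonempty ∧ S.card ≤ g ∧
      θ / (16 * P) * S.card ≤ (T₁ * T₂)⁻¹ * energy R (fun a => if a ∈ S then 1 else 0) := by
  classical
  have hD : 0 < T₁ * T₂ := mul_pos h.pos_left h.pos_right
  -- The values below `τ` have normalized energy at most `τ`, and `2 * τ` is exactly the term `θ / 2
  -- * μ` of the hypothesis.
  set τ : ℝ := θ * μ / 4 with hτ
  have hτ0 : 0 < τ := by positivity
  have hτinv : 4 / (θ * μ) = 1 / τ := by rw [hτ]; field_simp
  rw [hτinv] at hP
  set Z := ⌊1 / τ⌋₊ with hZ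
  let S₀ : Finset ι := univ.filter fun a => τ ≤ f a
  have hS₀ : S₀.card ≤ Z := by
    rw [hZ, Nat.le_floor_iff (by positivity), le_div_iff₀ hτ0]
    calc (S₀.card : ℝ) * τ = ∑ a ∈ S₀, τ := by rw [Finset.sum_const, nsmul_eq_mul]
      _ ≤ ∑ a ∈ S₀, f a := Finset.sum_le_sum fun a ha => (Finset.mem_filter.1 ha).2
      _ ≤ ∑ a, f a := Finset.sum_le_sum_of_subset_of_nonneg (Finset.subset_univ _) fun a _ _ => hf a
      _ ≤ 1 := hf1
  let fb : ι → ℝ := fun a => if a ∈ S₀ then f a else 0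
  let fs : ι → ℝ := fun a => if a ∈ S₀ then 0 else f a
  have hsplit : f = fb + fs := by
    ext a; simp only [fb, fs, Pi.add_apply]; split_ifs <;> simp
  have hfs : (T₁ * T₂)⁻¹ * energy R fs ≤ τ := by
    have h1 := h.energy_le_of_le (f := fs) hτ0.le
      (fun a => by simp only [fs]; split_ifs <;> simp [hf a])
      (fun a => by
        simp only [fs]
        split_ifs with ha
        · exact hτ0.le
        · by_contra hcon
          exact ha (Finset.mem_filter.2 ⟨mem_univ _, (not_le.1 hcon).le⟩))
    have h2 : ∑ a, fs a ≤ 1 := by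
      refine le_trans (Finset.sum_le_sum fun a _ => ?_) hf1
      simp only [fs]; split_ifs <;> simp [hf a]
    rw [inv_mul_le_iff₀ hD]
    exact h1.trans (mul_le_of_le_one_right (by positivity) h2)
  have hEb : θ / 4 * ∑ a, f a ^ 2 ≤ (T₁ * T₂)⁻¹ * energy R fb := by
    have h1 := mul_le_mul_of_nonneg_left (energy_add_le R fb fs) (inv_nonneg.2 hD.le)
    rw [← hsplit] at h1
    nlinarith
  obtain ⟨rk, hrk⟩ : ∃ rk : ι → ℕ, Set.InjOn rk S₀ ∧ ∀ a ∈ S₀, rk a < S₀.card := by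
    let e := S₀.equivFin
    refine ⟨fun a => if ha : a ∈ S₀ then (e ⟨a, ha⟩ : ℕ) else 0, ?_, ?_⟩
    · intro a ha b hb hab
      have ha : a ∈ S₀ := ha
      have hb : b ∈ S₀ := hb
      simp only [dif_pos ha, dif_pos hb] at hab
      exact congrArg Subtype.val (e.injective (Fin.ext hab))
    · intro a ha
      simp only [dif_pos ha]
      exact (e ⟨a, ha⟩).2
  -- The first index is the dyadic level of the value, which makes `f` constant up to a factor 2.
  -- The second cuts an arbitrary enumeration into blocks of length `g`, which bounds the size of
  -- each piece.
  let idx : ι → ℕ × ℕ := fun a => (Nat.log 2 ⌊f a / τ⌋₊, rk a / g)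
  let J : Finset (ℕ × ℕ) := Finset.range (Nat.log 2 Z + 1) ×ˢ Finset.range (Z / g + 1)
  have hJ : ∀ a ∈ S₀, idx a ∈ J := by
    intro a ha
    refine Finset.mem_product.2 ⟨Finset.mem_range.2 ?_, Finset.mem_range.2 ?_⟩
    · have hle : f a / τ ≤ 1 / τ → (idx a).1 ≤ Nat.log 2 Z := fun h1 => by
        change Nat.log 2 ⌊f a / τ⌋₊ ≤ Nat.log 2 Z
        exact Nat.log_mono_right (Nat.floor_le_floor h1)
      refine Nat.lt_succ_of_le (hle ?_)
      refine div_le_div_of_nonneg_right ?_ hτ0.le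
      exact (Finset.single_le_sum (fun a _ => hf a) (mem_univ a)).trans hf1
    · exact Nat.lt_succ_of_le (Nat.div_le_div_right ((hrk.2 a ha).le.trans hS₀))
  let piece : ℕ × ℕ → Finset ι := fun p => S₀.filter fun a => idx a = p
  let fp : ℕ × ℕ → ι → ℝ := fun p a => if a ∈ piece p then f a else 0
  have hfb : fb = ∑ p ∈ J, fp p := by
    ext a
    rw [Finset.sum_apply]
    simp only [fb, fp, piece, Finset.mem_filter]
    by_cases ha : a ∈ S₀
    · simp [ha, hJ a ha]
    · simp [ha]
  have hJcard : (J.card : ℝ) ≤ P := by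
    rw [Finset.card_product, Finset.card_range, Finset.card_range, Nat.cast_mul]
    exact hP
  have hP0 : 0 < P := lt_of_lt_of_le (by positivity) hP
  have hsq : ∑ p ∈ J, ∑ a, fp p a ^ 2 ≤ ∑ a, f a ^ 2 := by
    rw [Finset.sum_comm]
    refine Finset.sum_le_sum fun a _ => ?_
    have : ∀ p, fp p a ^ 2 = if p = idx a then (if a ∈ S₀ then f a ^ 2 else 0) else 0 := by
      intro p
      simp only [fp, piece, Finset.mem_filter]
      by_cases h1 : a ∈ S₀ <;> by_cases h2 : idx a = p
      · simp [h1, h2]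
      · simp [h2, Ne.symm h2]
      · simp [h1]
      · simp [h1]
    simp only [this, Finset.sum_ite_eq']
    split_ifs <;> first | exact le_rfl | positivity
  have hEp : ∑ p ∈ J, θ / (4 * P) * ∑ a, fp p a ^ 2 ≤ ∑ p ∈ J, (T₁ * T₂)⁻¹ * energy R (fp p) := by
    have h1 := mul_le_mul_of_nonneg_left (energy_sum_le R J fp) (inv_nonneg.2 hD.le)
    rw [← hfb] at h1
    rw [← Finset.mul_sum, ← Finset.mul_sum]
    have h2 : 0 ≤ ∑ p ∈ J, energy R (fp p) := Finset.sum_nonneg fun p _ => energy_nonneg R _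
    have h3 : (T₁ * T₂)⁻¹ * (J.card * ∑ p ∈ J, energy R (fp p)) ≤
        P * ((T₁ * T₂)⁻¹ * ∑ p ∈ J, energy R (fp p)) := by
      have := mul_le_mul_of_nonneg_right hJcard (mul_nonneg (inv_nonneg.2 hD.le) h2)
      linarith
    have h4 : θ / 4 * ∑ p ∈ J, ∑ a, fp p a ^ 2 ≤ θ / 4 * ∑ a, f a ^ 2 :=
      mul_le_mul_of_nonneg_left hsq (by positivity)
    have h5 : θ / (4 * P) * ∑ p ∈ J, ∑ a, fp p a ^ 2 = (θ / 4 * ∑ p ∈ J, ∑ a, fp p a ^ 2) / P := by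
      field_simp
    rw [h5, div_le_iff₀ hP0]
    linarith
  have hν : 0 < ∑ a, f a ^ 2 := by
    rcases (Finset.sum_nonneg fun a (_ : a ∈ univ) => sq_nonneg (f a)).eq_or_lt with h0 | h0
    · have h1 := h.energy_le f
      rw [← h0, mul_zero] at h1
      rw [← h0] at hE
      have h2 : (T₁ * T₂)⁻¹ * energy R f ≤ 0 := mul_nonpos_of_nonneg_of_nonpos (inv_nonneg.2 hD.le) h1
      have : 0 < θ / 2 * (0 + μ) := by positivity
      linarith
    · exact h0
  have hzero : ∀ p, ¬ (piece p).Nonempty → fp p = 0 := by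
    intro p hp
    rw [Finset.not_nonempty_iff_eq_empty] at hp
    ext a
    simp [fp, hp]
  have henergy0 : energy R 0 = 0 := by simp [energy]
  let J' := J.filter fun p => (piece p).Nonempty
  have hJ' : J'.Nonempty := by
    rw [Finset.nonempty_iff_ne_empty]
    intro h0
    have : fb = 0 := by
      rw [hfb]
      refine Finset.sum_eq_zero fun p hp => hzero p fun hne => ?_
      have : p ∈ J' := Finset.mem_filter.2 ⟨hp, hne⟩
      rw [h0] at this
      exact absurd this (Finset.notMem_empty _)
    rw [this, henergy0, mul_zero] at hEb
    have : 0 < θ / 4 * ∑ a, f a ^ 2 := by positivity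
    linarith
  have hEp' : ∑ p ∈ J', θ / (4 * P) * ∑ a, fp p a ^ 2 ≤
      ∑ p ∈ J', (T₁ * T₂)⁻¹ * energy R (fp p) := by
    rw [Finset.sum_filter_of_ne, Finset.sum_filter_of_ne]
    · exact hEp
    · intro p _ hp
      by_contra hcon
      rw [hzero p hcon, henergy0, mul_zero] at hp
      exact hp rfl
    · intro p _ hp
      by_contra hcon
      rw [hzero p hcon] at hp
      simp at hp
  obtain ⟨p, hpJ, hp⟩ := Finset.exists_le_of_sum_le hJ' hEp'
  refine ⟨piece p, (Finset.mem_filter.1 hpJ).2, ?_, ?_⟩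
  · have h1 : (piece p).card ≤ (Finset.Ico (p.2 * g) (p.2 * g + g)).card := by
      refine Finset.card_le_card_of_injOn rk ?_ ?_
      · intro a ha
        have h2 : idx a = p := (Finset.mem_filter.1 ha).2
        have h3 : rk a / g = p.2 := congrArg Prod.snd h2
        rw [Finset.coe_Ico, Set.mem_Ico, ← h3]
        refine ⟨Nat.div_mul_le_self _ _, ?_⟩
        have := Nat.lt_div_mul_add hg (a := rk a)
        omega
      · exact hrk.1.mono fun a ha => (Finset.mem_filter.1 ha).1
    simpa using h1
  · have hval : ∀ a ∈ piece p, 2 ^ p.1 * τ ≤ f a ∧ f a ≤ 2 * (2 ^ p.1 * τ) := by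
      intro a ha
      have h2 : idx a = p := (Finset.mem_filter.1 ha).2
      have h3 : Nat.log 2 ⌊f a / τ⌋₊ = p.1 := congrArg Prod.fst h2
      have h4 : τ ≤ f a := (Finset.mem_filter.1 (Finset.mem_filter.1 ha).1).2
      have h5 : ⌊f a / τ⌋₊ ≠ 0 := by
        rw [← Nat.one_le_iff_ne_zero, Nat.one_le_floor_iff]
        exact (one_le_div hτ0).2 h4
      have h6 : ((2 ^ p.1 : ℕ) : ℝ) ≤ f a / τ := by
        rw [← h3]
        exact le_trans (by exact_mod_cast Nat.pow_log_le_self 2 h5)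
          (Nat.floor_le (div_nonneg (hf a) hτ0.le))
      have h7 : f a / τ < ((2 ^ (p.1 + 1) : ℕ) : ℝ) := by
        rw [← Nat.floor_lt (div_nonneg (hf a) hτ0.le), ← h3]
        exact Nat.lt_pow_succ_log_self one_lt_two _
      rw [le_div_iff₀ hτ0] at h6
      rw [div_lt_iff₀ hτ0] at h7
      push_cast at h6 h7
      refine ⟨h6, h7.le.trans (le_of_eq ?_)⟩
      ring
    set c : ℝ := 2 ^ p.1 * τ with hc
    have hc0 : 0 < c := by positivity
    -- On a piece the values lie between `c` and `2 * c`; the resulting factor 4 turns `4 * P` into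
    -- `16 * P`.
    have h8 : energy R (fp p) ≤ (2 * c) ^ 2 * energy R (fun a => if a ∈ piece p then 1 else 0) := by
      rw [← energy_smul]
      refine energy_mono h.nonneg (fun a => ?_) fun a => ?_
      · simp only [fp]; split_ifs <;> simp [hf a]
      · simp only [fp]
        split_ifs with ha
        · simpa using (hval a ha).2
        · simp
    have h9 : c ^ 2 * (piece p).card ≤ ∑ a, fp p a ^ 2 := by
      calc c ^ 2 * (piece p).card = ∑ a ∈ piece p, c ^ 2 := by
            rw [Finset.sum_const, nsmul_eq_mul, mul_comm]
        _ ≤ ∑ a ∈ piece p, fp p a ^ 2 := by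
            refine Finset.sum_le_sum fun a ha => ?_
            simp only [fp, if_pos ha]
            exact pow_le_pow_left₀ hc0.le (hval a ha).1 2
        _ ≤ _ := Finset.sum_le_sum_of_subset_of_nonneg (Finset.subset_univ _)
            fun _ _ _ => sq_nonneg _
    have h10 : θ / (4 * P) * (c ^ 2 * (piece p).card) ≤
        (T₁ * T₂)⁻¹ * ((2 * c) ^ 2 * energy R (fun a => if a ∈ piece p then 1 else 0)) :=
      (mul_le_mul_of_nonneg_left h9 (by positivity)).trans
        (hp.trans (mul_le_mul_of_nonneg_left h8 (inv_nonneg.2 hD.le)))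
    have h11 : 4 * c ^ 2 * (θ / (16 * P) * (piece p).card) ≤
        4 * c ^ 2 * ((T₁ * T₂)⁻¹ * energy R (fun a => if a ∈ piece p then 1 else 0)) := by
      refine le_trans (le_of_eq ?_) (h10.trans (le_of_eq ?_))
      · have : θ / (16 * P) = θ / (4 * P) / 4 := by rw [div_div]; congr 1; ring
        rw [this]; ring
      · ring
    exact le_of_mul_le_mul_left h11 (by positivity)

end Energy

/-! ### From correlations to a dense small set -/

section Density

variable {ι E : Type*} [DecidableEq ι] [NormedAddCommGroup E] [InnerProductSpace ℝ E]

/-- The incidence matrix of a set of ordered pairs. -/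
def incidence (F : Finset (ι × ι)) : Matrix ι ι ℝ := fun a b => if (a, b) ∈ F then 1 else 0

/-- The incidence matrix of a set of ordered pairs, signed by the correlations. -/
noncomputable def signedIncidence (u : ι → E) (F : Finset (ι × ι)) : Matrix ι ι ℝ :=
  fun a b => if (a, b) ∈ F then (SignType.sign (inner ℝ (u a) (u b)) : ℝ) else 0

theorem abs_signedIncidence_le (u : ι → E) (F : Finset (ι × ι)) (a b : ι) :
    |signedIncidence u F a b| ≤ incidence F a b := by
  unfold signedIncidence incidence
  split_ifs
  · rcases lt_trichotomy (inner ℝ (u a) (u b)) 0 with h | h | h <;> simp [h]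
  · simp

theorem sum_sum_incidence (F : Finset (ι × ι)) (S S' : Finset ι) :
    ∑ b ∈ S', ∑ a ∈ S, incidence F a b = ((F.filter fun p => p.1 ∈ S ∧ p.2 ∈ S').card : ℝ) := by
  rw [Finset.sum_comm, ← Finset.sum_product' S S' (fun a b => incidence F a b)]
  simp only [incidence]
  rw [Finset.sum_boole]
  congr 2
  ext p
  simp [and_comm]

variable [Fintype ι]

/-- A set `F ⊆ A × B` of ordered pairs whose degrees are at most `K` times their averages. -/
structure NearlyBiregular (F : Finset (ι × ι)) (A B : Finset ι) (T₁ T₂ K : ℝ) : Prop where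
  mem_left : ∀ p ∈ F, p.1 ∈ A
  mem_right : ∀ p ∈ F, p.2 ∈ B
  sumsBounded : SumsBounded (incidence F) T₁ T₂
  card_left : A.card * T₁ ≤ K * F.card
  card_right : B.card * T₂ ≤ K * F.card
  nonempty : F.Nonempty
  pos : 0 < K

variable {F : Finset (ι × ι)} {A B : Finset ι} {T₁ T₂ K : ℝ}

/-- Signing makes all contributions add up: the signed sum of the neighbours of `b` has inner
product at least `deg b / 4` with `u b`. Cauchy–Schwarz over `B` gives `|F|²/16`, and the two degree
conditions each cost a factor `K`. -/
theorem NearlyBiregular.le_gramForm (h : NearlyBiregular F A B T₁ T₂ K) {u : ι → E}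
    (hu : ∀ a, ‖u a‖ = 1) (hF : ∀ p ∈ F, 1 / 4 ≤ |inner ℝ (u p.1) (u p.2)|) :
    1 / (16 * K ^ 2) * A.card ≤ gramForm u (twoStep (signedIncidence u F) T₁ T₂) := by
  have hT₁ := h.sumsBounded.pos_left
  have hT₂ := h.sumsBounded.pos_right
  have hD : 0 < T₁ * T₂ := mul_pos hT₁ hT₂
  have hFpos : (0 : ℝ) < F.card := by exact_mod_cast h.nonempty.card_pos
  have hloc : ∀ b, 1 / 4 * ∑ a, incidence F a b ≤ ‖∑ a, signedIncidence u F a b • u a‖ := by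
    intro b
    have h1 := real_inner_le_norm (∑ a, signedIncidence u F a b • u a) (u b)
    rw [hu b, mul_one, sum_inner] at h1
    refine le_trans ?_ h1
    rw [Finset.mul_sum]
    refine Finset.sum_le_sum fun a _ => ?_
    rw [inner_smul_left]
    unfold incidence signedIncidence
    split_ifs with hab
    · have := hF _ hab
      simp only [conj_trivial]
      rw [sign_mul_self]
      linarith
    · simp
  have hsum : ∑ b ∈ B, ∑ a, incidence F a b = F.card := by
    have h1 := sum_sum_incidence F univ univ
    rw [Finset.filter_true_of_mem (fun _ _ => ⟨mem_univ _, mem_univ _⟩)] at h1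
    rw [← h1]
    refine Finset.sum_subset (Finset.subset_univ _) fun b _ hb => Finset.sum_eq_zero fun a _ => ?_
    unfold incidence
    exact if_neg fun hab => hb (h.mem_right _ hab)
  rw [gramForm_twoStep, le_inv_mul_iff₀ hD]
  have h2 : (1 / 16 : ℝ) * (F.card : ℝ) ^ 2 ≤
      (B.card : ℝ) * ∑ c, ‖∑ a, signedIncidence u F a c • u a‖ ^ 2 := by
    calc (1 / 16 : ℝ) * (F.card : ℝ) ^ 2 = (∑ b ∈ B, 1 / 4 * ∑ a, incidence F a b) ^ 2 := by
          rw [← Finset.mul_sum, hsum]; ring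
      _ ≤ (B.card : ℝ) * ∑ b ∈ B, (1 / 4 * ∑ a, incidence F a b) ^ 2 := sq_sum_le_card_mul_sum_sq
      _ ≤ (B.card : ℝ) * ∑ b ∈ B, ‖∑ a, signedIncidence u F a b • u a‖ ^ 2 := by
          refine mul_le_mul_of_nonneg_left (Finset.sum_le_sum fun b _ => ?_) (Nat.cast_nonneg _)
          refine pow_le_pow_left₀ (mul_nonneg (by norm_num) ?_) (hloc b) 2
          exact Finset.sum_nonneg fun a _ => h.sumsBounded.nonneg a b
      _ ≤ _ := by
          refine mul_le_mul_of_nonneg_left ?_ (Nat.cast_nonneg _)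
          exact Finset.sum_le_sum_of_subset_of_nonneg (Finset.subset_univ _) fun _ _ _ => sq_nonneg _
  set G := ∑ c, ‖∑ a, signedIncidence u F a c • u a‖ ^ 2 with hG
  have hG0 : 0 ≤ G := Finset.sum_nonneg fun _ _ => sq_nonneg _
  have hK := h.pos
  have h3 : T₂ * ((1 / 16 : ℝ) * (F.card : ℝ) ^ 2) ≤ K * F.card * G := by
    calc T₂ * ((1 / 16 : ℝ) * (F.card : ℝ) ^ 2) ≤ T₂ * (B.card * G) :=
          mul_le_mul_of_nonneg_left h2 hT₂.le
      _ = (B.card * T₂) * G := by ring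
      _ ≤ _ := mul_le_mul_of_nonneg_right h.card_right hG0
  have h4 : T₂ * (1 / 16 * F.card) ≤ K * G := by
    refine le_of_mul_le_mul_left (a := (F.card : ℝ)) ?_ hFpos
    calc (F.card : ℝ) * (T₂ * (1 / 16 * F.card)) = T₂ * ((1 / 16 : ℝ) * (F.card : ℝ) ^ 2) := by ring
      _ ≤ K * F.card * G := h3
      _ = _ := by ring
  have h5 : T₂ * (1 / 16 * (A.card * T₁)) ≤ K * (K * G) := by
    calc T₂ * (1 / 16 * (A.card * T₁)) ≤ T₂ * (1 / 16 * (K * F.card)) := by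
          refine mul_le_mul_of_nonneg_left ?_ hT₂.le
          exact mul_le_mul_of_nonneg_left h.card_left (by norm_num)
      _ = K * (T₂ * (1 / 16 * F.card)) := by ring
      _ ≤ _ := mul_le_mul_of_nonneg_left h4 hK.le
  rw [one_div_mul_eq_div, mul_div_assoc', div_le_iff₀ (by positivity)]
  linarith

/-- A nearly biregular set of correlated pairs is dense on some small set. -/
theorem NearlyBiregular.exists_dense (h : NearlyBiregular F A B T₁ T₂ K) (hT : T₂ ≤ T₁) {u : ι → E}
    (hu : ∀ a, ‖u a‖ = 1) (hF : ∀ p ∈ F, 1 / 4 ≤ |inner ℝ (u p.1) (u p.2)|) {s : ℝ} (hs0 : 0 < s)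
    (hs : ∀ w, ∑ a, inner ℝ (u a) w ^ 2 ≤ s * ‖w‖ ^ 2) {l : ℕ} {θ μ : ℝ} (hθ : 0 < θ)
    (hμ : μ = (1 / (16 * K ^ 2)) ^ (2 * 2 ^ l) / s) (hθμ : θ ^ 2 ^ l ≤ μ) {g : ℕ} (hg : 0 < g)
    {P φ : ℝ}
    (hP : ((Nat.log 2 ⌊4 / (θ * μ)⌋₊ + 1 : ℕ) : ℝ) * ((⌊4 / (θ * μ)⌋₊ / g + 1 : ℕ) : ℝ) ≤ P)
    (hφ : φ = θ / (16 * P)) :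
    ∃ X : Finset ι, X.Nonempty ∧ X.card ≤ 2 * g ∧
      φ ^ 2 / 8 * T₂ * X.card ≤ ((F.filter fun p => p.1 ∈ X ∧ p.2 ∈ X).card : ℝ) := by
  have hR := h.sumsBounded
  have hT₁ := hR.pos_left
  have hT₂ := hR.pos_right
  have hD : 0 < T₁ * T₂ := mul_pos hT₁ hT₂
  have hK := h.pos
  have hμ0 : 0 < μ := by rw [hμ]; positivity
  have hA : A.Nonempty := by
    obtain ⟨p, hp⟩ := h.nonempty
    exact ⟨_, h.mem_left p hp⟩
  have hconc : μ * A.card ≤ ∑ a ∈ A, ∑ b, (twoStep (incidence F) T₁ T₂ ^ 2 ^ l) a b ^ 2 := by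
    rw [hμ]
    refine sum_sq_pow_ge hu hs0 hs (C := twoStep (signedIncidence u F) T₁ T₂) twoStep_isSymm ?_ ?_
      (by positivity) (h.le_gramForm hu hF) l
    · intro a ha b
      rw [twoStep_apply]
      refine mul_eq_zero_of_right _ (Finset.sum_eq_zero fun c _ => ?_)
      rw [signedIncidence, if_neg fun hac => ha (h.mem_left _ hac), zero_mul]
    · intro a b
      rw [twoStep_apply, twoStep_apply, abs_mul, abs_of_pos (inv_pos.2 hD)]
      refine mul_le_mul_of_nonneg_left ?_ (inv_nonneg.2 hD.le)
      refine (Finset.abs_sum_le_sum_abs _ _).trans (Finset.sum_le_sum fun c _ => ?_)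
      rw [abs_mul]
      exact mul_le_mul (abs_signedIncidence_le u F a c) (abs_signedIncidence_le u F b c)
        (abs_nonneg _) (hR.nonneg a c)
  obtain ⟨f, hf, hf1, hE⟩ := hR.exists_concentrated hA hθ hθμ hconc (by positivity)
  obtain ⟨S, hS, hSg, hSE⟩ := hR.exists_set hf hf1 hθ hμ0 hE hg hP
  have hP0 : 0 < P := lt_of_lt_of_le (by positivity) hP
  have hφ0 : 0 < φ := by rw [hφ]; positivity
  rw [← hφ] at hSE
  have hScard : (0 : ℝ) < S.card := by exact_mod_cast hS.card_pos
  -- The Schur bound on the energy of `S` rules out `φ > 1`; this is needed when the second set is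
  -- trimmed to size at most `S.card`.
  have hφ1 : φ ≤ 1 := by
    have h1 := hR.energy_le (fun a => if a ∈ S then (1 : ℝ) else 0)
    have h2 : ∑ a, (if a ∈ S then (1 : ℝ) else 0) ^ 2 = S.card := by simp
    rw [h2] at h1
    rw [le_inv_mul_iff₀ hD] at hSE
    have h3 : T₁ * T₂ * (φ * S.card) ≤ T₁ * T₂ * (1 * S.card) := by rw [one_mul]; exact hSE.trans h1
    exact le_of_mul_le_mul_right (le_of_mul_le_mul_left h3 hD) hScard
  let e : ι → ℝ := fun b => ∑ a ∈ S, incidence F a b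
  have he0 : ∀ b, 0 ≤ e b := fun b => Finset.sum_nonneg fun a _ => hR.nonneg a b
  have heT : ∀ b, e b ≤ T₂ := fun b =>
    (Finset.sum_le_sum_of_subset_of_nonneg (Finset.subset_univ _) fun a _ _ => hR.nonneg a b).trans
      (hR.col b)
  have hesum : ∑ b, e b ≤ S.card * T₁ := by
    rw [Finset.sum_comm, ← nsmul_eq_mul, ← Finset.sum_const]
    exact Finset.sum_le_sum fun a _ => hR.row a
  have henergy : energy (incidence F) (fun a => if a ∈ S then 1 else 0) = ∑ b, e b ^ 2 := by
    unfold energy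
    refine Finset.sum_congr rfl fun b _ => ?_
    simp [e]
  rw [henergy, le_inv_mul_iff₀ hD] at hSE
  -- The popular neighbours of `S`. The others account for at most half of the energy, so many edges
  -- leave `S` towards `S₁`.
  let S₁ : Finset ι := univ.filter fun b => φ / 2 * T₂ ≤ e b
  have h1 : φ / 2 * S.card * T₁ ≤ ∑ b ∈ S₁, e b := by
    have h2 : ∑ b, e b ^ 2 ≤ T₂ * ∑ b ∈ S₁, e b + φ / 2 * T₂ * ∑ b, e b := by
      rw [Finset.sum_filter, Finset.mul_sum, Finset.mul_sum, ← Finset.sum_add_distrib]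
      refine Finset.sum_le_sum fun b _ => ?_
      split_ifs with hb
      · have := mul_le_mul_of_nonneg_right (heT b) (he0 b)
        have : 0 ≤ φ / 2 * T₂ * e b := mul_nonneg (by positivity) (he0 b)
        nlinarith
      · have := mul_le_mul_of_nonneg_right (not_le.1 hb).le (he0 b)
        nlinarith
    have h3 : φ / 2 * T₂ * ∑ b, e b ≤ φ / 2 * T₂ * (S.card * T₁) :=
      mul_le_mul_of_nonneg_left hesum (by positivity)
    refine le_of_mul_le_mul_left (a := T₂) ?_ hT₂
    nlinarith
  -- Here `T₂ ≤ T₁` is essential: many edges with column degrees at most `T₂` need many endpoints.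
  have h2 : φ / 2 * S.card ≤ S₁.card := by
    have h3 : ∑ b ∈ S₁, e b ≤ S₁.card * T₂ := by
      rw [← nsmul_eq_mul, ← Finset.sum_const]
      exact Finset.sum_le_sum fun b _ => heT b
    refine le_of_mul_le_mul_right (a := T₂) ?_ hT₂
    calc φ / 2 * S.card * T₂ ≤ φ / 2 * S.card * T₁ := mul_le_mul_of_nonneg_left hT (by positivity)
      _ ≤ _ := h1.trans h3
  obtain ⟨S₂, hS₂, hS₂card⟩ := Finset.exists_subset_card_eq (min_le_right S.card S₁.card)
  have h3 : φ / 2 * S.card ≤ S₂.card := by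
    rw [hS₂card, Nat.cast_min]
    refine le_min ?_ h2
    nlinarith
  have h4 : S₂.card ≤ S.card := hS₂card ▸ min_le_left _ _
  refine ⟨S ∪ S₂, hS.mono Finset.subset_union_left, ?_, ?_⟩
  · have := Finset.card_union_le S S₂
    omega
  · have hX : ((S ∪ S₂).card : ℝ) ≤ 2 * S.card := by
      have := Finset.card_union_le S S₂
      exact_mod_cast (by omega : (S ∪ S₂).card ≤ 2 * S.card)
    have h5 : ∑ b ∈ S₂, e b ≤ ((F.filter fun p => p.1 ∈ S ∪ S₂ ∧ p.2 ∈ S ∪ S₂).card : ℝ) := by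
      rw [sum_sum_incidence]
      refine Nat.cast_le.2 (Finset.card_le_card fun p hp => ?_)
      obtain ⟨hpF, hp1, hp2⟩ := Finset.mem_filter.1 hp
      exact Finset.mem_filter.2
        ⟨hpF, Finset.mem_union_left _ hp1, Finset.mem_union_right _ hp2⟩
    have h6 : S₂.card * (φ / 2 * T₂) ≤ ∑ b ∈ S₂, e b := by
      rw [← nsmul_eq_mul, ← Finset.sum_const]
      exact Finset.sum_le_sum fun b hb => (Finset.mem_filter.1 (hS₂ hb)).2
    have h7 : φ / 2 * S.card * (φ / 2 * T₂) ≤ S₂.card * (φ / 2 * T₂) :=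
      mul_le_mul_of_nonneg_right h3 (by positivity)
    have h8 : φ ^ 2 / 8 * T₂ * (S ∪ S₂).card ≤ φ ^ 2 / 8 * T₂ * (2 * S.card) :=
      mul_le_mul_of_nonneg_left hX (by positivity)
    calc φ ^ 2 / 8 * T₂ * (S ∪ S₂).card ≤ φ ^ 2 / 8 * T₂ * (2 * S.card) := h8
      _ = φ / 2 * S.card * (φ / 2 * T₂) := by ring
      _ ≤ _ := h7.trans (h6.trans h5)

end Density

/-! ### Dyadic regularization of degrees -/

section Dyadic

variable {ι E : Type*} [Fintype ι] [DecidableEq ι] [NormedAddCommGroup E] [InnerProductSpace ℝ E]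

/-- A nonempty symmetric set of ordered pairs has a nearly biregular part. -/
theorem exists_nearlyBiregular {F : Finset (ι × ι)} (hne : F.Nonempty)
    (hsymm : ∀ p ∈ F, p.swap ∈ F) {L : ℕ} (hL : L = Nat.log 2 (Fintype.card ι) + 1) :
    ∃ (F' : Finset (ι × ι)) (A B : Finset ι) (T₁ T₂ : ℝ), F' ⊆ F ∧ T₂ ≤ T₁ ∧
      NearlyBiregular F' A B T₁ T₂ (2 * L ^ 2) ∧
      (F.card : ℝ) ≤ L ^ 2 * (Fintype.card ι * T₂) := by
  let deg : ι → ℕ := fun a => (univ.filter fun b => (a, b) ∈ F).card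
  let lev : ι → ℕ := fun a => Nat.log 2 (deg a)
  have hlev : ∀ a, lev a < L := fun a => by
    rw [hL]; exact Nat.lt_succ_of_le (Nat.log_mono_right (Finset.card_le_univ _))
  let Fc : ℕ × ℕ → Finset (ι × ι) := fun q => F.filter fun p => (lev p.1, lev p.2) = q
  have hmaps : ∀ p ∈ F, (lev p.1, lev p.2) ∈ Finset.range L ×ˢ Finset.range L := fun p _ =>
    Finset.mem_product.2 ⟨Finset.mem_range.2 (hlev _), Finset.mem_range.2 (hlev _)⟩
  have hLpos : 0 < L := by omega
  obtain ⟨q, -, hq⟩ : ∃ q ∈ Finset.range L ×ˢ Finset.range L,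
      (F.card : ℝ) / (L ^ 2) ≤ ((Fc q).card : ℝ) := by
    refine Finset.exists_le_of_sum_le
      (Finset.Nonempty.product ⟨0, Finset.mem_range.2 hLpos⟩ ⟨0, Finset.mem_range.2 hLpos⟩) ?_
    rw [Finset.sum_const, Finset.card_product, Finset.card_range, nsmul_eq_mul, ← Nat.cast_sum,
      ← Finset.card_eq_sum_card_fiberwise hmaps]
    push_cast
    rw [← sq, mul_div_cancel₀]
    positivity
  obtain ⟨i, j, hij, hcard⟩ : ∃ i j : ℕ, j ≤ i ∧ (F.card : ℝ) ≤ L ^ 2 * (Fc (i, j)).card := by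
    rw [div_le_iff₀' (by positivity)] at hq
    rcases le_total q.2 q.1 with h | h
    · exact ⟨q.1, q.2, h, hq⟩
    -- Swapping coordinates matches the two dyadic classes, so the larger degree can be placed on
    -- the left.
    · refine ⟨q.2, q.1, h, hq.trans_eq ?_⟩
      have : (Fc q).card = (Fc (q.2, q.1)).card := by
        refine Finset.card_bij' (fun p _ => p.swap) (fun p _ => p.swap) ?_ ?_ ?_ ?_
        · intro p hp
          obtain ⟨h1, h2⟩ := Finset.mem_filter.1 hp
          refine Finset.mem_filter.2 ⟨hsymm p h1, ?_⟩
          rw [← h2]; rfl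
        · intro p hp
          obtain ⟨h1, h2⟩ := Finset.mem_filter.1 hp
          refine Finset.mem_filter.2 ⟨hsymm p h1, ?_⟩
          have h3 := congrArg Prod.swap h2
          exact h3
        · intro p _; exact p.swap_swap
        · intro p _; exact p.swap_swap
      rw [this]
  have hFpos : (0 : ℝ) < F.card := by exact_mod_cast hne.card_pos
  -- Positivity of the degree is required because `Nat.log 2 0 = 0` would put isolated vertices in
  -- level 0.
  let cls : ℕ → Finset ι := fun i => univ.filter fun a => 0 < deg a ∧ lev a = i
  have hdegpos : ∀ p ∈ F, 0 < deg p.1 := fun p hp =>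
    Finset.card_pos.2 ⟨p.2, Finset.mem_filter.2 ⟨mem_univ _, hp⟩⟩
  have hdeglt : ∀ a, (deg a : ℝ) ≤ 2 ^ (lev a + 1) := fun a => by
    exact_mod_cast (Nat.lt_pow_succ_log_self one_lt_two _).le
  have hdegsum : ∑ a, deg a = F.card := by
    rw [Finset.card_eq_sum_card_fiberwise (f := Prod.fst) (t := univ) (fun _ _ => mem_univ _)]
    refine Finset.sum_congr rfl fun a _ => ?_
    refine Finset.card_bij (fun b _ => (a, b)) ?_ ?_ ?_
    · intro b hb
      exact Finset.mem_filter.2 ⟨(Finset.mem_filter.1 hb).2, rfl⟩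
    · intro b _ b' _ h
      exact (Prod.mk.inj h).2
    · rintro ⟨a', b⟩ hp
      obtain ⟨h1, rfl⟩ := Finset.mem_filter.1 hp
      exact ⟨b, Finset.mem_filter.2 ⟨mem_univ _, h1⟩, rfl⟩
  have hcls : ∀ k, ((cls k).card : ℝ) * 2 ^ (k + 1) ≤ 2 * L ^ 2 * (Fc (i, j)).card := by
    intro k
    have h1 : ((cls k).card : ℝ) * 2 ^ k ≤ F.card := by
      calc ((cls k).card : ℝ) * 2 ^ k = ∑ a ∈ cls k, (2 : ℝ) ^ k := by
            rw [Finset.sum_const, nsmul_eq_mul]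
        _ ≤ ∑ a ∈ cls k, (deg a : ℝ) := by
            refine Finset.sum_le_sum fun a ha => ?_
            obtain ⟨-, h2, rfl⟩ := Finset.mem_filter.1 ha
            exact_mod_cast Nat.pow_log_le_self 2 h2.ne'
        _ ≤ ∑ a, (deg a : ℝ) := Finset.sum_le_sum_of_subset_of_nonneg (Finset.subset_univ _)
            fun _ _ _ => Nat.cast_nonneg _
        _ = F.card := by exact_mod_cast hdegsum
    rw [pow_succ]
    linarith
  have hrowF : ∀ a, ∑ b, incidence (Fc (i, j)) a b ≤ 2 ^ (i + 1) := by
    intro a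
    unfold incidence
    rw [Finset.sum_boole]
    by_cases h : lev a = i
    · refine le_trans ?_ (h ▸ hdeglt a)
      refine Nat.cast_le.2 (Finset.card_le_card fun b hb => ?_)
      exact Finset.mem_filter.2 ⟨mem_univ _, (Finset.mem_filter.1 (Finset.mem_filter.1 hb).2).1⟩
    · rw [Finset.filter_false_of_mem]
      · simp
      · intro b _ hb
        exact h (Prod.mk.inj (Finset.mem_filter.1 hb).2).1
  have hcolF : ∀ b, ∑ a, incidence (Fc (i, j)) a b ≤ 2 ^ (j + 1) := by
    intro b
    unfold incidence
    rw [Finset.sum_boole]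
    by_cases h : lev b = j
    · refine le_trans ?_ (h ▸ hdeglt b)
      refine Nat.cast_le.2 (Finset.card_le_card fun a ha => ?_)
      exact Finset.mem_filter.2
        ⟨mem_univ _, hsymm _ (Finset.mem_filter.1 (Finset.mem_filter.1 ha).2).1⟩
    · rw [Finset.filter_false_of_mem]
      · simp
      · intro a _ ha
        exact h (Prod.mk.inj (Finset.mem_filter.1 ha).2).2
  refine ⟨Fc (i, j), cls i, cls j, 2 ^ (i + 1), 2 ^ (j + 1), Finset.filter_subset _ _,
    pow_le_pow_right₀ one_le_two (by omega), ⟨?_, ?_, ⟨?_, hrowF, hcolF, by positivity, by positivity⟩,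
    hcls i, hcls j, ?_, by positivity⟩, ?_⟩
  · intro p hp
    obtain ⟨h1, h2⟩ := Finset.mem_filter.1 hp
    exact Finset.mem_filter.2 ⟨mem_univ _, hdegpos p h1, (Prod.mk.inj h2).1⟩
  · intro p hp
    obtain ⟨h1, h2⟩ := Finset.mem_filter.1 hp
    exact Finset.mem_filter.2 ⟨mem_univ _, hdegpos _ (hsymm p h1), (Prod.mk.inj h2).2⟩
  · intro a b
    unfold incidence
    split_ifs <;> simp
  · rw [← Finset.card_pos]
    have : (0 : ℝ) < (Fc (i, j)).card := by
      by_contra hcon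
      have : ((Fc (i, j)).card : ℝ) = 0 := le_antisymm (not_lt.1 hcon) (Nat.cast_nonneg _)
      rw [this, mul_zero] at hcard
      linarith
    exact_mod_cast this
  · refine hcard.trans (mul_le_mul_of_nonneg_left ?_ (by positivity))
    have h1 := sum_sum_incidence (Fc (i, j)) univ univ
    rw [Finset.filter_true_of_mem (fun _ _ => ⟨mem_univ _, mem_univ _⟩)] at h1
    rw [← h1, ← nsmul_eq_mul, ← Finset.card_univ, ← Finset.sum_const]
    exact Finset.sum_le_sum fun b _ => hcolF b

/-- A set of correlated pairs of nearly isotropic unit vectors is dense on some small set. -/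
theorem exists_dense_subset {F : Finset (ι × ι)} (hne : F.Nonempty)
    (hsymm : ∀ p ∈ F, p.swap ∈ F) {L : ℕ} (hL : L = Nat.log 2 (Fintype.card ι) + 1) {u : ι → E}
    (hu : ∀ a, ‖u a‖ = 1) (hF : ∀ p ∈ F, 1 / 4 ≤ |inner ℝ (u p.1) (u p.2)|) {s : ℝ} (hs0 : 0 < s)
    (hs : ∀ w, ∑ a, inner ℝ (u a) w ^ 2 ≤ s * ‖w‖ ^ 2) {l : ℕ} {θ μ : ℝ} (hθ : 0 < θ)
    (hμ : μ = (1 / (64 * L ^ 4)) ^ (2 * 2 ^ l) / s) (hθμ : θ ^ 2 ^ l ≤ μ) {g : ℕ} (hg : 0 < g)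
    {P φ : ℝ}
    (hP : ((Nat.log 2 ⌊4 / (θ * μ)⌋₊ + 1 : ℕ) : ℝ) * ((⌊4 / (θ * μ)⌋₊ / g + 1 : ℕ) : ℝ) ≤ P)
    (hφ : φ = θ / (16 * P)) :
    ∃ X : Finset ι, X.Nonempty ∧ X.card ≤ 2 * g ∧
      φ ^ 2 * F.card * X.card ≤
        8 * L ^ 2 * Fintype.card ι * ((F.filter fun p => p.1 ∈ X ∧ p.2 ∈ X).card : ℝ) := by
  obtain ⟨F', A, B, T₁, T₂, hF', hT, hreg, hcard⟩ := exists_nearlyBiregular hne hsymm hL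
  obtain ⟨X, hX, hXg, hXF⟩ := hreg.exists_dense hT hu (fun p hp => hF p (hF' hp)) hs0 hs hθ
    (by rw [hμ]; congr 3; ring) hθμ hg hP hφ
  refine ⟨X, hX, hXg, ?_⟩
  have h1 : ((F'.filter fun p => p.1 ∈ X ∧ p.2 ∈ X).card : ℝ) ≤
      ((F.filter fun p => p.1 ∈ X ∧ p.2 ∈ X).card : ℝ) :=
    Nat.cast_le.2 (Finset.card_le_card (Finset.filter_subset_filter _ hF'))
  calc φ ^ 2 * F.card * X.card ≤ φ ^ 2 * (L ^ 2 * (Fintype.card ι * T₂)) * X.card := by gcongr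
    _ = 8 * L ^ 2 * Fintype.card ι * (φ ^ 2 / 8 * T₂ * X.card) := by ring
    _ ≤ _ := mul_le_mul_of_nonneg_left (hXF.trans h1) (by positivity)

end Dyadic

/-! ### Greedy covering and merging -/

/-- Merging small sets, a family of sets covers the same pairs with few sets. -/
theorem exists_merged_family {ι : Type*} [Fintype ι] [DecidableEq ι] (Ss : Finset (Finset ι)) {c : ℕ}
    (hc : ∀ X ∈ Ss, X.card ≤ c) :
    ∃ Ss' : Finset (Finset ι), (∀ X ∈ Ss', X.card ≤ 2 * c) ∧ (∀ X ∈ Ss, ∃ Y ∈ Ss', X ⊆ Y) ∧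
      Ss'.card * c ≤ c + ∑ X ∈ Ss, X.card := by
  let P : Finset (Finset ι) → Prop := fun Ss' =>
    (∀ X ∈ Ss', X.card ≤ 2 * c) ∧ (∀ X ∈ Ss, ∃ Y ∈ Ss', X ⊆ Y) ∧
      ∑ X ∈ Ss', X.card ≤ ∑ X ∈ Ss, X.card
  classical
  obtain ⟨S, hS, hmin⟩ := Finset.exists_min_image (univ.filter P) Finset.card
    ⟨Ss, Finset.mem_filter.2 ⟨mem_univ _, fun X hX => (hc X hX).trans (by omega),
      fun X hX => ⟨X, hX, subset_rfl⟩, le_rfl⟩⟩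
  obtain ⟨-, h1, h2, h3⟩ := Finset.mem_filter.1 hS
  -- Two sets of size at most `c` could be replaced by their union, contradicting minimality of the
  -- number of sets. So all but one set are larger than `c`.
  have hone : ∀ X ∈ S, ∀ Y ∈ S, X.card ≤ c → Y.card ≤ c → X = Y := by
    intro X hX Y hY hXc hYc
    by_contra hne
    have hYe : Y ∈ S.erase X := Finset.mem_erase.2 ⟨Ne.symm hne, hY⟩
    have hcard : (insert (X ∪ Y) ((S.erase X).erase Y)).card < S.card := by
      have a1 := Finset.card_erase_add_one hX
      have a2 := Finset.card_erase_add_one hYe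
      have a3 := Finset.card_insert_le (X ∪ Y) ((S.erase X).erase Y)
      omega
    refine absurd (hmin (insert (X ∪ Y) ((S.erase X).erase Y)) ?_) (not_le.2 hcard)
    refine Finset.mem_filter.2 ⟨mem_univ _, ?_, ?_, ?_⟩
    · intro Z hZ
      rcases Finset.mem_insert.1 hZ with rfl | hZ
      · exact (Finset.card_union_le X Y).trans (by omega)
      · exact h1 Z (Finset.mem_of_mem_erase (Finset.mem_of_mem_erase hZ))
    · intro Z hZ
      obtain ⟨W, hW, hZW⟩ := h2 Z hZ
      by_cases hWX : W = X
      · exact ⟨X ∪ Y, Finset.mem_insert_self _ _, (hWX ▸ hZW).trans Finset.subset_union_left⟩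
      by_cases hWY : W = Y
      · exact ⟨X ∪ Y, Finset.mem_insert_self _ _, (hWY ▸ hZW).trans Finset.subset_union_right⟩
      · exact ⟨W, Finset.mem_insert_of_mem
          (Finset.mem_erase.2 ⟨hWY, Finset.mem_erase.2 ⟨hWX, hW⟩⟩), hZW⟩
    · refine le_trans ?_ h3
      rw [← Finset.add_sum_erase S _ hX, ← Finset.add_sum_erase _ _ hYe]
      have a1 : ∑ Z ∈ insert (X ∪ Y) ((S.erase X).erase Y), Z.card ≤
          (X ∪ Y).card + ∑ Z ∈ (S.erase X).erase Y, Z.card := by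
        by_cases h : X ∪ Y ∈ (S.erase X).erase Y
        · rw [Finset.insert_eq_of_mem h]; omega
        · rw [Finset.sum_insert h]
      have a2 := Finset.card_union_le X Y
      omega
  refine ⟨S, h1, h2, le_trans ?_ (Nat.add_le_add_left h3 c)⟩
  have hsmall : (S.filter fun X => X.card ≤ c).card ≤ 1 :=
    Finset.card_le_one.2 fun X hX Y hY => hone X (Finset.mem_filter.1 hX).1 Y
      (Finset.mem_filter.1 hY).1 (Finset.mem_filter.1 hX).2 (Finset.mem_filter.1 hY).2
  have hlarge : (S.filter fun X => ¬ X.card ≤ c).card * c ≤ ∑ X ∈ S, X.card := by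
    calc (S.filter fun X => ¬ X.card ≤ c).card * c = ∑ X ∈ S with ¬ X.card ≤ c, c := by
          rw [Finset.sum_const, smul_eq_mul]
      _ ≤ ∑ X ∈ S with ¬ X.card ≤ c, X.card :=
          Finset.sum_le_sum fun X hX => (not_le.1 (Finset.mem_filter.1 hX).2).le
      _ ≤ _ := Finset.sum_le_sum_of_subset (Finset.filter_subset _ _)
  rw [← Finset.card_filter_add_card_filter_not (s := S) (fun X => X.card ≤ c), add_mul]
  exact Nat.add_le_add ((Nat.mul_le_mul_right c hsmall).trans (by omega)) hlarge

/-- If every symmetric part of a set of pairs is dense on a small set, then small sets of small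
total size cover all the pairs. -/
theorem exists_cover_of_dense {ι : Type*} [DecidableEq ι] {H : Finset (ι × ι)} {c : ℕ}
    {M : ℝ} (hM : 0 ≤ M)
    (hdense : ∀ F ⊆ H, F.Nonempty → (∀ p ∈ F, p.swap ∈ F) → ∃ X : Finset ι, X.Nonempty ∧
      X.card ≤ c ∧ (F.card : ℝ) * X.card ≤ M * ((F.filter fun p => p.1 ∈ X ∧ p.2 ∈ X).card : ℝ))
    (N : ℕ) (F : Finset (ι × ι)) (hFN : F.card = N) (hFH : F ⊆ H) (hsymm : ∀ p ∈ F, p.swap ∈ F) :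
    ∃ Ss : Finset (Finset ι), (∀ X ∈ Ss, X.card ≤ c) ∧
      (∀ p ∈ F, ∃ X ∈ Ss, p.1 ∈ X ∧ p.2 ∈ X) ∧ ((∑ X ∈ Ss, X.card : ℕ) : ℝ) ≤ M * (harmonic N : ℝ) := by
  induction N using Nat.strong_induction_on generalizing F with
  | _ N ih =>
    rcases F.eq_empty_or_nonempty with rfl | hne
    · refine ⟨∅, by simp, by simp, ?_⟩
      rw [← hFN]; simp
    obtain ⟨X, hX, hXc, hXF⟩ := hdense F hFH hne hsymm
    set F₁ := F.filter fun p => p.1 ∈ X ∧ p.2 ∈ X with hF₁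
    set F₂ := F.filter fun p => ¬ (p.1 ∈ X ∧ p.2 ∈ X) with hF₂
    have hsplit : F₁.card + F₂.card = N := by
      rw [← hFN]; exact Finset.card_filter_add_card_filter_not _
    have hN : (0 : ℝ) < N := by rw [← hFN]; exact_mod_cast hne.card_pos
    have hXpos : (0 : ℝ) < X.card := by exact_mod_cast hX.card_pos
    rw [hFN] at hXF
    have hF₁pos : 0 < F₁.card := by
      rw [Nat.pos_iff_ne_zero]
      intro h0
      rw [h0, Nat.cast_zero, mul_zero] at hXF
      exact absurd hXF (not_le.2 (mul_pos hN hXpos))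
    obtain ⟨Ss, h1, h2, h3⟩ := ih F₂.card (by omega) F₂ rfl ((Finset.filter_subset _ _).trans hFH)
      (fun p hp => by
        obtain ⟨hp1, hp2⟩ := Finset.mem_filter.1 hp
        exact Finset.mem_filter.2 ⟨hsymm p hp1, fun h => hp2 h.symm⟩)
    refine ⟨insert X Ss, ?_, ?_, ?_⟩
    · intro Y hY
      rcases Finset.mem_insert.1 hY with rfl | hY
      · exact hXc
      · exact h1 Y hY
    · intro p hp
      by_cases hpX : p.1 ∈ X ∧ p.2 ∈ X
      · exact ⟨X, Finset.mem_insert_self _ _, hpX⟩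
      · obtain ⟨Y, hY, hpY⟩ := h2 p (Finset.mem_filter.2 ⟨hp, hpX⟩)
        exact ⟨Y, Finset.mem_insert_of_mem hY, hpY⟩
    · have hsum : ∑ Y ∈ insert X Ss, Y.card ≤ X.card + ∑ Y ∈ Ss, Y.card := by
        by_cases h : X ∈ Ss
        · rw [Finset.insert_eq_of_mem h]; omega
        · rw [Finset.sum_insert h]
      -- Each harmonic term between `F₂.card` and `N` is at least `1 / N`, so the fraction `F₁.card
      -- / N` of removed pairs is paid for by the drop of the harmonic number.
      have hharm : ∀ m : ℕ, m ≤ F₁.card →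
          (harmonic F₂.card : ℝ) + m / N ≤ (harmonic (F₂.card + m) : ℝ) := by
        intro m hm
        induction m with
        | zero => simp
        | succ m ihm =>
          have h4 := ihm (by omega)
          rw [← add_assoc, harmonic_succ]
          have h5 : (1 : ℝ) / N ≤ ((F₂.card + m + 1 : ℕ) : ℝ)⁻¹ := by
            rw [one_div]
            refine inv_anti₀ (by positivity) ?_
            exact_mod_cast (by omega : F₂.card + m + 1 ≤ N)
          push_cast at h5 ⊢
          rw [add_div]
          linarith
      have h6 := hharm F₁.card le_rfl
      rw [add_comm F₂.card, hsplit] at h6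
      have h7 : (X.card : ℝ) ≤ M * (F₁.card / N) := by
        rw [mul_div_assoc', le_div_iff₀ hN]; linarith
      calc ((∑ Y ∈ insert X Ss, Y.card : ℕ) : ℝ) ≤ X.card + ((∑ Y ∈ Ss, Y.card : ℕ) : ℝ) := by
            exact_mod_cast hsum
        _ ≤ M * (F₁.card / N) + M * (harmonic F₂.card : ℝ) := add_le_add h7 h3
        _ = M * ((harmonic F₂.card : ℝ) + F₁.card / N) := by ring
        _ ≤ _ := mul_le_mul_of_nonneg_left h6 hM

/-! ### Covering the correlated pairs, with explicit losses -/

section Cover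

variable {ι E : Type*} [Fintype ι] [DecidableEq ι] [NormedAddCommGroup E] [InnerProductSpace ℝ E]

/-- `exists_dense_subset` with all losses expressed through a base `x` with `n ≤ x ^ k ^ 2`. -/
theorem exists_dense_subset_pow {F : Finset (ι × ι)} (hne : F.Nonempty)
    (hsymm : ∀ p ∈ F, p.swap ∈ F) {u : ι → E}
    (hu : ∀ a, ‖u a‖ = 1) (hF : ∀ p ∈ F, 1 / 4 ≤ |inner ℝ (u p.1) (u p.2)|) {s : ℝ} (hs1 : 1 ≤ s)
    (hsn : s ≤ Fintype.card ι)
    (hs : ∀ w, ∑ a, inner ℝ (u a) w ^ 2 ≤ s * ‖w‖ ^ 2) {l k : ℕ} (hk : k = 2 ^ l) {x : ℝ}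
    (hx64 : 64 ≤ x) (hxk : ((k ^ 2 + 11 * k + 12 : ℕ) : ℝ) ≤ x)
    (hxn : (Fintype.card ι : ℝ) ≤ x ^ k ^ 2)
    (hxL : ((Nat.log 2 (Fintype.card ι) + 1 : ℕ) : ℝ) ≤ x) :
    ∃ X : Finset ι, X.Nonempty ∧ X.card ≤ 2 * ⌈s⌉₊ ∧
      (F.card : ℝ) * X.card ≤ x ^ (24 * k + 53) * Fintype.card ι *
        ((F.filter fun p => p.1 ∈ X ∧ p.2 ∈ X).card : ℝ) := by
  have hx0 : 0 < x := by linarith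
  have hx1 : 1 ≤ x := by linarith
  have hs0 : 0 < s := by linarith
  set L := Nat.log 2 (Fintype.card ι) + 1 with hL
  have hL1 : (1 : ℝ) ≤ L := by rw [hL]; push_cast; linarith [(Nat.cast_nonneg (Nat.log 2 (Fintype.card ι)) : (0 : ℝ) ≤ _)]
  have hκ : 64 * (L : ℝ) ^ 4 ≤ x ^ 5 := by
    calc 64 * (L : ℝ) ^ 4 ≤ x * x ^ 4 := by gcongr
      _ = x ^ 5 := by ring
  have hκ2 : (64 * (L : ℝ) ^ 4) ^ (2 * k) ≤ x ^ (10 * k) := by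
    calc (64 * (L : ℝ) ^ 4) ^ (2 * k) ≤ (x ^ 5) ^ (2 * k) := by gcongr
      _ = x ^ (10 * k) := by rw [← pow_mul]; congr 1; ring
  -- The `k`-th power of `θ` is `x ^ (-(k² + 10k))`: the part `k²` pays for `s ≤ n ≤ x ^ k²`, and
  -- `10k` for the regularization constant `(64 L⁴) ^ (2k)`.
  set θ : ℝ := (x ^ (k + 10))⁻¹ with hθ
  set μ : ℝ := (1 / (64 * (L : ℝ) ^ 4)) ^ (2 * 2 ^ l) / s with hμ
  have hμ' : μ = ((64 * (L : ℝ) ^ 4) ^ (2 * k) * s)⁻¹ := by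
    rw [hμ, hk, one_div, inv_pow, mul_inv, div_eq_mul_inv]
  have hθμ : θ ^ 2 ^ l ≤ μ := by
    rw [hμ', hθ, inv_pow, ← hk]
    refine inv_anti₀ (by positivity) ?_
    calc (64 * (L : ℝ) ^ 4) ^ (2 * k) * s ≤ x ^ (10 * k) * x ^ k ^ 2 := by
          gcongr; exact hsn.trans hxn
      _ = (x ^ (k + 10)) ^ k := by rw [← pow_mul, ← pow_add]; congr 1; ring
  have hZ : 4 / (θ * μ) ≤ s * x ^ (11 * k + 11) := by
    rw [hμ', hθ, ← mul_inv, div_inv_eq_mul]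
    calc 4 * (x ^ (k + 10) * ((64 * (L : ℝ) ^ 4) ^ (2 * k) * s))
        ≤ x * (x ^ (k + 10) * (x ^ (10 * k) * s)) := by gcongr; linarith
      _ = s * (x * x ^ (k + 10) * x ^ (10 * k)) := by ring
      _ = s * x ^ (11 * k + 11) := by
          rw [← pow_succ', ← pow_add]; congr 2; ring
  have hZ0 : 0 ≤ 4 / (θ * μ) := by
    rw [hμ', hθ]; positivity
  set Z := ⌊4 / (θ * μ)⌋₊ with hZdef
  have hZle : (Z : ℝ) ≤ s * x ^ (11 * k + 11) := (Nat.floor_le hZ0).trans hZ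
  have hg : 0 < ⌈s⌉₊ := Nat.ceil_pos.2 hs0
  have hq : ((Z / ⌈s⌉₊ + 1 : ℕ) : ℝ) ≤ x ^ (11 * k + 12) := by
    have h1 : ((Z / ⌈s⌉₊ : ℕ) : ℝ) ≤ x ^ (11 * k + 11) := by
      refine Nat.cast_div_le.trans ?_
      rw [div_le_iff₀ (by exact_mod_cast hg), mul_comm]
      exact hZle.trans (mul_le_mul_of_nonneg_right (Nat.le_ceil s) (by positivity))
    have h2 : 1 ≤ x ^ (11 * k + 11) := one_le_pow₀ hx1
    push_cast
    rw [pow_succ x (11 * k + 11)]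
    nlinarith
  have hlog : ((Nat.log 2 Z + 1 : ℕ) : ℝ) ≤ x ^ 2 := by
    have h1 : (Nat.log 2 Z : ℝ) ≤ (k ^ 2 + 11 * k + 11 : ℕ) * x := by
      rcases Nat.eq_zero_or_pos Z with h0 | h0
      · rw [h0]; simp; positivity
      have h2 : (Nat.log 2 Z : ℝ) ≤ Real.logb 2 Z := by
        exact_mod_cast Real.natLog_le_logb Z 2
      refine h2.trans ?_
      have h3 : (Z : ℝ) ≤ x ^ (k ^ 2 + 11 * k + 11) := by
        calc (Z : ℝ) ≤ s * x ^ (11 * k + 11) := hZle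
          _ ≤ x ^ k ^ 2 * x ^ (11 * k + 11) := by gcongr; exact hsn.trans hxn
          _ = _ := by rw [← pow_add]; congr 1
      have h4 : Real.logb 2 Z ≤ Real.logb 2 (x ^ (k ^ 2 + 11 * k + 11)) :=
        Real.logb_le_logb_of_le one_lt_two (by exact_mod_cast h0) h3
      rw [Real.logb_pow] at h4
      refine h4.trans (mul_le_mul_of_nonneg_left ?_ (Nat.cast_nonneg _))
      rw [Real.logb_le_iff_le_rpow one_lt_two hx0]
      have h5 := one_add_mul_self_le_rpow_one_add (s := 1) (by norm_num) (p := x) hx1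
      norm_num at h5
      linarith
    push_cast at h1 hxk ⊢
    nlinarith
  -- The number of pieces is at most `x²` dyadic levels times `x ^ (11 * k + 12)` blocks.
  set φ : ℝ := θ / (16 * x ^ (11 * k + 14)) with hφ
  obtain ⟨X, hX, hXg, hXF⟩ := exists_dense_subset hne hsymm hL hu hF hs0 hs (l := l) (θ := θ) (μ := μ)
    (by positivity) hμ hθμ hg (P := x ^ (11 * k + 14)) (φ := φ) (by
      calc _ ≤ x ^ 2 * x ^ (11 * k + 12) := by gcongr
        _ = x ^ (11 * k + 14) := by rw [← pow_add]; congr 1; ring) hφ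
  refine ⟨X, hX, hXg, ?_⟩
  have hφinv : φ = (16 * x ^ (12 * k + 24))⁻¹ := by
    rw [hφ, hθ, div_eq_mul_inv, ← mul_inv]
    congr 1
    rw [mul_left_comm, ← pow_add]; congr 2; ring
  have hφpos : 0 < φ := by rw [hφinv]; positivity
  rw [mul_assoc] at hXF
  have hcoef : 8 * (L : ℝ) ^ 2 ≤ φ ^ 2 * x ^ (24 * k + 53) := by
    rw [hφinv, inv_pow, ← div_eq_inv_mul, le_div_iff₀ (by positivity)]
    calc 8 * (L : ℝ) ^ 2 * (16 * x ^ (12 * k + 24)) ^ 2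
        = 8 * 16 * 16 * (L : ℝ) ^ 2 * x ^ (24 * k + 48) := by
          rw [mul_pow, ← pow_mul]; ring_nf
      _ ≤ (x * 64) * x ^ 2 * x ^ (24 * k + 48) := by
          have : 8 * 16 * 16 ≤ x * 64 := by linarith
          exact mul_le_mul_of_nonneg_right (mul_le_mul this (by gcongr) (by positivity)
            (by positivity)) (by positivity)
      _ ≤ (x * x) * x ^ 2 * x ^ (24 * k + 48) := by gcongr
      _ = x ^ (24 * k + 52) := by ring
      _ ≤ x ^ (24 * k + 53) := pow_le_pow_right₀ hx1 (by omega)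
  refine le_of_mul_le_mul_left (a := φ ^ 2) (hXF.trans ?_) (by positivity)
  rw [← mul_assoc, ← mul_assoc]
  gcongr

/-- The correlated pairs of nearly isotropic unit vectors are covered by few small sets. -/
theorem exists_cover_of_correlated {H : Finset (ι × ι)}
    (hsymm : ∀ p ∈ H, p.swap ∈ H) {u : ι → E}
    (hu : ∀ a, ‖u a‖ = 1) (hH : ∀ p ∈ H, 1 / 4 ≤ |inner ℝ (u p.1) (u p.2)|) {s : ℝ} (hs1 : 1 ≤ s)
    (hsn : s ≤ Fintype.card ι)
    (hs : ∀ w, ∑ a, inner ℝ (u a) w ^ 2 ≤ s * ‖w‖ ^ 2) {l k : ℕ} (hk : k = 2 ^ l) {x : ℝ}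
    (hx64 : 64 ≤ x) (hxk : ((k ^ 2 + 11 * k + 12 : ℕ) : ℝ) ≤ x)
    (hxn : (Fintype.card ι : ℝ) ≤ x ^ k ^ 2)
    (hxL : ((Nat.log 2 (Fintype.card ι) + 1 : ℕ) : ℝ) ≤ x) :
    ∃ Ss : Finset (Finset ι), (∀ X ∈ Ss, (X.card : ℝ) ≤ 8 * s) ∧
      (∀ p ∈ H, ∃ X ∈ Ss, p.1 ∈ X ∧ p.2 ∈ X) ∧
      (Ss.card : ℝ) ≤ 1 + x ^ (24 * k + 55) * Fintype.card ι / s := by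
  have hx0 : 0 < x := by linarith
  obtain ⟨Ss, h1, h2, h3⟩ := exists_cover_of_dense (H := H) (c := 2 * ⌈s⌉₊)
    (M := x ^ (24 * k + 53) * Fintype.card ι) (by positivity)
    (fun F hFH hne hFs => exists_dense_subset_pow hne hFs hu (fun p hp => hH p (hFH hp)) hs1 hsn hs hk
      hx64 hxk hxn hxL) H.card H rfl subset_rfl hsymm
  obtain ⟨Ss', h4, h5, h6⟩ := exists_merged_family Ss h1
  have hceil : (⌈s⌉₊ : ℝ) ≤ 2 * s := by linarith [(Nat.ceil_lt_add_one (by linarith : 0 ≤ s)).le]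
  have hceil' := Nat.le_ceil s
  refine ⟨Ss', fun X hX => ?_, fun p hp => ?_, ?_⟩
  · have : (X.card : ℝ) ≤ 2 * (2 * ⌈s⌉₊) := by exact_mod_cast h4 X hX
    linarith
  · obtain ⟨X, hX, hp1, hp2⟩ := h2 p hp
    obtain ⟨Y, hY, hXY⟩ := h5 X hX
    exact ⟨Y, hY, hXY hp1, hXY hp2⟩
  -- The harmonic number is at most `1 + 2 log n`, hence costs only two more powers of `x`.
  · have hharm : (harmonic H.card : ℝ) ≤ x ^ 2 := by
      refine (harmonic_le_one_add_log _).trans ?_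
      have hn0 : (0 : ℝ) < Fintype.card ι := by linarith
      have hHn : (H.card : ℝ) ≤ (Fintype.card ι : ℝ) ^ 2 := by
        have := Finset.card_le_univ H
        rw [Fintype.card_prod] at this
        rw [sq]; exact_mod_cast this
      have hlog : Real.log H.card ≤ 2 * x := by
        rcases Nat.eq_zero_or_pos H.card with h0 | h0
        · rw [h0]; simp; positivity
        have h7 : Real.log H.card ≤ Real.log ((Fintype.card ι : ℝ) ^ 2) :=
          Real.log_le_log (by exact_mod_cast h0) hHn
        rw [Real.log_pow] at h7
        have h8 : Real.log (Fintype.card ι) ≤ x := by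
          refine le_trans ?_ hxL
          have h9 : (Fintype.card ι : ℝ) ≤ 2 ^ (Nat.log 2 (Fintype.card ι) + 1) := by
            exact_mod_cast (Nat.lt_pow_succ_log_self one_lt_two _).le
          have h10 := Real.log_le_log hn0 h9
          rw [Real.log_pow] at h10
          refine h10.trans (mul_le_of_le_one_right (Nat.cast_nonneg _) ?_)
          linarith [Real.log_two_lt_d9]
        push_cast at h7
        linarith
      nlinarith
    have h7 : ((Ss'.card : ℝ)) * (2 * ⌈s⌉₊) ≤ 2 * ⌈s⌉₊ + ((∑ X ∈ Ss, X.card : ℕ) : ℝ) := by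
      exact_mod_cast h6
    have h8 : ((∑ X ∈ Ss, X.card : ℕ) : ℝ) ≤ x ^ (24 * k + 55) * Fintype.card ι := by
      refine h3.trans ?_
      calc x ^ (24 * k + 53) * Fintype.card ι * (harmonic H.card : ℝ)
          ≤ x ^ (24 * k + 53) * Fintype.card ι * x ^ 2 :=
            mul_le_mul_of_nonneg_left hharm
              (mul_nonneg (pow_nonneg hx0.le _) (Nat.cast_nonneg _))
        _ = _ := by ring
    have hs0 : 0 < s := by linarith
    have h11 : 0 ≤ x ^ (24 * k + 55) * Fintype.card ι / s :=
      div_nonneg (mul_nonneg (pow_nonneg hx0.le _) (Nat.cast_nonneg _)) hs0.le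
    generalize x ^ (24 * k + 55) * (Fintype.card ι : ℝ) = y at h8 h11 ⊢
    have h9 : ((Ss'.card : ℝ) - 1) * (2 * ⌈s⌉₊) ≤ y := by linarith
    by_cases hm : (Ss'.card : ℝ) ≤ 1
    · linarith
    · have h10 : (Ss'.card : ℝ) - 1 ≤ y / s := by
        rw [le_div_iff₀ hs0]
        refine le_trans ?_ h9
        exact mul_le_mul_of_nonneg_left (by linarith) (by linarith)
      linarith

end Cover

/-! ### Restricting matchings to correlated triples -/

section Restriction

variable {ι κ E : Type*}

theorem IsQMatching.subset {q : ℕ} {M N : Finset (Finset ι)} (hM : IsQMatching q M) (h : N ⊆ M) :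
    IsQMatching q N :=
  ⟨fun τ hτ => hM.1 τ (h hτ), hM.2.subset (by exact_mod_cast h)⟩

/-- Pairwise disjoint sets which all meet `B` are at most as many as the elements of `B`. -/
theorem IsQMatching.card_le_of_meets {q : ℕ} {M : Finset (Finset ι)}
    (hM : IsQMatching q M) {B : Finset ι} (h : ∀ τ ∈ M, ∃ i ∈ τ, i ∈ B) : M.card ≤ B.card := by
  rcases M.eq_empty_or_nonempty with rfl | ⟨τ₀, hτ₀⟩
  · simp
  have : Nonempty ι := ⟨(h τ₀ hτ₀).choose⟩
  choose! f hf using h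
  refine Finset.card_le_card_of_injOn f (fun τ hτ => (hf τ hτ).2) ?_
  intro τ hτ σ hσ hτσ
  by_contra hne
  have h1 := Finset.disjoint_left.1 (hM.2 hτ hσ hne) (hf τ hτ).1
  have h2 := (hf σ hσ).1
  exact h1 (by rw [hτσ]; exact h2)

/-- The tuples of a matching lying in the range of an embedding form a matching of the source. -/
theorem IsQMatching.exists_restrict [Fintype κ] [DecidableEq κ] [Fintype ι] [DecidableEq ι]
    {q : ℕ} {M : Finset (Finset ι)} (hM : IsQMatching q M) (e : κ ↪ ι) :
    ∃ N : Finset (Finset κ), IsQMatching q N ∧ (∀ τ ∈ N, τ.map e ∈ M) ∧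
      M.card ≤ N.card + ((univ.map e)ᶜ).card := by
  set N : Finset (Finset κ) := univ.filter fun τ => τ.map e ∈ M with hN
  have hmem : ∀ τ ∈ N, τ.map e ∈ M := fun τ hτ => (Finset.mem_filter.1 hτ).2
  refine ⟨N, ⟨fun τ hτ => ?_, fun τ hτ σ hσ hne => ?_⟩, hmem, ?_⟩
  · rw [← Finset.card_map e]; exact hM.1 _ (hmem τ hτ)
  · have h1 := hM.2 (hmem τ hτ) (hmem σ hσ) fun h => hne (Finset.map_injective e h)
    exact (Finset.disjoint_map e).1 h1
  · have hsplit : M ⊆ N.image (fun τ => τ.map e) ∪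
        M.filter fun τ => ∃ i ∈ τ, i ∈ (univ.map e)ᶜ := by
      intro τ hτ
      by_cases h : ∃ i ∈ τ, i ∈ (univ.map e)ᶜ
      · exact Finset.mem_union_right _ (Finset.mem_filter.2 ⟨hτ, h⟩)
      · push Not at h
        have h1 : τ ⊆ univ.map e := fun i hi => by
          have := h i hi
          rwa [Finset.mem_compl, not_not] at this
        obtain ⟨σ, -, rfl⟩ := Finset.subset_map_iff.1 h1
        exact Finset.mem_union_left _ (Finset.mem_image.2
          ⟨σ, Finset.mem_filter.2 ⟨Finset.mem_univ _, hτ⟩, rfl⟩)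
    refine (Finset.card_le_card hsplit).trans ((Finset.card_union_le _ _).trans ?_)
    refine Nat.add_le_add Finset.card_image_le ?_
    exact (hM.subset (Finset.filter_subset _ _)).card_le_of_meets
      fun τ hτ => (Finset.mem_filter.1 hτ).2

variable [NormedAddCommGroup E] [InnerProductSpace ℝ E] [Fintype ι]

/-- In nearly isotropic position a vector is correlated with few others. -/
theorem card_correlated_le {u : ι → E} {s : ℝ} (hs : ∀ w, ∑ a, inner ℝ (u a) w ^ 2 ≤ s * ‖w‖ ^ 2)
    {w : E} (hw : ‖w‖ = 1) :
    ((univ.filter fun i => 1 / 4 ≤ |inner ℝ (u i) w|).card : ℝ) ≤ 16 * s := by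
  have h1 : ((univ.filter fun i => 1 / 4 ≤ |inner ℝ (u i) w|).card : ℝ) * (1 / 16) ≤
      ∑ a, inner ℝ (u a) w ^ 2 := by
    rw [← nsmul_eq_mul]
    refine (Finset.card_nsmul_le_sum _ (fun a => inner ℝ (u a) w ^ 2) _ fun i hi => ?_).trans
      (Finset.sum_le_sum_of_subset_of_nonneg (Finset.filter_subset _ _) fun _ _ _ => sq_nonneg _)
    have h2 := (Finset.mem_filter.1 hi).2
    rw [← sq_abs]
    nlinarith
  have h3 := hs w
  rw [hw] at h3
  linarith

/-- Few triples of a decoding matching consist of weakly correlated vectors. -/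
theorem card_uncorrelated_le {u : ι → E} (hu : ∀ a, ‖u a‖ = 1) {s : ℝ}
    (hs : ∀ w, ∑ a, inner ℝ (u a) w ^ 2 ≤ s * ‖w‖ ^ 2) {M : Finset (Finset ι)}
    (hM : IsQMatching 3 M) {p : E} (hp : ‖p‖ = 1)
    (hspan : ∀ τ ∈ M, p ∈ Submodule.span ℝ (u '' (τ : Set ι)))
    (hweak : ∀ τ ∈ M, ∀ i ∈ τ, ∀ j ∈ τ, i ≠ j → |inner ℝ (u i) (u j)| < 1 / 4) :
    (M.card : ℝ) ≤ 16 * s := by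
  classical
  -- Every triple in `M` must contain an index correlated with `p`, and disjoint triples use
  -- different indices.
  refine le_trans ?_ (card_correlated_le hs hp)
  refine Nat.cast_le.2 (hM.card_le_of_meets fun τ hτ => ?_)
  by_contra hcon
  push Not at hcon
  obtain ⟨i, j, k, hij, hik, hjk, rfl⟩ := Finset.card_eq_three.1 (hM.1 τ hτ)
  have hsmall : ∀ a ∈ ({i, j, k} : Finset ι), |inner ℝ p (u a)| ≤ 1 / 4 * ‖p‖ := by
    intro a ha
    have h1 := hcon a ha
    rw [Finset.mem_filter] at h1
    push Not at h1
    rw [real_inner_comm, hp, mul_one]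
    exact (h1 (Finset.mem_univ a)).le
  have hpz := eq_zero_of_weakly_correlated (p := p) (hu i) (hu j) (hu k)
    (hweak _ hτ i (by simp) j (by simp) hij) (hweak _ hτ i (by simp) k (by simp) hik)
    (hweak _ hτ j (by simp) k (by simp) hjk) (hsmall i (by simp)) (hsmall j (by simp))
    (hsmall k (by simp)) (by
      have := hspan _ hτ
      simpa [Set.image_insert_eq] using this)
  rw [hpz, norm_zero] at hp
  exact zero_ne_one hp

end Restriction

/-- A robustly high-dimensional LCC has a large sublist, nearly isotropic after a linear change of
coordinates, most of whose decoding triples contain a correlated pair. -/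
theorem exists_correlated_restriction {n d : ℕ} {v : Fin n → EuclideanSpace ℝ (Fin d)}
    (hspan : Submodule.span ℝ (Set.range v) = ⊤) {δ : ℝ}
    {M : Fin n → Finset (Finset (Fin n))} (hM : IsDecoding 3 δ v M) {w α s : ℝ} (hw : 0 < w)
    (hα : 2 * α ≤ n) (hs : 2 * n / w ≤ s)
    (hdim : ∀ U : Finset (Fin n), α ≤ (U.card : ℝ) → w ≤ (subDim v U : ℝ)) :
    ∃ (n' : ℕ) (e : Fin n' ↪ Fin n) (u : Fin n' → EuclideanSpace ℝ (Fin d))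
      (H : Finset (Fin n' × Fin n')) (N : Fin n' → Finset (Finset (Fin n'))),
      (n : ℝ) - α ≤ n' ∧ (∀ a, ‖u a‖ = 1) ∧ (∀ w, ∑ a, inner ℝ (u a) w ^ 2 ≤ s * ‖w‖ ^ 2) ∧
      (∀ p ∈ H, p.swap ∈ H) ∧ (∀ p ∈ H, p.1 ≠ p.2) ∧
      (∀ p ∈ H, 1 / 4 ≤ |inner ℝ (u p.1) (u p.2)|) ∧ (H.card : ℝ) ≤ n' * (16 * s) ∧
      (∀ a, IsQMatching 3 (N a)) ∧ (∀ a, δ * n - α - 16 * s ≤ (N a).card) ∧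
      (∀ a, ∀ τ ∈ N a, v (e a) ∈ Submodule.span ℝ (v ∘ e '' (τ : Set (Fin n')))) ∧
      (∀ a, ∀ τ ∈ N a, ∃ p ∈ H, p.1 ∈ τ ∧ p.2 ∈ τ) ∧ w ≤ listDim (v ∘ e) := by
  classical
  obtain ⟨T, G, hT, hGc, hG0, hGs⟩ := exists_isotropic_position v hspan hw
    (by rw [Fintype.card_fin]; linarith) hdim
  rw [Fintype.card_fin] at hGs
  set e : Fin G.card ↪ Fin n := (G.orderEmbOfFin rfl).toEmbedding with he
  have hmap : univ.map e = G := by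
    rw [he]; exact Finset.map_orderEmbOfFin_univ G rfl
  have heG : ∀ a, e a ∈ G := fun a => hmap.subset (Finset.mem_map_of_mem _ (mem_univ a))
  have hTv : ∀ a, ‖T (v (e a))‖ ≠ 0 := fun a => by
    rw [norm_ne_zero_iff, Ne, map_eq_zero_iff T hT]; exact hG0 _ (heG a)
  set u : Fin G.card → EuclideanSpace ℝ (Fin d) := fun a => ‖T (v (e a))‖⁻¹ • T (v (e a)) with hu
  have hu1 : ∀ a, ‖u a‖ = 1 := fun a => by
    rw [hu]; simp only [norm_smul, norm_inv, norm_norm]; exact inv_mul_cancel₀ (hTv a)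
  have hus : ∀ x, ∑ a, inner ℝ (u a) x ^ 2 ≤ s * ‖x‖ ^ 2 := by
    intro x
    have h1 : ∑ a, inner ℝ (u a) x ^ 2 =
        ∑ i ∈ G, inner ℝ (T (v i)) x ^ 2 / ‖T (v i)‖ ^ 2 := by
      conv_rhs => rw [← hmap]
      rw [Finset.sum_map]
      refine Finset.sum_congr rfl fun a _ => ?_
      rw [hu]
      simp only [real_inner_smul_left]
      rw [mul_pow, inv_pow, div_eq_inv_mul]
    rw [h1]
    exact (hGs x).trans (mul_le_mul_of_nonneg_right hs (sq_nonneg _))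
  set H : Finset (Fin G.card × Fin G.card) :=
    univ.filter fun p => p.1 ≠ p.2 ∧ 1 / 4 ≤ |inner ℝ (u p.1) (u p.2)| with hH
  have hHmem : ∀ p, p ∈ H ↔ p.1 ≠ p.2 ∧ 1 / 4 ≤ |inner ℝ (u p.1) (u p.2)| := fun p => by
    rw [hH, Finset.mem_filter]; simp
  choose N₀ hN₀ hN₀M hN₀c using fun a => (hM.isQMatching (e a)).exists_restrict e
  rw [hmap] at hN₀c
  have hvimg : ∀ τ : Finset (Fin G.card), v ∘ e '' (τ : Set (Fin G.card)) =
      v '' ((τ.map e : Finset (Fin n)) : Set (Fin n)) := fun τ => by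
    rw [Finset.coe_map, Set.image_comp]
  have hmemspan : ∀ a, ∀ τ ∈ N₀ a,
      v (e a) ∈ Submodule.span ℝ (v ∘ e '' (τ : Set (Fin G.card))) := fun a τ hτ => by
    rw [hvimg]; exact hM.mem_span _ _ (hN₀M a τ hτ)
  have huspan : ∀ a, ∀ τ ∈ N₀ a, u a ∈ Submodule.span ℝ (u '' (τ : Set (Fin G.card))) := by
    intro a τ hτ
    refine Submodule.smul_mem _ _ ?_
    have h1 := Submodule.mem_map_of_mem (f := T) (hmemspan a τ hτ)
    rw [Submodule.map_span] at h1
    refine Submodule.span_le.2 ?_ h1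
    rintro _ ⟨_, ⟨b, hb, rfl⟩, rfl⟩
    have h2 : T ((v ∘ e) b) = ‖T (v (e b))‖ • u b := by
      rw [hu]; simp only [smul_smul]; rw [mul_inv_cancel₀ (hTv b), one_smul]; rfl
    rw [SetLike.mem_coe, h2]
    exact Submodule.smul_mem _ _ (Submodule.subset_span ⟨b, hb, rfl⟩)
  refine ⟨G.card, e, u, H, fun a => (N₀ a).filter fun τ => ∃ p ∈ H, p.1 ∈ τ ∧ p.2 ∈ τ,
    ?_, hu1, hus, ?_, fun p hp => ((hHmem p).1 hp).1, fun p hp => ((hHmem p).1 hp).2, ?_,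
    fun a => (hN₀ a).subset (Finset.filter_subset _ _), ?_,
    fun a τ hτ => hmemspan a τ (Finset.mem_filter.1 hτ).1,
    fun a τ hτ => (Finset.mem_filter.1 hτ).2, ?_⟩
  · have h1 := Finset.card_add_card_compl G
    rw [Fintype.card_fin] at h1
    have h2 : (G.card : ℝ) + Gᶜ.card = n := by exact_mod_cast h1
    linarith
  · intro p hp
    rw [hHmem] at hp ⊢
    exact ⟨hp.1.symm, by rw [Prod.fst_swap, Prod.snd_swap, real_inner_comm]; exact hp.2⟩
  · have h1 : H.card = ∑ b, (H.filter fun p => p.2 = b).card :=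
      Finset.card_eq_sum_card_fiberwise fun _ _ => Finset.mem_coe.2 (mem_univ _)
    rw [h1]
    push_cast
    have h2 : ∀ b, ((H.filter fun p => p.2 = b).card : ℝ) ≤ 16 * s := by
      intro b
      refine le_trans ?_ (card_correlated_le hus (hu1 b))
      refine Nat.cast_le.2 (Finset.card_le_card_of_injOn Prod.fst (fun p hp => ?_) ?_)
      · obtain ⟨hp1, rfl⟩ := Finset.mem_filter.1 hp
        exact Finset.mem_coe.2 (Finset.mem_filter.2 ⟨mem_univ _, ((hHmem p).1 hp1).2⟩)
      · intro p hp q hq hpq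
        exact Prod.ext hpq ((Finset.mem_filter.1 hp).2.trans (Finset.mem_filter.1 hq).2.symm)
    refine (Finset.sum_le_sum fun b _ => h2 b).trans ?_
    rw [Finset.sum_const, Finset.card_univ, Fintype.card_fin, nsmul_eq_mul]
  · intro a
    have h1 := hM.le_card (e a)
    rw [Fintype.card_fin] at h1
    have h2 : ((M (e a)).card : ℝ) ≤ (N₀ a).card + Gᶜ.card := by exact_mod_cast hN₀c a
    have h3 : (((N₀ a).filter fun τ => ¬ ∃ p ∈ H, p.1 ∈ τ ∧ p.2 ∈ τ).card : ℝ) ≤ 16 * s := by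
      refine card_uncorrelated_le hu1 hus ((hN₀ a).subset (Finset.filter_subset _ _)) (hu1 a)
        (fun τ hτ => huspan a τ (Finset.mem_filter.1 hτ).1) fun τ hτ i hi j hj hij => ?_
      have h4 := (Finset.mem_filter.1 hτ).2
      by_contra h5
      exact h4 ⟨(i, j), (hHmem _).2 ⟨hij, not_lt.1 h5⟩, hi, hj⟩
    have h4 : (((N₀ a).filter fun τ => ∃ p ∈ H, p.1 ∈ τ ∧ p.2 ∈ τ).card : ℝ) +
        ((N₀ a).filter fun τ => ¬ ∃ p ∈ H, p.1 ∈ τ ∧ p.2 ∈ τ).card = (N₀ a).card := by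
      exact_mod_cast Finset.card_filter_add_card_filter_not _
    linarith
  · have h1 : α ≤ G.card := by
      have h1 := Finset.card_add_card_compl G
      rw [Fintype.card_fin] at h1
      have h2 : (G.card : ℝ) + Gᶜ.card = n := by exact_mod_cast h1
      linarith
    refine (hdim G h1).trans (le_of_eq ?_)
    have h2 : Set.range e = (G : Set (Fin n)) := by
      rw [← Set.image_univ, ← Finset.coe_univ, ← Finset.coe_map, hmap]
    rw [subDim, listDim, Set.range_comp, h2]

/-! ### Counting with matchings -/

section Matchings

variable {ι : Type*} [DecidableEq ι]

theorem IsQMatching.mul_card_le [Fintype ι] {q : ℕ} {M : Finset (Finset ι)} (hM : IsQMatching q M) :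
    q * M.card ≤ Fintype.card ι := by
  have h1 : (M.biUnion id).card = q * M.card := by
    rw [Finset.card_biUnion fun τ hτ σ hσ hne => hM.2 hτ hσ hne, mul_comm]
    exact Finset.sum_const_nat fun τ hτ => hM.1 τ hτ
  rw [← h1]
  exact Finset.card_le_univ _

/-- A matching clustered by sets of size at most `g` is at most `g` times as large as the number
of these sets. -/
theorem IsQMatching.card_le_of_clustered {q : ℕ} {N : Finset (Finset ι)}
    (hN : IsQMatching q N) {Ss : Finset (Finset ι)} {g : ℝ} (hg : ∀ X ∈ Ss, (X.card : ℝ) ≤ g)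
    (h : ∀ τ ∈ N, ∃ X ∈ Ss, ∃ i ∈ τ, i ∈ X) : (N.card : ℝ) ≤ Ss.card * g := by
  have h1 : N ⊆ Ss.biUnion fun X => N.filter fun τ => ∃ i ∈ τ, i ∈ X := fun τ hτ => by
    obtain ⟨X, hX, hi⟩ := h τ hτ
    exact Finset.mem_biUnion.2 ⟨X, hX, Finset.mem_filter.2 ⟨hτ, hi⟩⟩
  have h2 : (N.card : ℝ) ≤ ∑ X ∈ Ss, ((N.filter fun τ => ∃ i ∈ τ, i ∈ X).card : ℝ) := by
    exact_mod_cast (Finset.card_le_card h1).trans Finset.card_biUnion_le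
  refine h2.trans ((Finset.sum_le_sum fun X hX => ?_).trans_eq
    ((Finset.sum_const _).trans (nsmul_eq_mul _ _)))
  refine le_trans ?_ (hg X hX)
  exact Nat.cast_le.2 ((hN.subset (Finset.filter_subset _ _)).card_le_of_meets
    fun τ hτ => (Finset.mem_filter.1 hτ).2)

theorem exists_fin_enumeration {α : Type*} (Ss : Finset α) :
    ∃ S : Fin Ss.card → α, (∀ k, S k ∈ Ss) ∧ ∀ X ∈ Ss, ∃ k, S k = X :=
  ⟨fun k => (Ss.equivFin.symm k : α), fun k => (Ss.equivFin.symm k).2,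
    fun X hX => ⟨Ss.equivFin ⟨X, hX⟩, by simp⟩⟩

theorem two_le_card_inter {τ X : Finset ι} {i j : ι} (hij : i ≠ j) (hi : i ∈ τ) (hj : j ∈ τ)
    (hi' : i ∈ X) (hj' : j ∈ X) : 2 ≤ (τ ∩ X).card := by
  rw [← Finset.card_pair hij]
  refine Finset.card_le_card fun a ha => ?_
  rcases Finset.mem_insert.1 ha with rfl | ha
  · exact Finset.mem_inter.2 ⟨hi, hi'⟩
  · rw [Finset.mem_singleton.1 ha]; exact Finset.mem_inter.2 ⟨hj, hj'⟩

end Matchings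

/-! ### Asymptotic and dimensional estimates -/

section Numerics

theorem exists_threshold {r β : ℝ} (hr : 0 < r) (hβ : 0 < β) (c : ℝ) :
    ∃ N₀ : ℝ, ∀ y, N₀ ≤ y → Real.log y ≤ y ^ β ∧ c ≤ y ^ r ∧ 2 * Real.log y + 1 ≤ y ^ r := by
  have h1 := (isLittleO_log_rpow_atTop hβ).bound one_pos
  have h2 := (isLittleO_log_rpow_atTop hr).bound (by norm_num : (0 : ℝ) < 1 / 4)
  have h3 := (tendsto_rpow_atTop hr).eventually_ge_atTop (max c 2)
  obtain ⟨N₀, hN₀⟩ := Filter.eventually_atTop.1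
    (h1.and (h2.and (h3.and (Filter.eventually_ge_atTop 1))))
  refine ⟨N₀, fun y hy => ?_⟩
  obtain ⟨a1, a2, a3, a4⟩ := hN₀ y hy
  have hy0 : 0 ≤ y := by linarith
  rw [Real.norm_eq_abs, Real.norm_eq_abs, abs_of_nonneg (Real.log_nonneg a4),
    abs_of_nonneg (Real.rpow_nonneg hy0 _)] at a1 a2
  have a5 := (le_max_left c 2).trans a3
  have a6 := (le_max_right c 2).trans a3
  exact ⟨by linarith, a5, by linarith⟩

theorem natCast_log_add_one_le {a n : ℕ} (han : a ≤ n) (hn : 1 ≤ n) :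
    ((Nat.log 2 a + 1 : ℕ) : ℝ) ≤ 2 * Real.log n + 1 := by
  have h1 : (Nat.log 2 a : ℝ) ≤ Nat.log 2 n := by exact_mod_cast Nat.log_mono_right han
  have h2 : (Nat.log 2 n : ℝ) ≤ Real.logb 2 n := by exact_mod_cast Real.natLog_le_logb n 2
  have h3 : Real.logb 2 n ≤ 2 * Real.log n := by
    rw [Real.logb, div_le_iff₀ (Real.log_pos one_lt_two)]
    have h4 : 0 ≤ Real.log n := Real.log_nonneg (by exact_mod_cast hn)
    nlinarith [Real.log_two_gt_d9]
  push_cast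
  linarith

/-- With `x = n ^ (1/k²)` and `k = 2^l`, this makes the total loss `x ^ (24k + 55)` at most `n ^ β`.
-/
theorem exists_two_pow_mul_le {β : ℝ} (hβ : 0 < β) :
    ∃ l : ℕ, ((24 * 2 ^ l + 55 : ℕ) : ℝ) ≤ β * (2 ^ l : ℕ) ^ 2 := by
  obtain ⟨l, hl⟩ := pow_unbounded_of_one_lt (79 / β) (one_lt_two (α := ℝ))
  refine ⟨l, ?_⟩
  rw [div_lt_iff₀ hβ] at hl
  have h1 : (1 : ℝ) ≤ 2 ^ l := one_le_pow₀ one_le_two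
  push_cast
  nlinarith

theorem natCast_mul_one_sub_pow_le_one {n : ℕ} (hn : 1 ≤ n) {y : ℝ} (hy0 : 0 < y) (hy1 : y ≤ 1) {q : ℕ}
    (hq : Real.log n / y ≤ q) : n * (1 - y) ^ q ≤ 1 := by
  have hn0 : (0 : ℝ) < n := by exact_mod_cast hn
  rw [div_le_iff₀ hy0] at hq
  have h1 : (1 - y) ^ q ≤ Real.exp (-y) ^ q :=
    pow_le_pow_left₀ (by linarith) (by linarith [Real.add_one_le_exp (-y)]) q
  rw [← Real.exp_nat_mul] at h1
  calc n * (1 - y) ^ q ≤ n * Real.exp (q * -y) := by gcongr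
    _ ≤ n * Real.exp (-Real.log n) := by gcongr; linarith
    _ = 1 := by rw [Real.exp_neg, Real.exp_log hn0, mul_inv_cancel₀ hn0.ne']

/-- Multiplying by `δ⁷d` gives `δ¹³d² ≤ 9nL`; the constant 9 is absorbed by `δ² ≤ 1/9`, which raises
the exponent to 15. -/
theorem sq_le_of_le_inv_mul {δ n d L : ℝ} {q : ℕ} (hδ : 0 < δ) (hδ3 : δ ≤ 1 / 3) (hd : 0 < d)
    (hdn : d ≤ n) (hL : 1 ≤ L) (hq : (q : ℝ) ≤ 32 * n * L / (δ ^ 7 * d) + 1)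
    (h : 8 * δ ^ 6 * d ≤ 2 * q + 2 / (δ / 2) + 1) : d ^ 2 ≤ n * L * (1 / δ) ^ 15 := by
  have h1 : 2 / (δ / 2) + 3 ≤ 5 / δ := by
    rw [div_add' _ _ _ (by positivity), div_le_div_iff₀ (by positivity) hδ]; nlinarith
  have h2 : 8 * δ ^ 6 * d ≤ 64 * n * L / (δ ^ 7 * d) + 5 / δ := by
    have : 64 * n * L / (δ ^ 7 * d) = 2 * (32 * n * L / (δ ^ 7 * d)) := by ring
    linarith
  have h3 : 8 * δ ^ 13 * d ^ 2 ≤ 64 * n * L + 5 * δ ^ 6 * d := by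
    have h4 := mul_le_mul_of_nonneg_right h2 (by positivity : 0 ≤ δ ^ 7 * d)
    have h5 : (64 * n * L / (δ ^ 7 * d) + 5 / δ) * (δ ^ 7 * d) = 64 * n * L + 5 * δ ^ 6 * d := by
      field_simp
    rw [h5] at h4
    linarith
  have hn : 0 < n := by linarith
  have h4 : δ ^ 6 ≤ 1 := pow_le_one₀ hδ.le (by linarith)
  have h5 : δ ^ 6 * d ≤ 1 * (n * L) := by
    refine mul_le_mul h4 (by nlinarith) hd.le zero_le_one
  have h6 : δ ^ 13 * d ^ 2 ≤ 9 * (n * L) := by nlinarith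
  have h7 : δ ^ 2 ≤ 1 / 9 := by nlinarith
  rw [one_div, inv_pow, ← div_eq_mul_inv, le_div_iff₀ (by positivity)]
  calc d ^ 2 * δ ^ 15 = δ ^ 13 * d ^ 2 * δ ^ 2 := by ring
    _ ≤ 9 * (n * L) * (1 / 9) := mul_le_mul h6 h7 (by positivity) (by positivity)
    _ = n * L := by ring

end Numerics

/-- The decoding condition restricted by a sparse set of correlated pairs bounds the dimension. -/
theorem listDim_le_of_pairs {n : ℕ} {E : Type*} [AddCommGroup E] [Module ℝ E]
    [FiniteDimensional ℝ E] {v : Fin n → E} {H : Finset (Fin n × Fin n)}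
    {N : Fin n → Finset (Finset (Fin n))} (hne : ∀ p ∈ H, p.1 ≠ p.2)
    (hN : ∀ a, IsQMatching 3 (N a))
    (hspan : ∀ a, ∀ τ ∈ N a, v a ∈ Submodule.span ℝ (v '' (τ : Set (Fin n))))
    (hpair : ∀ a, ∀ τ ∈ N a, ∃ p ∈ H, p.1 ∈ τ ∧ p.2 ∈ τ) {κ t : ℝ} (hκ : 0 < κ) (ht : 0 < t)
    (hκt : κ ≤ 4 * t) (hNc : ∀ a, κ * n ≤ (N a).card) (hH : (H.card : ℝ) ≤ n * t) {q : ℕ}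
    (hq : n * (1 - κ / (4 * t)) ^ q ≤ 1) : (listDim v : ℝ) ≤ 2 * q + 2 / κ + 1 := by
  have hthin : ThinDecoding v (H.image fun p => {p.1, p.2}) N := by
    refine ⟨fun e he => ?_, hN, hspan, fun a τ hτ => ?_⟩
    · obtain ⟨p, hp, rfl⟩ := Finset.mem_image.1 he
      exact Finset.card_pair (hne p hp)
    · obtain ⟨p, hp, h1, h2⟩ := hpair a τ hτ
      refine ⟨_, Finset.mem_image_of_mem _ hp, ?_⟩
      rw [Finset.insert_subset_iff, Finset.singleton_subset_iff]
      exact ⟨h1, h2⟩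
  refine hthin.finrank_span_le hκ ht hκt (fun a => by rw [Fintype.card_fin]; exact hNc a) ?_ q
    (by rw [Fintype.card_fin]; exact hq)
  rw [Fintype.card_fin]
  exact (Nat.cast_le.2 Finset.card_image_le).trans hH

/-! ### Size and number of the clusters -/

section FinalNumerics

theorem rpow_le_eight_mul_rpow {n n' β : ℝ} (hn' : n / 2 ≤ n') (hn : 0 < n) (hβ : 0 < β)
    (hβ1 : β < 1) : n ^ (1 + 2 * β) ≤ 8 * n' ^ (1 + 2 * β) := by
  have h1 : n ^ (1 + 2 * β) ≤ (2 * n') ^ (1 + 2 * β) :=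
    Real.rpow_le_rpow hn.le (by linarith) (by linarith)
  rw [Real.mul_rpow zero_le_two (by linarith)] at h1
  have h2 : (2 : ℝ) ^ (1 + 2 * β) ≤ 2 ^ (3 : ℝ) :=
    Real.rpow_le_rpow_of_exponent_le one_le_two (by linarith)
  have h3 : (2 : ℝ) ^ (3 : ℝ) = 8 := by norm_num
  refine h1.trans (mul_le_mul_of_nonneg_right (h2.trans h3.le) (Real.rpow_nonneg (by linarith) _))

theorem cluster_size_le {n n' d d' δ : ℝ} (hn : 0 < n) (hn' : n / 2 ≤ n') (hδ : 0 < δ)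
    (hd' : 0 < d') (hdd : d' ≤ d) :
    8 * (n / (4 * δ ^ 6 * d)) ≤ 2 * (n' / ((δ / 2) ^ 6 * d')) := by
  have h1 : 8 * (n / (4 * δ ^ 6 * d)) = 2 * (n / (δ ^ 6 * d)) := by
    have : d ≠ 0 := by linarith
    field_simp; ring
  rw [h1]
  refine mul_le_mul_of_nonneg_left ?_ zero_le_two
  calc n / (δ ^ 6 * d) ≤ n / (δ ^ 6 * d') := by gcongr
    _ ≤ (64 * n') / (δ ^ 6 * d') := by gcongr; linarith
    _ = n' / ((δ / 2) ^ 6 * d') := by field_simp; ring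

/-- The covering inequality gives `m ≥ δ⁷d/8`. The bound on `d²` makes the cubic target smaller than
this. -/
theorem cluster_count_ge {n n' d d' δ m P : ℝ} (hn : 0 < n) (hn' : n / 2 ≤ n') (hδ : 0 < δ)
    (hδ1 : δ ≤ 1) (hd' : 0 < d') (hdd : d' ≤ d) (hP : 0 < P) (hdP : d ^ 2 ≤ 8 * P)
    (hm : δ / 2 * n' ≤ m * (8 * (n / (4 * δ ^ 6 * d)))) :
    1 * ((δ / 2) ^ 19 * d' ^ 3 / P) ≤ m := by
  have hd : 0 < d := by linarith
  have h1 : 8 * (n / (4 * δ ^ 6 * d)) = 2 * n / (δ ^ 6 * d) := by field_simp; ring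
  rw [h1, ← mul_div_assoc, le_div_iff₀ (by positivity)] at hm
  have h2 : δ ^ 7 * d * n ≤ 8 * m * n := by
    have : δ / 2 * (n / 2) * (δ ^ 6 * d) ≤ δ / 2 * n' * (δ ^ 6 * d) := by gcongr
    nlinarith
  have h3 : δ ^ 7 * d ≤ 8 * m := le_of_mul_le_mul_right h2 hn
  have h4 : d' ^ 3 ≤ d * (8 * P) := by
    calc d' ^ 3 ≤ d ^ 3 := by gcongr
      _ = d * d ^ 2 := by ring
      _ ≤ d * (8 * P) := by gcongr
  have h5 : δ ^ 19 ≤ δ ^ 7 := pow_le_pow_of_le_one hδ.le hδ1 (by norm_num)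
  rw [one_mul, div_le_iff₀ hP]
  have hm0 : 0 ≤ m := by nlinarith [mul_pos (pow_pos hδ 7) hd]
  calc (δ / 2) ^ 19 * d' ^ 3 = δ ^ 19 * d' ^ 3 / 524288 := by ring
    _ ≤ δ ^ 7 * (d * (8 * P)) / 524288 := by gcongr
    _ = (δ ^ 7 * d) * (8 * P) / 524288 := by ring
    _ ≤ (8 * m) * (8 * P) / 524288 := by gcongr
    _ = m * P * (64 / 524288) := by ring
    _ ≤ m * P * 1 := by gcongr; norm_num
    _ = m * P := mul_one _

/-- The cover has at most `1 + 4δ⁶dY` sets. After multiplication by `δ¹⁰d'` this is at most `5 * Q`,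
and the factor `2¹⁰` coming from `δ / 2` absorbs the constants. -/
theorem cluster_count_le {n n' d d' δ m P Y Q : ℝ} (hn' : 0 < n') (hn'n : n' ≤ n) (hδ : 0 < δ)
    (hδ1 : δ ≤ 1) (hd' : 0 < d') (hdd : d' ≤ d) (hdn : d ≤ n) (hY : 0 ≤ Y) (hnQ : n ≤ Q)
    (hdQ : Y * d ^ 2 ≤ Q) (hQP : Q ≤ 8 * P) (hm : m ≤ 1 + Y * n' / (n / (4 * δ ^ 6 * d))) :
    m ≤ 1 * (P / ((δ / 2) ^ 10 * d')) := by
  have hn : 0 < n := by linarith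
  have hd : 0 < d := by linarith
  have h1 : Y * n' / (n / (4 * δ ^ 6 * d)) ≤ 4 * δ ^ 6 * d * Y := by
    calc Y * n' / (n / (4 * δ ^ 6 * d)) ≤ Y * n / (n / (4 * δ ^ 6 * d)) := by gcongr
      _ = 4 * δ ^ 6 * d * Y := by field_simp
  have hp : ∀ j : ℕ, δ ^ j ≤ 1 := fun j => pow_le_one₀ hδ.le hδ1
  have h2 : δ ^ 10 * d' ≤ Q := by
    calc δ ^ 10 * d' ≤ 1 * d' := by gcongr; exact hp 10
      _ ≤ Q := by linarith
  have h3 : 4 * δ ^ 6 * d * Y * (δ ^ 10 * d') ≤ 4 * Q := by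
    calc 4 * δ ^ 6 * d * Y * (δ ^ 10 * d') ≤ 4 * δ ^ 6 * d * Y * (δ ^ 10 * d) := by gcongr
      _ = 4 * (δ ^ 16 * (Y * d ^ 2)) := by ring
      _ ≤ 4 * (1 * Q) := by gcongr; exact hp 16
      _ = 4 * Q := by ring
  rw [one_mul, le_div_iff₀ (by positivity)]
  calc m * ((δ / 2) ^ 10 * d') ≤ (1 + 4 * δ ^ 6 * d * Y) * ((δ / 2) ^ 10 * d') := by
        gcongr; linarith
    _ = (δ ^ 10 * d' + 4 * δ ^ 6 * d * Y * (δ ^ 10 * d')) / 1024 := by ring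
    _ ≤ (Q + 4 * Q) / 1024 := by gcongr
    _ ≤ P := by linarith

end FinalNumerics

/-! ### Assembly of the clustering -/

theorem subDim_univ {n d : ℕ} {v : Fin n → EuclideanSpace ℝ (Fin d)}
    (hspan : Submodule.span ℝ (Set.range v) = ⊤) : subDim v univ = d := by
  rw [subDim, Finset.coe_univ, Set.image_univ, hspan, finrank_top, finrank_euclideanSpace_fin]

theorem dim_le_card {n d : ℕ} {v : Fin n → EuclideanSpace ℝ (Fin d)}
    (hspan : Submodule.span ℝ (Set.range v) = ⊤) : d ≤ n := by
  have h1 := finrank_range_le_card (R := ℝ) v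
  rwa [Set.finrank, hspan, finrank_top, finrank_euclideanSpace_fin, Fintype.card_fin] at h1

theorem listDim_le {n' d : ℕ} (v : Fin n' → EuclideanSpace ℝ (Fin d)) : listDim v ≤ d := by
  have h1 := Submodule.finrank_le (Submodule.span ℝ (Set.range v))
  rwa [finrank_euclideanSpace_fin] at h1

theorem IsDecoding.delta_le {n : ℕ} {E : Type*} [AddCommGroup E] [Module ℝ E] {δ : ℝ}
    {v : Fin n → E} {M : Fin n → Finset (Finset (Fin n))} (hM : IsDecoding 3 δ v M) (hδ : 0 < δ)
    (hn : 0 < n) : δ ≤ 1 / 3 ∧ 3 ≤ n := by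
  have h1 := (hM.isQMatching ⟨0, hn⟩).mul_card_le
  have h2 := hM.le_card ⟨0, hn⟩
  rw [Fintype.card_fin] at h1 h2
  have hn0 : (0 : ℝ) < n := by exact_mod_cast hn
  have h3 : (3 : ℝ) * (M ⟨0, hn⟩).card ≤ n := by exact_mod_cast h1
  have h4 : (0 : ℝ) < (M ⟨0, hn⟩).card := lt_of_lt_of_le (by positivity) h2
  have h5 : 0 < (M ⟨0, hn⟩).card := by exact_mod_cast h4
  refine ⟨?_, by omega⟩
  by_contra hcon
  push Not at hcon
  nlinarith

/-- The final clustering for a nonnegligible exponent, by all pairs. -/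
theorem exists_clustering_of_one_le {β δ : ℝ} (hβ : 1 ≤ β) (hδ : 0 < δ) {n d : ℕ}
    {v : Fin n → EuclideanSpace ℝ (Fin d)} (hspan : Submodule.span ℝ (Set.range v) = ⊤)
    {M : Fin n → Finset (Finset (Fin n))} (hM : IsDecoding 3 δ v M) (hn : 0 < n) (hd : 0 < d) :
    ∃ (m : ℕ) (S : Fin m → Finset (Fin n)),
      (∀ k, ((S k).card : ℝ) ≤ 2 * ((n : ℝ) / (δ ^ 6 * (d : ℝ)))) ∧
      1 * (δ ^ 19 * (d : ℝ) ^ 3 / (n : ℝ) ^ (1 + 2 * β)) ≤ (m : ℝ) ∧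
      (m : ℝ) ≤ 1 * ((n : ℝ) ^ (1 + 2 * β) / (δ ^ 10 * (d : ℝ))) ∧
      ∀ i, ∀ τ ∈ M i, IsClustered S τ := by
  obtain ⟨hδ3, hn3⟩ := hM.delta_le hδ hn
  -- All two-element sets: fewer than `n²` of them, while the allowance is at least `n³ / (δ¹⁰d) ≥
  -- n²`.
  obtain ⟨S, hS, hS'⟩ := exists_fin_enumeration (Finset.powersetCard 2 (univ : Finset (Fin n)))
  have hn1 : (1 : ℝ) ≤ n := by exact_mod_cast hn
  have hd0 : (0 : ℝ) < d := by exact_mod_cast hd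
  have hdn : (d : ℝ) ≤ n := by exact_mod_cast dim_le_card hspan
  have hp : ∀ j : ℕ, δ ^ j ≤ 1 := fun j => pow_le_one₀ hδ.le (by linarith)
  have hpow : (n : ℝ) ^ 3 ≤ (n : ℝ) ^ (1 + 2 * β) := by
    rw [← Real.rpow_natCast]
    exact Real.rpow_le_rpow_of_exponent_le hn1 (by push_cast; linarith)
  have hcard : (Finset.powersetCard 2 (univ : Finset (Fin n))).card = n.choose 2 := by
    rw [Finset.card_powersetCard, Finset.card_univ, Fintype.card_fin]
  refine ⟨_, S, fun k => ?_, ?_, ?_, fun i τ hτ => ?_⟩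
  · have h1 := (Finset.mem_powersetCard.1 (hS k)).2
    rw [h1]
    push_cast
    refine le_mul_of_one_le_right zero_le_two ?_
    rw [le_div_iff₀ (by positivity), one_mul]
    calc δ ^ 6 * d ≤ 1 * d := by gcongr; exact hp 6
      _ ≤ n := by linarith
  · rw [hcard, one_mul]
    have h1 : 0 < n.choose 2 := Nat.choose_pos (by omega)
    have h2 : (1 : ℝ) ≤ n.choose 2 := by exact_mod_cast h1
    refine le_trans ?_ h2
    rw [div_le_one (by positivity)]
    calc δ ^ 19 * (d : ℝ) ^ 3 ≤ 1 * (n : ℝ) ^ 3 := by gcongr; exact hp 19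
      _ ≤ _ := by linarith
  · rw [hcard, one_mul, le_div_iff₀ (by positivity)]
    have h1 : (n.choose 2 : ℝ) ≤ (n : ℝ) ^ 2 := by exact_mod_cast Nat.choose_le_pow n 2
    calc (n.choose 2 : ℝ) * (δ ^ 10 * d) ≤ (n : ℝ) ^ 2 * (1 * n) := by gcongr; exact hp 10
      _ = (n : ℝ) ^ 3 := by ring
      _ ≤ _ := hpow
  · obtain ⟨X, hXτ, hX⟩ := Finset.exists_subset_card_eq
      (by rw [(hM.isQMatching i).1 τ hτ]; norm_num : 2 ≤ τ.card)
    obtain ⟨k, hk⟩ := hS' X (Finset.mem_powersetCard.2 ⟨Finset.subset_univ _, hX⟩)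
    exact ⟨k, by rw [hk, Finset.inter_eq_right.2 hXτ, hX]⟩

set_option maxHeartbeats 1000000 in
/-- The final clustering for a small exponent and a sufficiently long list. -/
theorem exists_clustering_of_lt_one {β δ : ℝ} (hβ : 0 < β) (hβ1 : β < 1) (hδ : 0 < δ) {n d : ℕ}
    {v : Fin n → EuclideanSpace ℝ (Fin d)} (hspan : Submodule.span ℝ (Set.range v) = ⊤)
    {M : Fin n → Finset (Finset (Fin n))} (hM : IsDecoding 3 δ v M) (hn : 0 < n)
    (hdim : ∀ U : Finset (Fin n), δ ^ 2 / 288 * (n : ℝ) ≤ (U.card : ℝ) →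
      max (8 * δ ^ 6 * (d : ℝ)) ((n : ℝ) ^ (1 / 2 - β / 4 : ℝ)) ≤ (subDim v U : ℝ))
    {l k : ℕ} (hk : k = 2 ^ l) (hkβ : ((24 * k + 55 : ℕ) : ℝ) ≤ β * k ^ 2)
    (hlog : Real.log n ≤ (n : ℝ) ^ (β / 4))
    (hx1 : max 64 ((k ^ 2 + 11 * k + 12 : ℕ) : ℝ) ≤ (n : ℝ) ^ (1 / (k : ℝ) ^ 2))
    (hx2 : 2 * Real.log n + 1 ≤ (n : ℝ) ^ (1 / (k : ℝ) ^ 2))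
    (hδ15 : (1 / δ) ^ 15 ≤ (n : ℝ) ^ (β / 4)) (hδ12 : (1 / δ) ^ 12 ≤ (n : ℝ) ^ (1 / 4 : ℝ)) :
    ∃ (n' m : ℕ) (e : Fin n' ↪ Fin n) (N : Fin n' → Finset (Finset (Fin n')))
      (S : Fin m → Finset (Fin n')),
      IsDecoding 3 (δ / 2) (v ∘ e) N ∧ (n : ℝ) / 2 ≤ n' ∧
      (∀ k, ((S k).card : ℝ) ≤ 2 * ((n' : ℝ) / ((δ / 2) ^ 6 * (listDim (v ∘ e) : ℝ)))) ∧
      1 * ((δ / 2) ^ 19 * (listDim (v ∘ e) : ℝ) ^ 3 / (n' : ℝ) ^ (1 + 2 * β)) ≤ (m : ℝ) ∧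
      (m : ℝ) ≤ 1 * ((n' : ℝ) ^ (1 + 2 * β) / ((δ / 2) ^ 10 * (listDim (v ∘ e) : ℝ))) ∧
      ∀ i, ∀ τ ∈ N i, IsClustered S τ := by
  obtain ⟨hδ3, hn3⟩ := hM.delta_le hδ hn
  have hn1 : (1 : ℝ) ≤ n := by exact_mod_cast hn
  have hn0 : (0 : ℝ) < n := by linarith
  have hdn : (d : ℝ) ≤ n := by exact_mod_cast dim_le_card hspan
  have hδsq : δ ^ 2 / 288 ≤ 1 / 2592 := by nlinarith
  have hdlow : (n : ℝ) ^ (1 / 4 : ℝ) ≤ d := by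
    have h1 := (le_max_right _ _).trans (hdim univ (by
      rw [Finset.card_univ, Fintype.card_fin]; nlinarith))
    rw [subDim_univ hspan] at h1
    exact (Real.rpow_le_rpow_of_exponent_le hn1 (by linarith)).trans h1
  have hp6 : δ ^ 6 ≤ (1 / 3) ^ 6 := pow_le_pow_left₀ hδ.le hδ3 6
  -- From `d ≥ n^(1/4) ≥ δ^(-12)` and `δ⁴ ≤ 1/81`. The constant 32 is what makes `16 * s ≤ δ²n/8`.
  have hdδ : 32 ≤ δ ^ 8 * d := by
    have h1 := hδ12.trans hdlow
    rw [one_div, inv_pow, inv_le_iff_one_le_mul₀ (by positivity)] at h1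
    have h2 : δ ^ 4 ≤ (1 / 3) ^ 4 := pow_le_pow_left₀ hδ.le hδ3 4
    have h3 : 1 ≤ (δ ^ 8 * d) * δ ^ 4 := by linarith [h1, (by ring : (δ ^ 8 * d) * δ ^ 4 = δ ^ 12 * d)]
    have h4 : (δ ^ 8 * d) * δ ^ 4 ≤ (δ ^ 8 * d) * (1 / 3) ^ 4 := by gcongr
    norm_num at h4
    linarith
  have hd0 : (0 : ℝ) < d := by
    by_contra hcon
    nlinarith [mul_nonneg (pow_nonneg hδ.le 8) (by linarith : (0 : ℝ) ≤ -d)]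
  set s : ℝ := n / (4 * δ ^ 6 * d) with hs
  have hs0 : 0 < s := by positivity
  have hs1 : 1 ≤ s := by
    rw [hs, le_div_iff₀ (by positivity), one_mul]
    calc 4 * δ ^ 6 * d ≤ 4 * (1 / 3) ^ 6 * d := by gcongr
      _ ≤ (n : ℝ) := by norm_num; linarith
  have hsδ : 16 * s ≤ δ ^ 2 / 8 * n := by
    rw [hs, ← mul_div_assoc, div_le_iff₀ (by positivity)]
    nlinarith
  obtain ⟨n', e, u, H, N, hn', hu, hus, hsymm, hne, hH, hHc, hN, hNc, hNspan, hNpair, hdim'⟩ :=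
    exists_correlated_restriction hspan hM (w := 8 * δ ^ 6 * d) (α := δ ^ 2 / 288 * n) (s := s)
      (by positivity) (by nlinarith) (le_of_eq (by rw [hs]; field_simp; norm_num))
      fun U hU => (le_max_left _ _).trans (hdim U hU)
  have hn'n : n' ≤ n := by simpa using Fintype.card_le_of_embedding e
  have hn'n' : (n' : ℝ) ≤ n := by exact_mod_cast hn'n
  have hn'2 : (n : ℝ) / 2 ≤ n' := by nlinarith
  have hn'0 : (0 : ℝ) < n' := by linarith
  have hn'1 : 1 ≤ n' := by exact_mod_cast hn'0
  -- The losses `δ²n/288` and `δ²n/8` are together less than `δn/2`.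
  have hNle : ∀ a, δ / 2 * n' ≤ (N a).card := fun a => by
    refine le_trans ?_ (hNc a)
    nlinarith [mul_le_mul_of_nonneg_left hn'n' hδ.le, mul_pos hδ hn0,
      mul_le_mul_of_nonneg_right hδ3 (mul_pos hδ hn0).le]
  have hd'0 : (0 : ℝ) < listDim (v ∘ e) := lt_of_lt_of_le (by positivity) hdim'
  have hd'd : (listDim (v ∘ e) : ℝ) ≤ d := by exact_mod_cast listDim_le (v ∘ e)
  have hsn' : s ≤ n' := by nlinarith
  -- the dimension bound
  have hd2 : (d : ℝ) ^ 2 ≤ (n : ℝ) ^ (1 + β / 2) := by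
    have hlog1 : 1 ≤ Real.log n := by
      rw [Real.le_log_iff_exp_le hn0]
      have h3 : (3 : ℝ) ≤ n := by exact_mod_cast hn3
      linarith [Real.exp_one_lt_d9]
    -- This is the contraction rate `κ / (4 * t)` for `κ = δ / 2` and `t = 16 * s`.
    set y : ℝ := δ / 2 / (4 * (16 * s)) with hy
    have hyeq : y = δ ^ 7 * d / (32 * n) := by rw [hy, hs]; field_simp; norm_num
    have hy0 : 0 < y := by positivity
    have hy1 : δ / 2 ≤ 4 * (16 * s) := by linarith
    have hy1' : y ≤ 1 := by rw [hy, div_le_one (by positivity)]; exact hy1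
    have hq1 : Real.log n' / y ≤ ⌈Real.log n / y⌉₊ := by
      refine le_trans ?_ (Nat.le_ceil _)
      gcongr
    have h1 := listDim_le_of_pairs hne hN hNspan hNpair (half_pos hδ) (by positivity) hy1 hNle hHc
      (natCast_mul_one_sub_pow_le_one hn'1 hy0 hy1' hq1)
    have hq2 : (⌈Real.log n / y⌉₊ : ℝ) ≤ 32 * n * Real.log n / (δ ^ 7 * d) + 1 := by
      refine (Nat.ceil_lt_add_one (by positivity)).le.trans (le_of_eq ?_)
      rw [hyeq]; field_simp
    refine (sq_le_of_le_inv_mul hδ hδ3 hd0 hdn hlog1 hq2 (hdim'.trans h1)).trans ?_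
    calc (n : ℝ) * Real.log n * (1 / δ) ^ 15 ≤ n * (n : ℝ) ^ (β / 4) * (n : ℝ) ^ (β / 4) := by gcongr
      _ = (n : ℝ) ^ (1 + β / 2) := by
        nth_rewrite 1 [← Real.rpow_one (n : ℝ)]
        rw [← Real.rpow_add hn0, ← Real.rpow_add hn0]; congr 1; ring
  -- the cover
  set x : ℝ := (n : ℝ) ^ (1 / (k : ℝ) ^ 2) with hx
  have hk0 : (0 : ℝ) < k := by rw [hk]; positivity
  have hxk : x ^ k ^ 2 = n := by
    rw [hx, ← Real.rpow_natCast, ← Real.rpow_mul hn0.le]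
    push_cast
    rw [one_div, inv_mul_cancel₀ (by positivity), Real.rpow_one]
  have hxY : x ^ (24 * k + 55) ≤ (n : ℝ) ^ β := by
    rw [hx, ← Real.rpow_natCast, ← Real.rpow_mul hn0.le]
    refine Real.rpow_le_rpow_of_exponent_le hn1 ?_
    rw [one_div, ← div_eq_inv_mul, div_le_iff₀ (by positivity)]
    exact hkβ
  obtain ⟨Ss, hSs, hcov, hSsc⟩ := exists_cover_of_correlated hsymm hu hH hs1
    (by rw [Fintype.card_fin]; exact hsn') hus hk ((le_max_left _ _).trans hx1)
    ((le_max_right _ _).trans hx1) (by rw [Fintype.card_fin, hxk]; exact hn'n')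
    (by rw [Fintype.card_fin]; exact (natCast_log_add_one_le hn'n hn).trans hx2)
  rw [Fintype.card_fin] at hSsc
  obtain ⟨S, hS, hS'⟩ := exists_fin_enumeration Ss
  have hP := rpow_le_eight_mul_rpow hn'2 hn0 hβ hβ1
  refine ⟨n', Ss.card, e, N, S, ⟨hN, fun a => by rw [Fintype.card_fin]; exact hNle a, hNspan⟩, hn'2,
    fun j => (hSs _ (hS j)).trans (cluster_size_le hn0 hn'2 hδ hd'0 hd'd), ?_, ?_, ?_⟩
  · refine cluster_count_ge hn0 hn'2 hδ (by linarith) hd'0 hd'd (Real.rpow_pos_of_pos hn'0 _) ?_ ?_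
    · exact hd2.trans ((Real.rpow_le_rpow_of_exponent_le hn1 (by linarith)).trans hP)
    · refine (hNle ⟨0, hn'1⟩).trans ((hN ⟨0, hn'1⟩).card_le_of_clustered hSs fun τ hτ => ?_)
      obtain ⟨p, hp, hp1, -⟩ := hNpair _ τ hτ
      obtain ⟨X, hX, hX1, -⟩ := hcov p hp
      exact ⟨X, hX, p.1, hp1, hX1⟩
  · refine cluster_count_le hn'0 hn'n' hδ (by linarith) hd'0 hd'd hdn
      (Real.rpow_nonneg hn0.le β) (Q := (n : ℝ) ^ (1 + 2 * β)) ?_ ?_ hP (hSsc.trans ?_)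
    · nth_rewrite 1 [← Real.rpow_one (n : ℝ)]
      exact Real.rpow_le_rpow_of_exponent_le hn1 (by linarith)
    · calc (n : ℝ) ^ β * (d : ℝ) ^ 2 ≤ (n : ℝ) ^ β * (n : ℝ) ^ (1 + β / 2) := by gcongr
        _ = (n : ℝ) ^ (β + (1 + β / 2)) := (Real.rpow_add hn0 _ _).symm
        _ ≤ _ := Real.rpow_le_rpow_of_exponent_le hn1 (by linarith)
    · gcongr
  · intro i τ hτ
    obtain ⟨p, hp, hp1, hp2⟩ := hNpair i τ hτ
    obtain ⟨X, hX, hX1, hX2⟩ := hcov p hp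
    obtain ⟨j, rfl⟩ := hS' X hX
    exact ⟨j, two_le_card_inter (hne p hp) hp1 hp2 hX1 hX2⟩

theorem mainTheorem3 :
    -- the absolute constants hidden in the three `O` / `Ω` bounds
    ∃ A a B : ℝ, 0 < A ∧ 0 < a ∧ 0 < B ∧
    ∀ β : ℝ, 0 < β →
    -- the exponent hidden in `n > (1/δ)^{ω(1)}`
    ∃ C : ℝ, 0 < C ∧
    ∀ (n d : ℕ) (δ : ℝ) (v : Fin n → EuclideanSpace ℝ (Fin d)),
      0 < δ →
      (1 / δ) ^ C < (n : ℝ) →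
      Submodule.span ℝ (Set.range v) = ⊤ →
      IsLCC 3 δ v →
      (∀ U : Finset (Fin n), δ ^ 2 / 288 * (n : ℝ) ≤ (U.card : ℝ) →
        max (8 * δ ^ 6 * (d : ℝ)) ((n : ℝ) ^ (1 / 2 - β / 4 : ℝ)) ≤ (subDim v U : ℝ)) →
      -- the sublist `v ∘ e`, of length `n'` and dimension `d'`, with its matchings `M`
      ∃ (n' d' m : ℕ) (δ' : ℝ) (e : Fin n' ↪ Fin n)
        (M : Fin n' → Finset (Finset (Fin n'))) (S : Fin m → Finset (Fin n')),
        IsDecoding 3 δ' (v ∘ e) M ∧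
        listDim (v ∘ e) = d' ∧
        d' ≤ d ∧
        δ / 10 * (n : ℝ) ≤ (n' : ℝ) ∧
        δ ^ 2 / 4 ≤ δ' ∧
        (∀ k, ((S k).card : ℝ) ≤ A * ((n' : ℝ) / (δ' ^ 6 * (d' : ℝ)))) ∧
        a * (δ' ^ 19 * (d' : ℝ) ^ 3 / (n' : ℝ) ^ (1 + 2 * β)) ≤ (m : ℝ) ∧
        (m : ℝ) ≤ B * ((n' : ℝ) ^ (1 + 2 * β) / (δ' ^ 10 * (d' : ℝ))) ∧
        ∀ i, ∀ τ ∈ M i, IsClustered S τ := by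

  refine ⟨2, 1, 1, two_pos, one_pos, one_pos, fun β hβ => ?_⟩
  obtain ⟨l, hl⟩ := exists_two_pow_mul_le hβ
  set k : ℕ := 2 ^ l with hk
  have hk0 : (0 : ℝ) < k := by rw [hk]; positivity
  obtain ⟨N₀, hN₀⟩ := exists_threshold (r := 1 / (k : ℝ) ^ 2) (β := β / 4) (by positivity)
    (by positivity) (max 64 ((k ^ 2 + 11 * k + 12 : ℕ) : ℝ))
  -- The three terms give `(1/δ)¹² ≤ n^(1/4)`, `(1/δ)¹⁵ ≤ n^(β/4)` and `n ≥ N₀`; the last follows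
  -- from Bernoulli's inequality, since `δ ≤ 1/3`.
  refine ⟨max (max 48 (60 / β)) N₀, by positivity, fun n d δ v hδ hn hspan ⟨M, hM⟩ hdim => ?_⟩
  set C := max (max 48 (60 / β)) N₀ with hC
  have hn0 : (0 : ℝ) < n := lt_of_le_of_lt (by positivity) hn
  have hn' : 0 < n := by exact_mod_cast hn0
  obtain ⟨hδ3, hn3⟩ := hM.delta_le hδ hn'
  have hd0 : 0 < d := by
    have h1 := (le_max_right _ _).trans (hdim univ (by
      rw [Finset.card_univ, Fintype.card_fin]
      exact mul_le_of_le_one_left hn0.le (by nlinarith)))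
    rw [subDim_univ hspan] at h1
    have h2 : (0 : ℝ) < d := lt_of_lt_of_le (by positivity) h1
    exact_mod_cast h2
  rcases le_or_gt 1 β with hβ1 | hβ1
  · obtain ⟨m, S, h1, h2, h3, h4⟩ := exists_clustering_of_one_le hβ1 hδ hspan hM hn' hd0
    have hdim' : listDim v = d := by
      rw [listDim, hspan, finrank_top, finrank_euclideanSpace_fin]
    exact ⟨n, d, m, δ, Function.Embedding.refl _, M, S, hM, hdim', le_rfl, by nlinarith,
      by nlinarith, h1, h2, h3, h4⟩
  · have hC48 : 48 ≤ C := (le_max_left _ _).trans (le_max_left _ _)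
    have hCβ : 60 / β ≤ C := (le_max_right _ _).trans (le_max_left _ _)
    have hδ1 : 3 ≤ 1 / δ := by rw [le_div_iff₀ hδ]; linarith
    have hpow : ∀ (j : ℕ) (r : ℝ), 0 ≤ r → (j : ℝ) ≤ C * r → (1 / δ) ^ j ≤ (n : ℝ) ^ r := by
      intro j r hr hj
      rw [← Real.rpow_natCast]
      refine (Real.rpow_le_rpow_of_exponent_le (by linarith) hj).trans ?_
      rw [Real.rpow_mul (by positivity)]
      exact Real.rpow_le_rpow (by positivity) hn.le hr
    have hnN : N₀ ≤ n := by
      refine (le_max_right _ _ : N₀ ≤ C).trans (le_trans ?_ hn.le)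
      have h1 := one_add_mul_self_le_rpow_one_add (s := 1 / δ - 1) (by linarith) (p := C) (by linarith)
      rw [add_sub_cancel] at h1
      nlinarith
    obtain ⟨h1, h2, h3⟩ := hN₀ n hnN
    obtain ⟨n', m, e, N, S, g1, g2, g3, g4, g5, g6⟩ := exists_clustering_of_lt_one hβ hβ1 hδ hspan hM
      hn' hdim hk hl h1 h2 h3 (hpow 15 _ (by positivity) (by
        rw [div_le_iff₀ hβ] at hCβ; push_cast; linarith))
      (hpow 12 _ (by positivity) (by push_cast; linarith))
    exact ⟨n', _, m, δ / 2, e, N, S, g1, rfl, listDim_le _, by nlinarith, by nlinarith, g3, g4, g5, g6⟩
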